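/- **Theorem (Existence of an adiabatic invariant).** Let $M$ be a smooth manifold (finite-dimensional, Hausdorff, second countable, without boundary) and let $\Gamma$ be a finite-dimensional real vector space. "Smooth" means $C^\infty$, and a $\gamma$-dependent object on $M$ is smooth if it is smooth jointly in $(m,\gamma)\in M\times\Gamma$. *Setting.* Let $\Omega_\gamma$, $\gamma\in\Gamma$, be a smooth $\gamma$-dependent $2$-form on $M$ with $\mathbf{d}\Omega_\gamma=0$ for each $\gamma$, and suppose that $\Omega_\gamma=-\mathbf{d}\vartheta_\gamma$ for some smooth $\gamma$-dependent $1$-form $\vartheta_\gamma$. Let $\Phi_\theta$, $\theta\in U(1)$, be a smooth $U(1)$-action on $M$ with infinitesimal generator $R_0$, and let $F:M\times\Gamma\to M$, $F_\gamma=F(\cdot,\gamma)$, be a non-resonant presymplectic nearly-periodic map with limiting roto-rate $R_0$. That is, $F$ is smooth, each $F_\gamma$ is a diffeomorphism of $M$, $F_0=\Phi_{\theta_0}$ for some $\theta_0$ that is not a rational multiple of $2\pi$, and $F_\gamma^*\Omega_\gamma=\Omega_\gamma$ for each $\gamma$. Let $R_\gamma=R_0+R_1[\gamma]+R_2[\gamma,\gamma]+\cdots$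 be a roto-rate for $F$, i.e. a formal power series in $\gamma$ with zeroth coefficient the limiting roto-rate $R_0$, whose coefficients are homogeneous polynomial maps from $\Gamma$ into smooth vector fields on $M$, such that $F_\gamma^*R_\gamma=R_\gamma$ and $\exp(2\pi\mathcal{L}_{R_\gamma})=1$ in the sense of formal power series in $\gamma$. Here $\exp(\theta\mathcal{L}_{R_\gamma})$ is the solution of $\frac{d}{d\theta}\exp(\theta\mathcal{L}_{R_\gamma})=\mathcal{L}_{R_\gamma}\exp(\theta\mathcal{L}_{R_\gamma})$ that equals $1$ at $\theta=0$. *Assumption.* Suppose that at least one of the following conditions holds. 1. $F$ is Hamiltonian: there are a smooth $(t,\gamma)$-dependent vector field $Y_{t,\gamma}$ and a smooth $(t,\gamma)$-dependent function $H_{t,\gamma}$ on $M$, $t\in\mathbb{R}$, with $\iota_{Y_{t,\gamma}}\Omega_\gamma=\mathbf{d}H_{t,\gamma}$, such that for each $\gamma$ the map $F_\gamma$ is the time-one flow (from $t=0$ to $t=1$) of $Y_{t,\gamma}$. 2. $M$ is connected and $R_0$ has at least one zero. *Conclusion.* There is a smooth $\gamma$-dependent $1$-form $\theta_\gamma$ on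 $M$ such that, in the sense of formal power series in $\gamma$, $$\mathcal{L}_{R_\gamma}\theta_\gamma=0,\qquad -\mathbf{d}\theta_\gamma=\Omega_\gamma ,$$ and such that $\mu_\gamma=\iota_{R_\gamma}\theta_\gamma$ satisfies $F_\gamma^*\mu_\gamma=\mu_\gamma$ in the sense of formal power series in $\gamma$; that is, $\mu_\gamma$ is an adiabatic invariant for $F$. -/

import Mathlib

open scoped Manifold ContDiff Topology

noncomputable section

/-! `M` is a manifold without boundary modelled on the finite-dimensional space `E`, and `Γ` is a
finite-dimensional parameter space; these assumptions are made in the theorem. -/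

namespace NearlyPeriodic

section FormalSeries

/-- A formal power series `a₀ + a₁[γ] + a₂[γ, γ] + ⋯` in `γ : Γ` with coefficients in the real
vector space `V`: the `n`-th term is the homogeneous polynomial map `γ ↦ aₙ[γ, …, γ]` of degree `n`,
given by a multilinear map. -/
def FormalSeries (Γ : Type*) [AddCommGroup Γ] [Module ℝ Γ] (V : Type*) [AddCommGroup V]
    [Module ℝ V] : Type _ :=
  (n : ℕ) → MultilinearMap ℝ (fun _ : Fin n => Γ) V

variable {Γ : Type*} {V : Type*}

/-- The homogeneous term `aₙ[γ, …, γ]`. -/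
def FormalSeries.term [AddCommGroup Γ] [Module ℝ Γ] [AddCommGroup V] [Module ℝ V]
    (a : FormalSeries Γ V) (n : ℕ) (γ : Γ) : V :=
  a n (fun _ => γ)

/-- The partial sum `a₀ + a₁[γ] + ⋯ + a_N[γ, …, γ]`. -/
def FormalSeries.partialSum [AddCommGroup Γ] [Module ℝ Γ] [AddCommGroup V] [Module ℝ V]
    (a : FormalSeries Γ V) (N : ℕ) (γ : Γ) : V :=
  ∑ n ∈ Finset.range (N + 1), a.term n γ

/-- Vanishing in the sense of formal power series in `γ`. Here `f N γ` is an expression, smooth in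
`γ`, in which every formal power series has been replaced by its partial sum up to degree `N`; this
does not affect the Taylor coefficients at `γ = 0` of degree at most `N`. So the formal expression
vanishes if and only if, for every `N`, all Taylor coefficients of `f N` of degree at most `N`
vanish. -/
def FormallyZero [NormedAddCommGroup Γ] [NormedAddCommGroup V] (f : ℕ → Γ → V) : Prop :=
  ∀ N : ℕ, f N =O[𝓝 0] fun γ : Γ => ‖γ‖ ^ (N + 1)

end FormalSeries

variable {E : Type*} [NormedAddCommGroup E] [NormedSpace ℝ E]
  {M : Type*} [TopologicalSpace M] [ChartedSpace E M]
  {Γ : Type*} [NormedAddCommGroup Γ] [NormedSpace ℝ Γ]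

section Tensors

variable (E M) in
/-- Smooth vector fields on `M`. -/
abbrev SmoothVF [IsManifold 𝓘(ℝ, E) ∞ M] : Type _ :=
  Cₛ^∞⟮𝓘(ℝ, E); E, (TangentSpace 𝓘(ℝ, E) : M → Type _)⟯

variable (E M) in
/-- (Not necessarily smooth) vector fields on `M`. -/
abbrev VF : Type _ := (m : M) → TangentSpace 𝓘(ℝ, E) m

variable (E M) in
/-- (Not necessarily smooth) `1`-forms on `M`. -/
abbrev OneForm : Type _ := (m : M) → TangentSpace 𝓘(ℝ, E) m →L[ℝ] ℝ

variable (E M) in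
/-- (Not necessarily smooth) bilinear forms on `M`; the `2`-forms are the alternating ones. -/
abbrev BilinForm : Type _ :=
  (m : M) → TangentSpace 𝓘(ℝ, E) m →L[ℝ] TangentSpace 𝓘(ℝ, E) m →L[ℝ] ℝ

/-- `X` is a smooth `γ`-dependent vector field: `(m, γ) ↦ X_γ(m)` is smooth into `TM`. -/
def SmoothVFFamily [IsManifold 𝓘(ℝ, E) ∞ M] (X : Γ → VF E M) : Prop :=
  ContMDiff (𝓘(ℝ, E).prod 𝓘(ℝ, Γ)) (𝓘(ℝ, E).prod 𝓘(ℝ, E)) ∞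
    (fun p : M × Γ => Bundle.TotalSpace.mk' E
      (E := (TangentSpace 𝓘(ℝ, E) : M → Type _)) p.1 (X p.2 p.1))

/-- `θ` is a smooth `γ`-dependent `1`-form: `(m, γ) ↦ θ_γ(m)` is smooth into `T*M`. -/
def SmoothOneFormFamily [IsManifold 𝓘(ℝ, E) ∞ M] (θ : Γ → OneForm E M) : Prop :=
  ContMDiff (𝓘(ℝ, E).prod 𝓘(ℝ, Γ)) (𝓘(ℝ, E).prod 𝓘(ℝ, E →L[ℝ] ℝ)) ∞
    (fun p : M × Γ => Bundle.TotalSpace.mk' (E →L[ℝ] ℝ)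
      (E := fun m : M => TangentSpace 𝓘(ℝ, E) m →L[ℝ] ℝ) p.1 (θ p.2 p.1))

/-- `Ω` is a smooth `γ`-dependent section of `T*M ⊗ T*M`. -/
def SmoothBilinFormFamily [IsManifold 𝓘(ℝ, E) ∞ M] (Ω : Γ → BilinForm E M) : Prop :=
  ContMDiff (𝓘(ℝ, E).prod 𝓘(ℝ, Γ)) (𝓘(ℝ, E).prod 𝓘(ℝ, E →L[ℝ] E →L[ℝ] ℝ)) ∞
    (fun p : M × Γ => Bundle.TotalSpace.mk' (E →L[ℝ] E →L[ℝ] ℝ)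
      (E := fun m : M => TangentSpace 𝓘(ℝ, E) m →L[ℝ] TangentSpace 𝓘(ℝ, E) m →L[ℝ] ℝ)
      p.1 (Ω p.2 p.1))

/-- The derivative `X f` of a function along a vector field. -/
def lieFun (X : VF E M) (f : M → ℝ) (m : M) : ℝ :=
  mvfderiv 𝓘(ℝ, E) f m (X m)

/-- `(L_X θ)(Y) = X(θ(Y)) - θ([X, Y])`. -/
def lieOneForm (X : VF E M) (θ : OneForm E M) (Y : VF E M) (m : M) : ℝ :=
  lieFun X (fun x => θ x (Y x)) m - θ m (VectorField.mlieBracket 𝓘(ℝ, E) X Y m)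

/-- `dθ(X, Y) = X(θ(Y)) - Y(θ(X)) - θ([X, Y])`. -/
def dOneForm (θ : OneForm E M) (X Y : VF E M) (m : M) : ℝ :=
  lieFun X (fun x => θ x (Y x)) m - lieFun Y (fun x => θ x (X x)) m
    - θ m (VectorField.mlieBracket 𝓘(ℝ, E) X Y m)

/-- `dΩ(X, Y, Z)` for a `2`-form `Ω`, by the invariant formula. -/
def dTwoForm (Ω : BilinForm E M) (X Y Z : VF E M) (m : M) : ℝ :=
  lieFun X (fun x => Ω x (Y x) (Z x)) m - lieFun Y (fun x => Ω x (X x) (Z x)) m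
    + lieFun Z (fun x => Ω x (X x) (Y x)) m
    - Ω m (VectorField.mlieBracket 𝓘(ℝ, E) X Y m) (Z m)
    + Ω m (VectorField.mlieBracket 𝓘(ℝ, E) X Z m) (Y m)
    - Ω m (VectorField.mlieBracket 𝓘(ℝ, E) Y Z m) (X m)

/-- `(M, Ω_γ)` is a `γ`-dependent presymplectic manifold: `Ω` is a smooth `γ`-dependent `2`-form
with `dΩ_γ = 0` for each `γ`. -/
structure IsPresymplectic [IsManifold 𝓘(ℝ, E) ∞ M] (Ω : Γ → BilinForm E M) : Prop where
  smooth : SmoothBilinFormFamily Ω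
  alternating : ∀ (γ : Γ) (m : M) (v : TangentSpace 𝓘(ℝ, E) m), Ω γ m v v = 0
  closed : ∀ (γ : Γ) (X Y Z : SmoothVF E M) (m : M), dTwoForm (Ω γ) X Y Z m = 0

/-- `Ω_γ = -dϑ_γ` for some smooth `γ`-dependent `1`-form `ϑ_γ`. -/
def IsExact [IsManifold 𝓘(ℝ, E) ∞ M] (Ω : Γ → BilinForm E M) : Prop :=
  ∃ ϑ : Γ → OneForm E M, SmoothOneFormFamily ϑ ∧
    ∀ (γ : Γ) (X Y : SmoothVF E M) (m : M), Ω γ m (X m) (Y m) = -dOneForm (ϑ γ) X Y m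

end Tensors

section Maps

/-- `F` is a nearly-periodic map with respect to the given smooth `U(1)`-action on `M`, with
`F₀ = Φ_{θ₀}`, where `Φ_θ` is the action of `exp(iθ)`. -/
structure IsNearlyPeriodicMap [IsManifold 𝓘(ℝ, E) ∞ M] [MulAction Circle M]
    (F : Γ → M → M) (θ₀ : ℝ) : Prop where
  smooth : ContMDiff (𝓘(ℝ, E).prod 𝓘(ℝ, Γ)) 𝓘(ℝ, E) ∞ (fun p : M × Γ => F p.2 p.1)
  diffeo : ∀ γ : Γ, ∃ e : M ≃ₘ^∞⟮𝓘(ℝ, E), 𝓘(ℝ, E)⟯ M, ∀ m : M, e m = F γ m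
  zero : ∀ m : M, F 0 m = Circle.exp θ₀ • m

/-- The angle `θ₀` is not a rational multiple of `2π`. -/
def NonResonant (θ₀ : ℝ) : Prop :=
  ∀ q : ℚ, θ₀ ≠ q * (2 * Real.pi)

variable (E) in
/-- The infinitesimal generator `R₀(m) = d/dθ|_{θ=0} Φ_θ(m)` of the `U(1)`-action. -/
def generator [MulAction Circle M] (m : M) : TangentSpace 𝓘(ℝ, E) m :=
  (mfderiv 𝓘(ℝ, ℝ) 𝓘(ℝ, E) (fun θ : ℝ => Circle.exp θ • m) 0 (1 : ℝ) : E)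

/-- `F_γ^*Ω_γ = Ω_γ` for each `γ`. -/
def PreservesForm (F : Γ → M → M) (Ω : Γ → BilinForm E M) : Prop :=
  ∀ (γ : Γ) (m : M) (v w : TangentSpace 𝓘(ℝ, E) m),
    Ω γ (F γ m) (mfderiv 𝓘(ℝ, E) 𝓘(ℝ, E) (F γ) m v) (mfderiv 𝓘(ℝ, E) 𝓘(ℝ, E) (F γ) m w)
      = Ω γ m v w

/-- `F` is the time-one flow of the time-dependent vector field `Y`: every point `m` is the starting
point of an integral curve of `Y` on `[0, 1]`, which ends in `F m`. -/
def IsTimeOneFlow (Y : ℝ → VF E M) (F : M → M) : Prop :=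
  ∀ m : M, ∃ c : ℝ → M, c 0 = m ∧ c 1 = F m ∧
    ∀ t ∈ Set.Icc (0 : ℝ) 1,
      HasMFDerivWithinAt 𝓘(ℝ, ℝ) 𝓘(ℝ, E) c (Set.Icc 0 1) t
        ((1 : ℝ →L[ℝ] ℝ).smulRight (Y t (c t)))

/-- `F_γ` is, for each `γ`, the time-one flow of a smooth `(t, γ)`-dependent vector field `Y_{t,γ}`
with `ι_{Y_{t,γ}} Ω_γ = dH_{t,γ}` for a smooth `(t, γ)`-dependent function `H_{t,γ}`. -/
def IsHamiltonian [IsManifold 𝓘(ℝ, E) ∞ M] (F : Γ → M → M) (Ω : Γ → BilinForm E M) : Prop :=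
  ∃ (Y : ℝ × Γ → VF E M) (H : ℝ × Γ → M → ℝ),
    SmoothVFFamily Y ∧
    ContMDiff (𝓘(ℝ, E).prod 𝓘(ℝ, ℝ × Γ)) 𝓘(ℝ, ℝ) ∞ (fun p : M × (ℝ × Γ) => H p.2 p.1) ∧
    (∀ (t : ℝ) (γ : Γ) (m : M) (v : TangentSpace 𝓘(ℝ, E) m),
      Ω γ m (Y (t, γ) m) v = mvfderiv 𝓘(ℝ, E) (H (t, γ)) m v) ∧
    ∀ γ : Γ, IsTimeOneFlow (fun t => Y (t, γ)) (F γ)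

end Maps

section RotoRate

/-- `u_θ = exp(θ L_R) f` in the sense of formal power series. As `R₀` need not vanish, `exp(θ L_R)`
is the solution with value `1` at `θ = 0` of `d/dθ exp(θ L_R) = L_R exp(θ L_R)`; in degree `n` this
reads `d/dθ uₙ(θ) = ∑_{k + l = n} L_{R_k} u_l(θ)`. -/
structure IsFormalExp [IsManifold 𝓘(ℝ, E) ∞ M] (R : FormalSeries Γ (SmoothVF E M))
    (f : C^∞⟮𝓘(ℝ, E), M; ℝ⟯) (u : ℝ → FormalSeries Γ C^∞⟮𝓘(ℝ, E), M; ℝ⟯) : Prop where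
  smooth : ∀ (n : ℕ) (γ : Γ), ContMDiff (𝓘(ℝ, ℝ).prod 𝓘(ℝ, E)) 𝓘(ℝ, ℝ) ∞
    (fun p : ℝ × M => (u p.1).term n γ p.2)
  init : ∀ (n : ℕ) (γ : Γ), (u 0).term n γ = if n = 0 then f else 0
  deriv : ∀ (n : ℕ) (γ : Γ) (m : M) (θ : ℝ),
    HasDerivAt (fun s : ℝ => (u s).term n γ m)
      (∑ kl ∈ Finset.HasAntidiagonal.antidiagonal n, lieFun (R.term kl.1 γ) ((u θ).term kl.2 γ) m) θ

/-- A tangent vector as an element of the model space `E`, by means of the preferred chart at `m`.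
It serves to measure tangent vectors at a fixed point by a norm. -/
def tangentCoord {m : M} (v : TangentSpace 𝓘(ℝ, E) m) : E := v

/-- `R` is a roto-rate for the nearly-periodic map `F`: `R₀` is the generator of the circle action,
`F_γ^*R_γ = R_γ` and `exp(2π L_{R_γ}) = 1` in the sense of formal power series. The last condition
is imposed on functions; since `exp(2π L_R)` is an automorphism of the tensor algebra that commutes
with `d`, it then holds on all tensor fields. -/
structure IsRotoRate [IsManifold 𝓘(ℝ, E) ∞ M] [MulAction Circle M]
    (F : Γ → M → M) (R : FormalSeries Γ (SmoothVF E M)) : Prop where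
  limiting : ∀ (γ : Γ) (m : M), R.term 0 γ m = generator E m
  invariant : ∀ m : M, FormallyZero (fun N γ =>
    tangentCoord (VectorField.mpullback 𝓘(ℝ, E) 𝓘(ℝ, E) (F γ) (R.partialSum N γ) m)
      - tangentCoord (R.partialSum N γ m))
  periodic : ∀ f : C^∞⟮𝓘(ℝ, E), M; ℝ⟯, ∃ u : ℝ → FormalSeries Γ C^∞⟮𝓘(ℝ, E), M; ℝ⟯,
    IsFormalExp R f u ∧
      ∀ (n : ℕ) (γ : Γ), (u (2 * Real.pi)).term n γ = if n = 0 then f else 0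

/-- `L_{R_γ}θ_γ = 0` in the sense of formal power series. -/
def FormallyInvariant [IsManifold 𝓘(ℝ, E) ∞ M] (R : FormalSeries Γ (SmoothVF E M))
    (θ : Γ → OneForm E M) : Prop :=
  ∀ (Y : SmoothVF E M) (m : M),
    FormallyZero (fun N γ => lieOneForm (R.partialSum N γ) (θ γ) Y m)

/-- `-dθ_γ = Ω_γ` in the sense of formal power series. -/
def FormalPrimitive [IsManifold 𝓘(ℝ, E) ∞ M] (θ : Γ → OneForm E M)
    (Ω : Γ → BilinForm E M) : Prop :=
  ∀ (X Y : SmoothVF E M) (m : M),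
    FormallyZero (fun _ γ => -dOneForm (θ γ) X Y m - Ω γ m (X m) (Y m))

/-- The truncation `ι_{R^N_γ}θ_γ` of `μ_γ = ι_{R_γ}θ_γ`, where `R^N_γ` is the partial sum of `R_γ`
up to degree `N`. It has the same Taylor coefficients in `γ` as `μ_γ` up to degree `N`. -/
def momentTrunc [IsManifold 𝓘(ℝ, E) ∞ M] (R : FormalSeries Γ (SmoothVF E M))
    (θ : Γ → OneForm E M) (N : ℕ) (γ : Γ) (m : M) : ℝ :=
  θ γ m (R.partialSum N γ m)

/-- `μ_γ = ι_{R_γ}θ_γ` satisfies `F_γ^*μ_γ = μ_γ` in the sense of formal power series. -/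
def IsAdiabaticInvariant [IsManifold 𝓘(ℝ, E) ∞ M] (F : Γ → M → M)
    (R : FormalSeries Γ (SmoothVF E M)) (θ : Γ → OneForm E M) : Prop :=
  ∀ m : M, FormallyZero (fun N γ => momentTrunc R θ N γ (F γ m) - momentTrunc R θ N γ m)

end RotoRate

end NearlyPeriodic

end

/-!
Let `Ω = -dϑ`. Every primitive used below has the form `θ = ϑ - dg` with a smooth function `g` that
depends on the parameter, so that `-dθ = Ω` holds exactly. The two remaining assertions are
statements about formal power series: `L_R θ = 0`, and `F^*μ = μ` for the moment `μ = ι_R θ`.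

*Normal form.* By `eq_transCoeff_normalGen` a formal vector field `R = R₀ + R₁ + ⋯` with
`exp(2π L_R) = 1` is conjugate to `R₀` by a formal Lie transformation `T`. The generators of `T` are
found degree by degree: averaging over the circle action inverts `L_{R₀}` on the fields of average
zero (`lie_homVF`), and an averaged obstruction `X` would make the flow of `R` move every function
`f` by `2π X f` to leading order, so it vanishes. One consequence is used throughout
(`exists_lie_eq_of_leading`): the leading coefficient of a series `L_R u` lies in the image of
`L_{R₀}`.

*Choice of `g`.* The homological equation `ι_R ϑ = μ + L_R g` with `L_R μ = 0` is solved in formal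
power series, again by averaging (`homologicalPair_eq`, `cauchy_homologicalPair_snd`). The
coefficients of `g` are homogeneous in the parameter, and Borel's lemma on manifolds
(`exists_borel_family`) provides a smooth `g` with these coefficients
(`exists_normalizing_function`). All identities of formal power series are checked along the lines
`t ↦ t γ`, where they become identities between sequences of Taylor coefficients; `isBigO_of_lines`
leads back to the estimates in `γ`.

*Invariance of `θ`.* Put `δ = L_R θ = dμ - ι_R Ω` and `ν = F^*μ - μ`. As `F` preserves `R` and `Ω`,
one has `L_R ν = 0` and `dν = F^*δ - δ`. Suppose that the coefficients of `δ` and of `dν` vanish in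
degrees less than `n`. Then `νₙ` is invariant under `R₀`, and `dνₙ = Φ_{θ₀}^*δₙ - δₙ`. Along the
orbits of the circle action this says that a `2π`-periodic function has constant increments over
steps of length `θ₀`. Hence these increments are zero, `dνₙ = 0`, and, as `θ₀ / 2π` is irrational,
`δₙ` is invariant under all rotations. A rotation-invariant form in the image of `L_{R₀}` is zero
(`eq_zero_of_rot_invariant`). Therefore `δ = 0` and `ν` is locally constant (`defect_eq_zero`).

*Invariance of `μ`.* Since `F^*R = R`, one has `ν = κ(R)` for the closed form `κ = F^*θ - θ`. As `ν`
is locally constant, conjugation gives `ν = (T⁻¹κ)(R₀)` (`cauchy_apply_eq`). If `M` is connected and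
`R₀` has a zero, then `ν` vanishes there, hence everywhere (`nu_eq_zero_of_connected`). In general
`T⁻¹κ` differs from `κ` by an exact form, so the constants `νₙ` are the averages of `κₙ(R₀)` over
the orbits (`nu_eq_zero_of_integral`). For a Hamiltonian map these averages vanish, being fluxes
through closed loops: by the first variation formula the action of the trajectory which starts at
`Φ_s m` has the `s`-derivative `κ(R₀)`, and this action is periodic in `s`
(`integral_orbit_eq_zero`). The first variation formula is proved by comparing nearby integral
curves in charts (`exists_two_curve_bound`), which avoids the smooth dependence of solutions on
initial values.
-/

open scoped Manifold ContDiff Topology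

noncomputable section

set_option linter.style.haveILetI false
set_option linter.unusedSectionVars false

/-! ### Parameter integrals on manifolds -/

namespace NearlyPeriodic
open MeasureTheory Set

section Calculus

/-- Integrals over a compact interval of a smooth function depend smoothly on parameters. The
integral is read as a convolution with the indicator function of the interval, evaluated at `0`. -/
theorem contDiffOn_intervalIntegral_param {P : Type*} [NormedAddCommGroup P] [NormedSpace ℝ P]
    {s : Set P} (hs : IsOpen s) {h : P → ℝ → ℝ}
    (hh : ContDiffOn ℝ ∞ (fun p : P × ℝ => h p.1 p.2) (s ×ˢ univ)) (a b : ℝ) :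
    ContDiffOn ℝ ∞ (fun p => ∫ t in a..b, h p t) s := by
  wlog hab : a ≤ b generalizing a b
  · have := (this b a (le_of_not_ge hab)).neg
    refine this.congr fun p _ => ?_
    rw [intervalIntegral.integral_symm]
  obtain ⟨χ, hχ⟩ : ∃ χ : ContDiffBump (0 : ℝ), χ.rIn = |a| + |b| + 1 :=
    ⟨⟨|a| + |b| + 1, |a| + |b| + 2, by positivity, by linarith⟩, rfl⟩
  let f : ℝ → ℝ := (Ioc a b).indicator fun _ => 1
  have hf : LocallyIntegrable f volume :=
    ((integrable_indicator_iff measurableSet_Ioc).2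
      (integrableOn_const (by simp))).locallyIntegrable
  let g : P → ℝ → ℝ := fun p x => χ x * h p (-x)
  have hg : ContDiffOn ℝ ∞ (fun p : P × ℝ => g p.1 p.2) (s ×ˢ univ) := by
    refine ContDiffOn.mul (χ.contDiff.comp contDiff_snd).contDiffOn ?_
    refine hh.comp (f := fun p : P × ℝ => (p.1, -p.2))
      (contDiff_fst.prodMk contDiff_snd.neg).contDiffOn ?_
    intro p hp
    exact ⟨hp.1, mem_univ _⟩
  have key := contDiffOn_convolution_right_with_param_comp (μ := volume) (n := (⊤ : ℕ∞))
    (ContinuousLinearMap.lsmul ℝ ℝ) (contDiffOn_const (c := (0 : ℝ))) hs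
    (f := f) (g := g) (k := Metric.closedBall 0 χ.rOut) (isCompact_closedBall _ _)
    (fun p x _ hx => by
      have : χ x = 0 := χ.zero_of_le_dist (not_le.1 fun h' => hx h').le
      simp [g, this]) hf hg
  refine key.congr fun p _ => ?_
  rw [convolution_def, intervalIntegral.integral_of_le hab,
    ← integral_indicator measurableSet_Ioc]
  congr 1
  ext t
  by_cases ht : t ∈ Ioc a b
  · have h1 : χ (-t) = 1 := by
      apply χ.one_of_mem_closedBall
      simp only [Metric.mem_closedBall, dist_zero_right, norm_neg, Real.norm_eq_abs, hχ]
      have := abs_le_max_abs_abs ht.1.le ht.2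
      have h2 := max_le_add_of_nonneg (abs_nonneg a) (abs_nonneg b)
      linarith
    simp [f, g, ht, h1]
  · simp [f, ht]

/-- Manifold version of `contDiffOn_intervalIntegral_param`. -/
theorem contMDiff_intervalIntegral {E' : Type*} [NormedAddCommGroup E'] [NormedSpace ℝ E']
    {H : Type*} [TopologicalSpace H] {I : ModelWithCorners ℝ E' H} [I.Boundaryless]
    {N : Type*} [TopologicalSpace N] [ChartedSpace H N] [IsManifold I ∞ N]
    {h : N → ℝ → ℝ}
    (hh : ContMDiff (I.prod 𝓘(ℝ, ℝ)) 𝓘(ℝ, ℝ) ∞ (fun p : N × ℝ => h p.1 p.2)) (a b : ℝ) :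
    ContMDiff I 𝓘(ℝ, ℝ) ∞ (fun n => ∫ t in a..b, h n t) := by
  intro n
  have hU : IsOpen (extChartAt I n).target := isOpen_extChartAt_target n
  have h1 : ContDiffOn ℝ ∞ (fun p : E' × ℝ => h ((extChartAt I n).symm p.1) p.2)
      ((extChartAt I n).target ×ˢ univ) := by
    have h0 : ContMDiffOn (𝓘(ℝ, E').prod 𝓘(ℝ, ℝ)) 𝓘(ℝ, ℝ) ∞
        (fun p : E' × ℝ => h ((extChartAt I n).symm p.1) p.2)
        ((extChartAt I n).target ×ˢ univ) :=
      hh.comp_contMDiffOn (f := fun p : E' × ℝ => ((extChartAt I n).symm p.1, p.2))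
        (ContMDiffOn.prodMk ((contMDiffOn_extChartAt_symm n).comp contMDiffOn_fst
          (fun p hp => hp.1)) contMDiffOn_snd)
    rw [← contMDiffOn_iff_contDiffOn, modelWithCornersSelf_prod, ← chartedSpaceSelf_prod]
    exact h0
  have h2 := contDiffOn_intervalIntegral_param hU
    (h := fun p t => h ((extChartAt I n).symm p) t) h1 a b
  have h3 : ContMDiffOn I 𝓘(ℝ, ℝ) ∞
      ((fun p => ∫ t in a..b, h ((extChartAt I n).symm p) t) ∘ extChartAt I n)
      (extChartAt I n).source :=
    h2.contMDiffOn.comp (contMDiffOn_extChartAt (n := ∞) |>.mono (by simp))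
      (fun x hx => (extChartAt I n).map_source hx)
  have h4 := h3.contMDiffAt (extChartAt_source_mem_nhds (I := I) n)
  refine h4.congr_of_eventuallyEq ?_
  filter_upwards [extChartAt_source_mem_nhds (I := I) n] with x hx
  simp only [Function.comp_apply, (extChartAt I n).left_inv hx]

/-- Symmetry of the second derivative, for directional derivatives. -/
theorem fderiv_fderiv_apply_comm {V : Type*} [NormedAddCommGroup V] [NormedSpace ℝ V]
    {f : V → ℝ} {z : V} (hf : ContDiffAt ℝ ∞ f z) (u w : V) :
    fderiv ℝ (fun z => fderiv ℝ f z u) z w = fderiv ℝ (fun z => fderiv ℝ f z w) z u := by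
  have hd : DifferentiableAt ℝ (fderiv ℝ f) z :=
    ((hf.fderiv_right (m := 1) (by norm_cast)).differentiableAt (by simp))
  have hs := hf.isSymmSndFDerivAt (by simp only [minSmoothness_of_isRCLikeNormedField]; exact WithTop.coe_le_coe.2 (le_top : (2 : ℕ∞) ≤ ⊤))
  have e : ∀ u w, fderiv ℝ (fun z => fderiv ℝ f z u) z w = fderiv ℝ (fderiv ℝ f) z w u := by
    intro u w
    have := (hd.hasFDerivAt.clm_apply (hasFDerivAt_const u z)).fderiv
    rw [this]; simp
  rw [e, e]; exact hs.eq w u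

end Calculus

section Partial

variable {E : Type*} [NormedAddCommGroup E] [NormedSpace ℝ E]
  {M : Type*} [TopologicalSpace M] [ChartedSpace E M]

/-- The differential in the preferred chart. -/
theorem mvfderiv_eq_fderiv {f : M → ℝ} {m : M} (hf : MDifferentiableAt 𝓘(ℝ, E) 𝓘(ℝ, ℝ) f m)
    (v : TangentSpace 𝓘(ℝ, E) m) :
    mvfderiv 𝓘(ℝ, E) f m v
      = fderiv ℝ (f ∘ (extChartAt 𝓘(ℝ, E) m).symm) (extChartAt 𝓘(ℝ, E) m m) (v : E) := by
  have h := hf.mfderiv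
  simp only [writtenInExtChartAt, extChartAt_model_space_eq_id, PartialEquiv.refl_coe,
    modelWithCornersSelf_coe, range_id, fderivWithin_univ, Function.id_comp] at h
  exact congrArg (fun L : E →L[ℝ] ℝ => L v) h

variable [IsManifold 𝓘(ℝ, E) ∞ M]

theorem contDiffAt_chart {h : M → ℝ → ℝ}
    (hh : ContMDiff (𝓘(ℝ, E).prod 𝓘(ℝ, ℝ)) 𝓘(ℝ, ℝ) ∞ (fun p : M × ℝ => h p.1 p.2)) (m : M) :
    ContDiffOn ℝ ∞ (fun p : E × ℝ => h ((extChartAt 𝓘(ℝ, E) m).symm p.1) p.2)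
      ((extChartAt 𝓘(ℝ, E) m).target ×ˢ univ) := by
  have h0 : ContMDiffOn (𝓘(ℝ, E).prod 𝓘(ℝ, ℝ)) 𝓘(ℝ, ℝ) ∞
      (fun p : E × ℝ => h ((extChartAt 𝓘(ℝ, E) m).symm p.1) p.2)
      ((extChartAt 𝓘(ℝ, E) m).target ×ˢ univ) :=
    hh.comp_contMDiffOn (f := fun p : E × ℝ => ((extChartAt 𝓘(ℝ, E) m).symm p.1, p.2))
      (ContMDiffOn.prodMk ((contMDiffOn_extChartAt_symm m).comp contMDiffOn_fst
        (fun p hp => hp.1)) contMDiffOn_snd)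
  rw [← contMDiffOn_iff_contDiffOn, modelWithCornersSelf_prod, ← chartedSpaceSelf_prod]
  exact h0

omit [IsManifold 𝓘(ℝ, E) ∞ M] in
theorem contMDiff_slice {h : M → ℝ → ℝ}
    (hh : ContMDiff (𝓘(ℝ, E).prod 𝓘(ℝ, ℝ)) 𝓘(ℝ, ℝ) ∞ (fun p : M × ℝ => h p.1 p.2)) (t : ℝ) :
    ContMDiff 𝓘(ℝ, E) 𝓘(ℝ, ℝ) ∞ (fun m => h m t) :=
  hh.comp (contMDiff_id.prodMk contMDiff_const)

/-- In a chart, the differential of a slice is the partial derivative of the family. -/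
theorem mvfderiv_slice {h : M → ℝ → ℝ}
    (hh : ContMDiff (𝓘(ℝ, E).prod 𝓘(ℝ, ℝ)) 𝓘(ℝ, ℝ) ∞ (fun p : M × ℝ => h p.1 p.2))
    (m : M) (v : TangentSpace 𝓘(ℝ, E) m) (t : ℝ) :
    mvfderiv 𝓘(ℝ, E) (fun m => h m t) m v
      = fderiv ℝ (fun p : E × ℝ => h ((extChartAt 𝓘(ℝ, E) m).symm p.1) p.2)
        (extChartAt 𝓘(ℝ, E) m m, t) ((v : E), (0 : ℝ)) := by
  have hU : IsOpen (extChartAt 𝓘(ℝ, E) m).target := isOpen_extChartAt_target m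
  rw [mvfderiv_eq_fderiv (((contMDiff_slice hh t) m).mdifferentiableAt (by simp))]
  have hd : DifferentiableAt ℝ (fun p : E × ℝ => h ((extChartAt 𝓘(ℝ, E) m).symm p.1) p.2)
      (extChartAt 𝓘(ℝ, E) m m, t) :=
    ((contDiffAt_chart hh m).contDiffAt ((hU.prod isOpen_univ).mem_nhds
      ⟨mem_extChartAt_target m, mem_univ _⟩)).differentiableAt (by simp)
  have h1 : HasFDerivAt (fun x : E => (x, t)) (ContinuousLinearMap.inl ℝ E ℝ)
      (extChartAt 𝓘(ℝ, E) m m) := hasFDerivAt_prodMk_left _ _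
  have := (hd.hasFDerivAt.comp (extChartAt 𝓘(ℝ, E) m m) h1).fderiv
  have e2 : ((fun m => h m t) ∘ (extChartAt 𝓘(ℝ, E) m).symm)
    = (fun p : E × ℝ => h ((extChartAt 𝓘(ℝ, E) m).symm p.1) p.2) ∘ (fun x : E => (x, t)) := rfl
  rw [e2, this]
  rfl

/-- Differentiation in a tangent direction commutes with differentiation in a parameter. -/
theorem hasDerivAt_mvfderiv {h h' : M → ℝ → ℝ}
    (hh : ContMDiff (𝓘(ℝ, E).prod 𝓘(ℝ, ℝ)) 𝓘(ℝ, ℝ) ∞ (fun p : M × ℝ => h p.1 p.2))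
    (hd : ∀ m t, HasDerivAt (h m) (h' m t) t) (m : M) (v : TangentSpace 𝓘(ℝ, E) m) (t : ℝ) :
    HasDerivAt (fun t => mvfderiv 𝓘(ℝ, E) (fun m => h m t) m v)
      (mvfderiv 𝓘(ℝ, E) (fun m => h' m t) m v) t := by
  have hU : IsOpen (extChartAt 𝓘(ℝ, E) m).target := isOpen_extChartAt_target m
  set k : E × ℝ → ℝ := fun p => h ((extChartAt 𝓘(ℝ, E) m).symm p.1) p.2 with hk
  set x := extChartAt 𝓘(ℝ, E) m m with hx
  have hW : IsOpen ((extChartAt 𝓘(ℝ, E) m).target ×ˢ (univ : Set ℝ)) := hU.prod isOpen_univ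
  have hxW : ∀ t, (x, t) ∈ (extChartAt 𝓘(ℝ, E) m).target ×ˢ (univ : Set ℝ) := fun t =>
    ⟨mem_extChartAt_target m, mem_univ _⟩
  have hc : ∀ p ∈ (extChartAt 𝓘(ℝ, E) m).target ×ˢ (univ : Set ℝ), ContDiffAt ℝ ∞ k p := fun p hp =>
    (contDiffAt_chart hh m).contDiffAt (hW.mem_nhds hp)
  have h'k : ∀ p ∈ (extChartAt 𝓘(ℝ, E) m).target ×ˢ (univ : Set ℝ),
      h' ((extChartAt 𝓘(ℝ, E) m).symm p.1) p.2 = fderiv ℝ k p (0, 1) := by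
    intro p hp
    have h1 : HasDerivAt (fun s => k (p.1, s)) (fderiv ℝ k p (0, 1)) p.2 := by
      have h2 : HasFDerivAt (fun s : ℝ => (p.1, s)) (ContinuousLinearMap.inr ℝ E ℝ) p.2 :=
        hasFDerivAt_prodMk_right _ _
      have h3 : HasFDerivAt k (fderiv ℝ k p) (p.1, p.2) :=
        ((hc p hp).differentiableAt (by simp)).hasFDerivAt
      have := (h3.comp p.2 h2).hasDerivAt
      exact this
    exact (hd _ _).unique h1
  have hdm : MDifferentiableAt 𝓘(ℝ, E) 𝓘(ℝ, ℝ) (fun m => h' m t) m := by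
    have h5 : ContMDiffAt 𝓘(ℝ, E) 𝓘(ℝ, ℝ) 1 (fun m' => fderiv ℝ k (extChartAt 𝓘(ℝ, E) m m', t) (0, 1))
        m := by
      have h6 : ContDiffAt ℝ 1 (fun p => fderiv ℝ k p (0, 1)) (x, t) :=
        ((hc _ (hxW t)).fderiv_right (m := 1) (by norm_cast)).clm_apply contDiffAt_const
      have h7 : ContDiffAt ℝ 1 (fun y : E => fderiv ℝ k (y, t) (0, 1)) x :=
        h6.comp x (contDiffAt_id.prodMk contDiffAt_const)
      exact h7.contMDiffAt.comp m (contMDiffAt_extChartAt)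
    refine (h5.mdifferentiableAt (by simp)).congr_of_eventuallyEq ?_
    filter_upwards [extChartAt_source_mem_nhds (I := 𝓘(ℝ, E)) m] with m' hm'
    have := h'k (extChartAt 𝓘(ℝ, E) m m', t) ⟨(extChartAt 𝓘(ℝ, E) m).map_source hm', mem_univ _⟩
    rwa [(extChartAt 𝓘(ℝ, E) m).left_inv hm'] at this
  have e1 : (fun t => mvfderiv 𝓘(ℝ, E) (fun m => h m t) m v)
      = fun t => fderiv ℝ k (x, t) ((v : E), (0 : ℝ)) := by
    ext t; exact mvfderiv_slice hh m v t
  have h6 : DifferentiableAt ℝ (fun p => fderiv ℝ k p ((v : E), (0 : ℝ))) (x, t) :=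
    (((hc _ (hxW t)).fderiv_right (m := 1) (by norm_cast)).clm_apply
      contDiffAt_const).differentiableAt (by simp)
  have h7 : HasDerivAt (fun t => fderiv ℝ k (x, t) ((v : E), (0 : ℝ)))
      (fderiv ℝ (fun p => fderiv ℝ k p ((v : E), (0 : ℝ))) (x, t) (0, 1)) t := by
    have := (h6.hasFDerivAt.comp t (hasFDerivAt_prodMk_right (𝕜 := ℝ) x t)).hasDerivAt
    exact this
  rw [e1]
  convert h7 using 1
  rw [fderiv_fderiv_apply_comm (hc _ (hxW t)), mvfderiv_eq_fderiv hdm]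
  have h8 : ((fun m => h' m t) ∘ (extChartAt 𝓘(ℝ, E) m).symm) =ᶠ[𝓝 x]
      fun y => fderiv ℝ k (y, t) (0, 1) := by
    filter_upwards [hU.mem_nhds (mem_extChartAt_target m)] with y hy
    exact h'k (y, t) ⟨hy, mem_univ _⟩
  rw [h8.fderiv_eq]
  have h9 : DifferentiableAt ℝ (fun p => fderiv ℝ k p ((0 : E), (1 : ℝ))) (x, t) :=
    (((hc _ (hxW t)).fderiv_right (m := 1) (by norm_cast)).clm_apply
      contDiffAt_const).differentiableAt (by simp)
  have := (h9.hasFDerivAt.comp x (hasFDerivAt_prodMk_left (𝕜 := ℝ) x t)).fderiv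
  have e3 : ((fun p => fderiv ℝ k p ((0 : E), (1 : ℝ))) ∘ fun e : E => (e, t))
    = fun y => fderiv ℝ k (y, t) (0, 1) := rfl
  rw [e3] at this
  rw [this]
  rfl

/-- Differentiation under the integral sign. It follows from the symmetry of second derivatives by
integrating `hasDerivAt_mvfderiv`, applied to the integral as a function of its upper end. -/
theorem mvfderiv_intervalIntegral {h : M → ℝ → ℝ}
    (hh : ContMDiff (𝓘(ℝ, E).prod 𝓘(ℝ, ℝ)) 𝓘(ℝ, ℝ) ∞ (fun p : M × ℝ => h p.1 p.2))
    (m : M) (v : TangentSpace 𝓘(ℝ, E) m) (a b : ℝ) :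
    mvfderiv 𝓘(ℝ, E) (fun m => ∫ t in a..b, h m t) m v
      = ∫ t in a..b, mvfderiv 𝓘(ℝ, E) (fun m => h m t) m v := by
  have hcont : ∀ m, Continuous (h m) := fun m =>
    hh.continuous.comp (Continuous.prodMk_right m)
  let J : M → ℝ → ℝ := fun m c => ∫ t in a..c, h m t
  have hJ : ContMDiff (𝓘(ℝ, E).prod 𝓘(ℝ, ℝ)) 𝓘(ℝ, ℝ) ∞ (fun p : M × ℝ => J p.1 p.2) := by
    have e : (fun p : M × ℝ => J p.1 p.2)
        = fun p : M × ℝ => ∫ u in (0 : ℝ)..1, (p.2 - a) * h p.1 ((p.2 - a) * u + a) := by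
      ext p
      rw [intervalIntegral.integral_const_mul,
        intervalIntegral.mul_integral_comp_mul_add (a := 0) (b := 1) (f := h p.1) (p.2 - a) a]
      simp [J]
    rw [e]
    refine contMDiff_intervalIntegral (I := 𝓘(ℝ, E).prod 𝓘(ℝ, ℝ))
      (h := fun (p : M × ℝ) (u : ℝ) => (p.2 - a) * h p.1 ((p.2 - a) * u + a)) ?_ 0 1
    have hp2 : ContMDiff ((𝓘(ℝ, E).prod 𝓘(ℝ, ℝ)).prod 𝓘(ℝ, ℝ)) 𝓘(ℝ, ℝ) ∞
        (fun q : (M × ℝ) × ℝ => q.1.2 - a) :=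
      (contMDiff_snd.comp contMDiff_fst).sub contMDiff_const
    refine hp2.mul ?_
    refine hh.comp (f := fun q : (M × ℝ) × ℝ => (q.1.1, (q.1.2 - a) * q.2 + a)) ?_
    exact (contMDiff_fst.comp contMDiff_fst).prodMk
      ((hp2.mul contMDiff_snd).add contMDiff_const)
  have hder := hasDerivAt_mvfderiv hJ (h' := h)
    (fun m t => intervalIntegral.integral_hasDerivAt_right
      ((hcont m).intervalIntegrable _ _) ((hcont m).stronglyMeasurableAtFilter _ _)
      (hcont m).continuousAt) m v
  have hc2 : Continuous (fun t => mvfderiv 𝓘(ℝ, E) (fun m => h m t) m v) := by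
    have hU : IsOpen (extChartAt 𝓘(ℝ, E) m).target := isOpen_extChartAt_target m
    have e1 : (fun t => mvfderiv 𝓘(ℝ, E) (fun m => h m t) m v)
      = fun t => fderiv ℝ (fun p : E × ℝ => h ((extChartAt 𝓘(ℝ, E) m).symm p.1) p.2)
        (extChartAt 𝓘(ℝ, E) m m, t) ((v : E), (0 : ℝ)) := by
      ext t; exact mvfderiv_slice hh m v t
    rw [e1, continuous_iff_continuousAt]
    intro t
    have h6 : ContDiffAt ℝ 1 (fun p => fderiv ℝ
        (fun p : E × ℝ => h ((extChartAt 𝓘(ℝ, E) m).symm p.1) p.2) p ((v : E), (0 : ℝ)))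
        (extChartAt 𝓘(ℝ, E) m m, t) :=
      (((contDiffAt_chart hh m).contDiffAt ((hU.prod isOpen_univ).mem_nhds
        ⟨mem_extChartAt_target m, mem_univ _⟩)).fderiv_right (m := 1)
          (by norm_cast)).clm_apply contDiffAt_const
    exact h6.continuousAt.comp (f := fun t : ℝ => (extChartAt 𝓘(ℝ, E) m m, t))
      (Continuous.prodMk_right _).continuousAt
  have := intervalIntegral.integral_eq_sub_of_hasDerivAt (fun t _ => hder t)
    (hc2.intervalIntegrable a b)
  rw [this]
  simp [J, mvfderiv_const]

end Partial
end NearlyPeriodic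

/-! ### Smooth families of tensors -/

namespace NearlyPeriodic
open MeasureTheory Set

variable {E : Type*} [NormedAddCommGroup E] [NormedSpace ℝ E]
  {M : Type*} [TopologicalSpace M] [ChartedSpace E M]
  {P : Type*} [NormedAddCommGroup P] [NormedSpace ℝ P]

section Families

variable (E M) in
/-- Smooth real functions on `M`. -/
abbrev SmoothFn : Type _ := C^∞⟮𝓘(ℝ, E), M; ℝ⟯

variable (E) in
/-- `f` is a smooth family of functions: `(m, γ) ↦ f_γ(m)` is smooth. -/
def JointlySmooth (f : P → M → ℝ) : Prop :=
  ContMDiff (𝓘(ℝ, E).prod 𝓘(ℝ, P)) 𝓘(ℝ, ℝ) ∞ (fun p : M × P => f p.2 p.1)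

theorem JointlySmooth.slice {f : P → M → ℝ} (hf : JointlySmooth E f) (γ : P) :
    ContMDiff 𝓘(ℝ, E) 𝓘(ℝ, ℝ) ∞ (f γ) :=
  ContMDiff.comp (g := fun p : M × P => f p.2 p.1) (f := fun m => (m, γ)) hf
    (contMDiff_id.prodMk contMDiff_const)

theorem JointlySmooth.mdiff {f : P → M → ℝ} (hf : JointlySmooth E f) (γ : P) (m : M) :
    MDifferentiableAt 𝓘(ℝ, E) 𝓘(ℝ, ℝ) (f γ) m :=
  (hf.slice γ m).mdifferentiableAt (by simp)

theorem JointlySmooth.param {f : P → M → ℝ} (hf : JointlySmooth E f) (m : M) :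
    ContDiff ℝ ∞ (fun γ => f γ m) := by
  rw [← contMDiff_iff_contDiff]
  exact ContMDiff.comp (g := fun p : M × P => f p.2 p.1) (f := fun γ => (m, γ)) hf
    (contMDiff_const.prodMk contMDiff_id)

theorem JointlySmooth.add {f g : P → M → ℝ} (hf : JointlySmooth E f) (hg : JointlySmooth E g) :
    JointlySmooth E (fun γ m => f γ m + g γ m) := ContMDiff.add hf hg

theorem JointlySmooth.sub {f g : P → M → ℝ} (hf : JointlySmooth E f) (hg : JointlySmooth E g) :
    JointlySmooth E (fun γ m => f γ m - g γ m) := ContMDiff.sub hf hg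

theorem JointlySmooth.mul {f g : P → M → ℝ} (hf : JointlySmooth E f) (hg : JointlySmooth E g) :
    JointlySmooth E (fun γ m => f γ m * g γ m) := ContMDiff.mul hf hg

theorem JointlySmooth.sum {ι : Type*} {s : Finset ι} {f : ι → P → M → ℝ}
    (hf : ∀ i ∈ s, JointlySmooth E (f i)) :
    JointlySmooth E (fun γ m => ∑ i ∈ s, f i γ m) :=
  contMDiff_finsetSum (f := fun i (p : M × P) => f i p.2 p.1) hf

theorem JointlySmooth.const (f : SmoothFn E M) : JointlySmooth (P := P) E (fun _ => f) :=
  f.contMDiff.comp contMDiff_fst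

theorem JointlySmooth.of_param {p : P → ℝ} (hp : ContDiff ℝ ∞ p) :
    JointlySmooth (M := M) E (fun γ _ => p γ) :=
  hp.contMDiff.comp contMDiff_snd

variable [IsManifold 𝓘(ℝ, E) ∞ M]

theorem smoothVFFamily_const (X : SmoothVF E M) : SmoothVFFamily (fun _ : P => (X : VF E M)) :=
  X.contMDiff.comp contMDiff_fst

/-- The derivative of a smooth family of functions along a smooth family of vector fields is a
smooth family of functions. -/
theorem JointlySmooth.mvfderiv {f : P → M → ℝ} (hf : JointlySmooth E f) {X : P → VF E M}
    (hX : SmoothVFFamily X) : JointlySmooth E (fun γ m => mvfderiv 𝓘(ℝ, E) (f γ) m (X γ m)) := by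
  have h1 := hf.contMDiff_tangentMap (m := ∞) (by simp)
  have h0 : ContMDiff (𝓘(ℝ, E).prod 𝓘(ℝ, P)) (𝓘(ℝ, P).prod 𝓘(ℝ, P)) ∞
      (fun p : M × P => (Bundle.TotalSpace.mk' P (E := (TangentSpace 𝓘(ℝ, P) : P → Type _)) p.2 0)) :=
    (Bundle.contMDiff_zeroSection ℝ (TangentSpace 𝓘(ℝ, P) : P → Type _)).comp contMDiff_snd
  have h2 := (contMDiff_equivTangentBundleProd_symm (I := 𝓘(ℝ, E)) (M := M) (I' := 𝓘(ℝ, P))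
    (M' := P) (n := ∞)).comp (hX.prodMk h0)
  have h3 := (contMDiff_snd_tangentBundle_modelSpace ℝ 𝓘(ℝ, ℝ) (n := ∞)).comp (h1.comp h2)
  refine h3.congr fun p => ?_
  have hd : MDifferentiableAt (𝓘(ℝ, E).prod 𝓘(ℝ, P)) 𝓘(ℝ, ℝ) (fun p : M × P => f p.2 p.1)
      (p.1, p.2) := (hf (p.1, p.2)).mdifferentiableAt (by simp)
  have h4 : HasMFDerivAt 𝓘(ℝ, E) (𝓘(ℝ, E).prod 𝓘(ℝ, P)) (fun m : M => (m, p.2)) p.1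
      ((ContinuousLinearMap.id ℝ (TangentSpace 𝓘(ℝ, E) p.1)).prod 0) :=
    (hasMFDerivAt_id p.1).prodMk (hasMFDerivAt_const p.2 p.1)
  have h5 := (hd.hasMFDerivAt.comp p.1 h4).mfderiv
  exact congrArg (fun L : E →L[ℝ] ℝ => L (X p.2 p.1)) h5

theorem JointlySmooth.lie {f : P → M → ℝ} (hf : JointlySmooth E f) (X : SmoothVF E M) :
    JointlySmooth E (fun γ => lieFun X (f γ)) :=
  hf.mvfderiv (smoothVFFamily_const X)

theorem contMDiff_lieFun (X : SmoothVF E M) {f : M → ℝ} (hf : ContMDiff 𝓘(ℝ, E) 𝓘(ℝ, ℝ) ∞ f) :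
    ContMDiff 𝓘(ℝ, E) 𝓘(ℝ, ℝ) ∞ (lieFun X f) :=
  ((JointlySmooth.const (P := ℝ) (⟨f, hf⟩ : SmoothFn E M)).lie X).slice 0

theorem SmoothOneFormFamily.apply {θ : P → OneForm E M} (hθ : SmoothOneFormFamily θ)
    {X : P → VF E M} (hX : SmoothVFFamily X) : JointlySmooth E (fun γ m => θ γ m (X γ m)) := by
  have h := ContMDiff.clm_bundle_apply (IM := 𝓘(ℝ, E).prod 𝓘(ℝ, P)) (IB := 𝓘(ℝ, E)) (n := ∞)
    (F₁ := E) (F₂ := ℝ) (E₁ := (TangentSpace 𝓘(ℝ, E) : M → Type _)) (E₂ := Bundle.Trivial M ℝ)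
    (b := fun p : M × P => p.1) (ϕ := fun p => θ p.2 p.1) (v := fun p => X p.2 p.1) hθ hX
  intro p
  exact ((Bundle.contMDiffAt_totalSpace).1 (h p)).2

theorem SmoothBilinFormFamily.apply {Ω : P → BilinForm E M} (hΩ : SmoothBilinFormFamily Ω)
    {X Y : P → VF E M} (hX : SmoothVFFamily X) (hY : SmoothVFFamily Y) :
    JointlySmooth E (fun γ m => Ω γ m (X γ m) (Y γ m)) := by
  have h := ContMDiff.clm_bundle_apply₂ (IM := 𝓘(ℝ, E).prod 𝓘(ℝ, P)) (IB := 𝓘(ℝ, E)) (n := ∞)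
    (F₁ := E) (F₂ := E) (F₃ := ℝ) (E₁ := (TangentSpace 𝓘(ℝ, E) : M → Type _))
    (E₂ := (TangentSpace 𝓘(ℝ, E) : M → Type _)) (E₃ := Bundle.Trivial M ℝ)
    (b := fun p : M × P => p.1) (ψ := fun p => Ω p.2 p.1) (v := fun p => X p.2 p.1)
    (w := fun p => Y p.2 p.1) hΩ hX hY
  intro p
  exact ((Bundle.contMDiffAt_totalSpace).1 (h p)).2

/-- The differentials of a smooth family of functions form a smooth family of `1`-forms. -/
theorem JointlySmooth.smoothOneFormFamily {f : P → M → ℝ} (hf : JointlySmooth E f) :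
    SmoothOneFormFamily (fun γ m => _root_.mvfderiv 𝓘(ℝ, E) (f γ) m) := by
  intro p
  refine (contMDiffAt_hom_bundle _).2 ⟨contMDiff_fst p, ?_⟩
  have := ContMDiffAt.mfderiv (x₀ := p) (m := ∞) (n := ∞) (I := 𝓘(ℝ, E)) (I' := 𝓘(ℝ, ℝ))
    (J := 𝓘(ℝ, E).prod 𝓘(ℝ, P)) (fun p : M × P => f p.2) (fun p => p.1)
    (ContMDiff.contMDiffAt (ContMDiff.comp (g := fun p : M × P => f p.2 p.1)
      (f := fun q : (M × P) × M => (q.2, q.1.2)) hf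
      (contMDiff_snd.prodMk (contMDiff_snd.comp contMDiff_fst)))) contMDiffAt_fst (by simp)
  refine this.congr_of_eventuallyEq (Filter.Eventually.of_forall fun q => ?_)
  ext v
  simp [inTangentCoordinates, ContinuousLinearMap.inCoordinates]
  rfl

end Families
end NearlyPeriodic

/-! ### Frames, and vector fields as derivations -/

namespace NearlyPeriodic
open MeasureTheory Set

variable {E : Type*} [NormedAddCommGroup E] [NormedSpace ℝ E]
  {M : Type*} [TopologicalSpace M] [ChartedSpace E M] [IsManifold 𝓘(ℝ, E) ∞ M]
  {P : Type*} [NormedAddCommGroup P] [NormedSpace ℝ P]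

section VectorFields

/-- The product of a vector field by a function. -/
def fmul (f : SmoothFn E M) (X : SmoothVF E M) : SmoothVF E M :=
  ⟨fun m => f m • X m, f.contMDiff.smul_section X.contMDiff⟩

@[simp] theorem fmul_apply (f : SmoothFn E M) (X : SmoothVF E M) (m : M) :
    fmul f X m = f m • X m := rfl

theorem SmoothFn.mdiff (f : SmoothFn E M) (m : M) :
    MDifferentiableAt 𝓘(ℝ, E) 𝓘(ℝ, ℝ) f m :=
  f.contMDiff.mdifferentiableAt (by simp)

theorem SmoothVF.mdiff (X : SmoothVF E M) (m : M) :
    MDifferentiableAt 𝓘(ℝ, E) (𝓘(ℝ, E).prod 𝓘(ℝ, E))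
      (fun m => (Bundle.TotalSpace.mk' E m (X m) : TangentBundle 𝓘(ℝ, E) M)) m :=
  X.contMDiff.mdifferentiableAt (by simp)

@[simp] theorem SmoothVF.coe_sum {ι : Type*} (s : Finset ι) (X : ι → SmoothVF E M) (m : M) :
    (∑ i ∈ s, X i : SmoothVF E M) m = ∑ i ∈ s, X i m := by
  classical
  induction s using Finset.induction_on with
  | empty => simp
  | insert a s ha ih => simp [Finset.sum_insert ha, ih]

@[simp] theorem SmoothFn.coe_sum {ι : Type*} (s : Finset ι) (f : ι → SmoothFn E M) (m : M) :
    (∑ i ∈ s, f i : SmoothFn E M) m = ∑ i ∈ s, f i m := by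
  classical
  induction s using Finset.induction_on with
  | empty => simp
  | insert a s ha ih => simp [Finset.sum_insert ha, ih]

section LieFun

omit [IsManifold 𝓘(ℝ, E) ∞ M]

theorem lieFun_add_left (X Y : VF E M) (f : M → ℝ) (m : M) :
    lieFun (X + Y) f m = lieFun X f m + lieFun Y f m := by
  simp [lieFun]

theorem lieFun_smul_left (c : ℝ) (X : VF E M) (f : M → ℝ) (m : M) :
    lieFun (c • X) f m = c * lieFun X f m := by
  simp [lieFun]

theorem lieFun_add (X : VF E M) {f g : M → ℝ} {m : M}
    (hf : MDifferentiableAt 𝓘(ℝ, E) 𝓘(ℝ, ℝ) f m) (hg : MDifferentiableAt 𝓘(ℝ, E) 𝓘(ℝ, ℝ) g m) :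
    lieFun X (f + g) m = lieFun X f m + lieFun X g m := by
  simp [lieFun, mvfderiv_add hf hg]

theorem lieFun_sub (X : VF E M) {f g : M → ℝ} {m : M}
    (hf : MDifferentiableAt 𝓘(ℝ, E) 𝓘(ℝ, ℝ) f m) (hg : MDifferentiableAt 𝓘(ℝ, E) 𝓘(ℝ, ℝ) g m) :
    lieFun X (f - g) m = lieFun X f m - lieFun X g m := by
  simp [lieFun, mvfderiv_sub hf hg]

theorem lieFun_mul (X : VF E M) {f g : M → ℝ} {m : M}
    (hf : MDifferentiableAt 𝓘(ℝ, E) 𝓘(ℝ, ℝ) f m) (hg : MDifferentiableAt 𝓘(ℝ, E) 𝓘(ℝ, ℝ) g m) :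
    lieFun X (f * g) m = lieFun X f m * g m + f m * lieFun X g m := by
  simp [lieFun, mvfderiv_mul hf hg]; ring

theorem lieFun_const (X : VF E M) (c : ℝ) (m : M) : lieFun X (fun _ => c) m = 0 := by
  simp [lieFun, mvfderiv_const]

theorem lieFun_congr (X : VF E M) {f g : M → ℝ} {m : M} (h : f =ᶠ[𝓝 m] g) :
    lieFun X f m = lieFun X g m := by
  have := h.mfderiv_eq (I := 𝓘(ℝ, E)) (I' := 𝓘(ℝ, ℝ))
  have h2 := h.eq_of_nhds
  exact congrArg (fun L : E →L[ℝ] ℝ => L (X m)) this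

end LieFun

/-- The derivative of a smooth function along a smooth vector field, as a smooth function. -/
def lieD (X : SmoothVF E M) (f : SmoothFn E M) : SmoothFn E M :=
  ⟨lieFun X f, contMDiff_lieFun X f.contMDiff⟩

@[simp] theorem lieD_apply (X : SmoothVF E M) (f : SmoothFn E M) (m : M) :
    lieD X f m = lieFun X f m := rfl

theorem lieD_mul (X : SmoothVF E M) (f g : SmoothFn E M) :
    lieD X (f * g) = lieD X f * g + f * lieD X g := by
  ext m
  exact lieFun_mul X (f.mdiff m) (g.mdiff m)

variable [FiniteDimensional ℝ E]

instance : LieRing (SmoothVF E M) where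
  bracket X Y := ⟨VectorField.mlieBracket 𝓘(ℝ, E) X Y, by
    haveI := FiniteDimensional.complete ℝ E
    haveI : IsManifold 𝓘(ℝ, E) ((⊤ : ℕ∞) + 1) M := by simpa using ‹IsManifold 𝓘(ℝ, E) ∞ M›
    haveI : IsManifold 𝓘(ℝ, E) (minSmoothness ℝ 2) M :=
      IsManifold.of_le (n := ∞) (by
        simp only [minSmoothness_of_isRCLikeNormedField]
        exact WithTop.coe_le_coe.2 (le_top : (2 : ℕ∞) ≤ ⊤))
    exact ContDiff.mlieBracket_vectorField (m := ⊤) (n := ⊤) X.contMDiff Y.contMDiff (by simp)⟩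
  add_lie X Y Z := by
    haveI := FiniteDimensional.complete ℝ E
    ext m
    exact congrArg (fun v : E => v)
      (VectorField.mlieBracket_add_left (W := Z) (X.mdiff m) (Y.mdiff m))
  lie_add X Y Z := by
    haveI := FiniteDimensional.complete ℝ E
    ext m
    exact congrArg (fun v : E => v)
      (VectorField.mlieBracket_add_right (V := X) (Y.mdiff m) (Z.mdiff m))
  lie_self X := by
    ext m
    exact congrFun (VectorField.mlieBracket_self (I := 𝓘(ℝ, E)) (V := (X : VF E M))) m
  leibniz_lie X Y Z := by
    haveI := FiniteDimensional.complete ℝ E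
    haveI : IsManifold 𝓘(ℝ, E) (minSmoothness ℝ 3) M :=
      IsManifold.of_le (n := ∞) (by
        simp only [minSmoothness_of_isRCLikeNormedField]
        exact WithTop.coe_le_coe.2 (le_top : (3 : ℕ∞) ≤ ⊤))
    have h2 : minSmoothness ℝ 2 ≤ ∞ := by
      simp only [minSmoothness_of_isRCLikeNormedField]
      exact WithTop.coe_le_coe.2 (le_top : (2 : ℕ∞) ≤ ⊤)
    ext m
    exact VectorField.leibniz_identity_mlieBracket_apply (X.contMDiff.of_le h2 m)
      (Y.contMDiff.of_le h2 m) (Z.contMDiff.of_le h2 m)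

theorem bracket_apply (X Y : SmoothVF E M) (m : M) :
    ⁅X, Y⁆ m = VectorField.mlieBracket 𝓘(ℝ, E) X Y m := rfl

instance : LieAlgebra ℝ (SmoothVF E M) where
  lie_smul c X Y := by
    haveI := FiniteDimensional.complete ℝ E
    ext m
    exact VectorField.mlieBracket_const_smul_right (V := X) (c := c) (Y.mdiff m)

theorem bracket_fmul (X Y : SmoothVF E M) (f : SmoothFn E M) :
    ⁅X, fmul f Y⁆ = fmul (lieD X f) Y + fmul f ⁅X, Y⁆ := by
  haveI := FiniteDimensional.complete ℝ E
  ext m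
  exact VectorField.mlieBracket_smul_right (V := X) (f.mdiff m) (Y.mdiff m)

variable [T2Space M]

/-- Near every point the coordinate functions `xᵢ` of a chart and the coordinate vector fields `eᵢ`
extend to globally defined smooth objects. -/
theorem exists_chart_frame (m₀ : M) :
    ∃ (x : Fin (Module.finrank ℝ E) → SmoothFn E M) (e : Fin (Module.finrank ℝ E) → SmoothVF E M),
      ∀ᶠ m in 𝓝 m₀, (∀ v : TangentSpace 𝓘(ℝ, E) m, v = ∑ i, mvfderiv 𝓘(ℝ, E) (x i) m v • e i m) ∧
        (∀ i, x i m = (Module.finBasis ℝ E).repr (extChartAt 𝓘(ℝ, E) m₀ m) i) ∧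
        (∀ i j, mvfderiv 𝓘(ℝ, E) (x i) m (e j m) = if j = i then 1 else 0) ∧
        ∀ i, mfderiv 𝓘(ℝ, E) 𝓘(ℝ, E) (extChartAt 𝓘(ℝ, E) m₀) m (e i m)
          = Module.finBasis ℝ E i := by
  let b := Module.finBasis ℝ E
  let tr := trivializationAt E (TangentSpace 𝓘(ℝ, E) : M → Type _) m₀
  let f : SmoothBumpFunction 𝓘(ℝ, E) m₀ := Classical.choice inferInstance
  let φ := extChartAt 𝓘(ℝ, E) m₀
  let c : Fin (Module.finrank ℝ E) → E →L[ℝ] ℝ := fun i => LinearMap.toContinuousLinearMap (b.coord i)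
  have hx : ∀ i, ContMDiff 𝓘(ℝ, E) 𝓘(ℝ, ℝ) ∞ (fun m => f m • c i (φ m)) := fun i =>
    f.contMDiff_smul ((c i).contMDiff.comp_contMDiffOn
      (contMDiffOn_extChartAt (I := 𝓘(ℝ, E)) (x := m₀)))
  have he : ∀ i, ContMDiff 𝓘(ℝ, E) (𝓘(ℝ, E).prod 𝓘(ℝ, E)) ∞
      (fun m => Bundle.TotalSpace.mk' E (E := (TangentSpace 𝓘(ℝ, E) : M → Type _)) m
        (((f : M → ℝ) • tr.localFrame b i) m)) := fun i => by
    refine ContMDiffOn.smul_section_of_tsupport (u := tr.baseSet) (ψ := f)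
      f.contMDiff.contMDiffOn tr.open_baseSet ?_
      (Bundle.Trivialization.contMDiffOn_localFrame_baseSet (I := 𝓘(ℝ, E)) ∞ tr b i)
    simpa [tr] using f.tsupport_subset_chartAt_source
  classical
  refine ⟨fun i => ⟨_, hx i⟩, fun i => ⟨_, he i⟩, ?_⟩
  filter_upwards [f.eventuallyEq_one.eventuallyEq_nhds,
    (chartAt E m₀).open_source.mem_nhds (mem_chart_source E m₀)] with m hm hms
  have hmb : m ∈ tr.baseSet := by simpa [tr] using hms
  have h1 : ∀ i (v : TangentSpace 𝓘(ℝ, E) m), mvfderiv 𝓘(ℝ, E) (fun m => f m • c i (φ m)) m v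
      = b.repr (tr.continuousLinearMapAt ℝ m v) i := by
    intro i v
    have e1 : (fun m => f m • c i (φ m)) =ᶠ[𝓝 m] (c i) ∘ φ := by
      filter_upwards [hm] with m' hm'
      simp [hm']
    have hφ : MDifferentiableAt 𝓘(ℝ, E) 𝓘(ℝ, E) φ m := mdifferentiableAt_extChartAt hms
    have h3 := lieFun_congr (fun m' => if h : m' = m then h ▸ v else 0) e1
    simp only [lieFun, dite_true] at h3
    rw [h3, TangentBundle.continuousLinearMapAt_trivializationAt hms]
    have h4 := ((c i).hasMFDerivAt.comp m hφ.hasMFDerivAt).mfderiv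
    exact congrArg (fun L : E →L[ℝ] ℝ => L v) h4
  have h2 : ∀ i, ((f : M → ℝ) • tr.localFrame b i) m = tr.basisAt b hmb i := by
    intro i
    have : f m = 1 := hm.eq_of_nhds
    simp [this, hmb]
  have h5 : ∀ i, tr.continuousLinearMapAt ℝ m (((f : M → ℝ) • tr.localFrame b i) m) = b i := by
    intro i
    rw [h2]
    simp only [Bundle.Trivialization.basisAt, Module.Basis.map_apply,
      Bundle.Trivialization.continuousLinearMapAt_apply, tr.coe_linearMapAt_of_mem hmb]
    exact congrArg Prod.snd (tr.apply_mk_symm hmb (b i))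
  refine ⟨fun v => ?_, fun i => ?_, fun i j => ?_, fun i => ?_⟩
  · have h3 : v = ∑ i, (tr.basisAt b hmb).repr v i • tr.basisAt b hmb i :=
      ((tr.basisAt b hmb).sum_repr v).symm
    conv_lhs => rw [h3]
    refine Finset.sum_congr rfl fun i _ => ?_
    have h4 : (tr.basisAt b hmb).repr v i = b.repr (tr.continuousLinearMapAt ℝ m v) i := by
      simp [Bundle.Trivialization.basisAt, tr.coe_linearMapAt_of_mem hmb]
    rw [h4, ← h1 i]
    exact congrArg _ (h2 i).symm
  · have : f m = 1 := hm.eq_of_nhds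
    change f m • c i (φ m) = _
    rw [this, one_smul]
    rfl
  · refine (h1 i _).trans ?_
    refine (congrArg (fun w => b.repr w i) (h5 j)).trans ?_
    rw [b.repr_self, Finsupp.single_apply]
  · rw [← TangentBundle.continuousLinearMapAt_trivializationAt hms]
    exact h5 i

/-- Near every point there are smooth functions `xᵢ` and smooth vector fields `eᵢ`, all of them
globally defined, with `v = ∑ dxᵢ(v) eᵢ` for every tangent vector `v`. -/
theorem exists_local_frame (m₀ : M) :
    ∃ (x : Fin (Module.finrank ℝ E) → SmoothFn E M) (e : Fin (Module.finrank ℝ E) → SmoothVF E M),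
      ∀ᶠ m in 𝓝 m₀, ∀ v : TangentSpace 𝓘(ℝ, E) m,
        v = ∑ i, mvfderiv 𝓘(ℝ, E) (x i) m v • e i m := by
  obtain ⟨x, e, h⟩ := exists_chart_frame (E := E) m₀
  exact ⟨x, e, h.mono fun m hm => hm.1⟩

theorem exists_smoothVF_apply_eq (m : M) (v : TangentSpace 𝓘(ℝ, E) m) :
    ∃ X : SmoothVF E M, X m = v := by
  obtain ⟨x, e, h⟩ := exists_local_frame (E := E) m
  refine ⟨∑ i, mvfderiv 𝓘(ℝ, E) (x i) m v • e i, ?_⟩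
  rw [SmoothVF.coe_sum]
  exact (h.self_of_nhds v).symm

/-- A tangent vector is determined by its action on smooth functions. -/
theorem tangent_ext {m : M} {v w : TangentSpace 𝓘(ℝ, E) m}
    (h : ∀ f : SmoothFn E M, mvfderiv 𝓘(ℝ, E) f m v = mvfderiv 𝓘(ℝ, E) f m w) : v = w := by
  obtain ⟨x, e, he⟩ := exists_local_frame (E := E) m
  rw [he.self_of_nhds v, he.self_of_nhds w]
  simp only [h]

theorem SmoothVF.ext_lieD {X Y : SmoothVF E M} (h : ∀ f, lieD X f = lieD Y f) : X = Y := by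
  ext m
  exact tangent_ext fun f => congrArg (fun g : SmoothFn E M => g m) (h f)

/-- A family of vector fields is smooth as soon as the derivatives along it of all smooth functions
are. -/
theorem smoothVFFamily_of_lie {X : P → VF E M}
    (h : ∀ f : SmoothFn E M, JointlySmooth E (fun γ => lieFun (X γ) f)) : SmoothVFFamily X := by
  intro p
  obtain ⟨x, e, he⟩ := exists_local_frame (E := E) p.1
  have h1 : ContMDiff (𝓘(ℝ, E).prod 𝓘(ℝ, P)) (𝓘(ℝ, E).prod 𝓘(ℝ, E)) ∞
    (fun p : M × P => Bundle.TotalSpace.mk' E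
      (E := (TangentSpace 𝓘(ℝ, E) : M → Type _)) p.1
        (∑ i, lieFun (X p.2) (x i) p.1 • e i p.1)) := by
    intro q
    rw [Bundle.contMDiffAt_totalSpace]
    refine ⟨contMDiffAt_fst, ?_⟩
    have hq : ∀ᶠ q' : M × P in 𝓝 q, q'.1 ∈ (trivializationAt E (TangentSpace 𝓘(ℝ, E) : M → Type _)
        q.1).baseSet := continuousAt_fst.eventually
      ((trivializationAt E (TangentSpace 𝓘(ℝ, E) : M → Type _) q.1).open_baseSet.mem_nhds
        (FiberBundle.mem_baseSet_trivializationAt' q.1))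
    have h2 : ContMDiffAt (𝓘(ℝ, E).prod 𝓘(ℝ, P)) 𝓘(ℝ, E) ∞ (fun q' : M × P =>
        ∑ i, lieFun (X q'.2) (x i) q'.1 •
          (trivializationAt E (TangentSpace 𝓘(ℝ, E) : M → Type _) q.1
            (Bundle.TotalSpace.mk' E q'.1 (e i q'.1))).2) q := by
      refine contMDiffAt_finsetSum fun i _ => (h (x i) q).smul ?_
      exact ((Bundle.contMDiffAt_totalSpace).1 ((smoothVFFamily_const (P := P) (e i)) q)).2
    refine h2.congr_of_eventuallyEq ?_
    filter_upwards [hq] with q' hq'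
    have := ((trivializationAt E (TangentSpace 𝓘(ℝ, E) : M → Type _) q.1).linear ℝ hq')
    have h3 := map_sum (this.mk' _) (fun i => lieFun (X q'.2) (x i) q'.1 • e i q'.1) Finset.univ
    simp only [map_smul] at h3
    exact h3
  refine (h1 p).congr_of_eventuallyEq ?_
  filter_upwards [continuousAt_fst.eventually he] with q hq
  exact congrArg (fun v => Bundle.TotalSpace.mk' E
      (E := (TangentSpace 𝓘(ℝ, E) : M → Type _)) q.1 v) (hq (X q.2 q.1))

/-- A vector field is smooth as soon as the derivatives along it of all smooth functions are. -/
theorem exists_smoothVF_of_lie {X : VF E M}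
    (h : ∀ f : SmoothFn E M, ContMDiff 𝓘(ℝ, E) 𝓘(ℝ, ℝ) ∞ (lieFun X f)) :
    ∃ Y : SmoothVF E M, (Y : VF E M) = X := by
  have := smoothVFFamily_of_lie (P := ℝ) (X := fun _ => X) fun f =>
    (JointlySmooth.const (P := ℝ) (⟨_, h f⟩ : SmoothFn E M))
  exact ⟨⟨X, fun m => ContMDiff.comp (g := fun p : M × ℝ => Bundle.TotalSpace.mk' E
      (E := (TangentSpace 𝓘(ℝ, E) : M → Type _)) p.1 (X p.1)) (f := fun m => (m, 0)) this
      (contMDiff_id.prodMk contMDiff_const) m⟩, rfl⟩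

/-- The Lie bracket acts on functions as a commutator. This follows from the Jacobi identity for
`X`, `Y` and `f W`, and the Leibniz rule, at a point where `W` does not vanish. -/
theorem lieD_bracket (X Y : SmoothVF E M) (f : SmoothFn E M) :
    lieD ⁅X, Y⁆ f = lieD X (lieD Y f) - lieD Y (lieD X f) := by
  ext m
  rcases subsingleton_or_nontrivial E with hE | hE
  · have : ∀ (Z : SmoothVF E M) (g : SmoothFn E M), lieD Z g m = 0 := fun Z g => by
      have : Z m = 0 := Subsingleton.elim (α := E) _ _
      simp [lieFun, this]
    have h2 : ∀ g h : SmoothFn E M, (g - h) m = g m - h m := fun _ _ => rfl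
    rw [h2, this, this, this, sub_zero]
  obtain ⟨w, hw⟩ := exists_ne (0 : E)
  obtain ⟨W, hW⟩ := exists_smoothVF_apply_eq m (w : TangentSpace 𝓘(ℝ, E) m)
  have h1 := leibniz_lie X Y (fmul f W)
  rw [bracket_fmul, bracket_fmul, bracket_fmul, lie_add, lie_add, bracket_fmul, bracket_fmul,
    bracket_fmul, bracket_fmul] at h1
  have h2 := leibniz_lie X Y W
  have h3 : (fmul (lieD ⁅X, Y⁆ f) W) m = (fmul (lieD X (lieD Y f) - lieD Y (lieD X f)) W) m := by
    have h4 := congrArg (fun Z : SmoothVF E M => Z m) h1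
    have h5 := congrArg (fun Z : SmoothVF E M => Z m) h2
    simp only [ContMDiffSection.coe_add, Pi.add_apply, fmul_apply] at h4 h5 ⊢
    have h6 : (lieD X (lieD Y f) - lieD Y (lieD X f)) m
      = lieD X (lieD Y f) m - lieD Y (lieD X f) m := rfl
    rw [h5, smul_add] at h4
    rw [h6, sub_smul]
    rw [← sub_eq_zero] at h4 ⊢
    rw [← neg_eq_zero, ← h4]
    abel
  simp only [fmul_apply, hW] at h3
  exact smul_left_injective ℝ hw h3

instance : LieRingModule (SmoothVF E M) (SmoothFn E M) where
  bracket := lieD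
  add_lie X Y f := by ext m; exact lieFun_add_left X Y f m
  lie_add X f g := by ext m; exact lieFun_add X (f.mdiff m) (g.mdiff m)
  leibniz_lie X Y f := by
    change lieD X (lieD Y f) = lieD ⁅X, Y⁆ f + lieD Y (lieD X f)
    rw [lieD_bracket, sub_add_cancel]

theorem lie_eq_lieD (X : SmoothVF E M) (f : SmoothFn E M) : ⁅X, f⁆ = lieD X f := rfl

theorem lie_fn_apply (X : SmoothVF E M) (f : SmoothFn E M) (m : M) : ⁅X, f⁆ m = lieFun X f m := rfl

instance : LieModule ℝ (SmoothVF E M) (SmoothFn E M) where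
  smul_lie c X f := by ext m; exact lieFun_smul_left c X f m
  lie_smul c X f := by
    ext m
    have h := lieFun_mul X (f := fun _ : M => c) (m := m)
      (mdifferentiableAt_const (I := 𝓘(ℝ, E)) (I' := 𝓘(ℝ, ℝ))) (f.mdiff m)
    rw [lieFun_const, zero_mul, zero_add] at h
    exact h

end VectorFields
end NearlyPeriodic

/-! ### Averaging over the circle action -/

namespace NearlyPeriodic
open MeasureTheory Set

variable {E : Type*} [NormedAddCommGroup E] [NormedSpace ℝ E] [FiniteDimensional ℝ E]
  {M : Type*} [TopologicalSpace M] [ChartedSpace E M] [IsManifold 𝓘(ℝ, E) ∞ M] [T2Space M]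

section Pullback

/-- The pulled back field `Φ^*Y` is `Φ`-related to `Y`. -/
theorem mfderiv_mpullback (Φ : M ≃ₘ^∞⟮𝓘(ℝ, E), 𝓘(ℝ, E)⟯ M) (Y : VF E M) (m : M) :
    mfderiv 𝓘(ℝ, E) 𝓘(ℝ, E) Φ m (VectorField.mpullback 𝓘(ℝ, E) 𝓘(ℝ, E) Φ Y m) = Y (Φ m) := by
  have h := Φ.mfderivToContinuousLinearEquiv_coe (x := m) (by simp)
  rw [VectorField.mpullback_apply, ← h, ContinuousLinearMap.inverse_equiv]
  exact (Φ.mfderivToContinuousLinearEquiv (by simp) m).apply_symm_apply _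

theorem mvfderiv_comp_mpullback (Φ : M ≃ₘ^∞⟮𝓘(ℝ, E), 𝓘(ℝ, E)⟯ M) (Y : VF E M) {g : M → ℝ} {m : M}
    (hg : MDifferentiableAt 𝓘(ℝ, E) 𝓘(ℝ, ℝ) g (Φ m)) :
    lieFun (VectorField.mpullback 𝓘(ℝ, E) 𝓘(ℝ, E) Φ Y) (g ∘ Φ) m = lieFun Y g (Φ m) := by
  rw [lieFun, mvfderiv_comp_apply m hg (Φ.contMDiff.mdifferentiableAt (by simp)),
    mfderiv_mpullback]
  rfl

end Pullback

variable [MulAction Circle M] [ContMDiffSMul (𝓡 1) 𝓘(ℝ, E) ∞ Circle M]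

section Rotation

/-- The rotation `Φ_s` by the angle `s`. -/
def rot (s : ℝ) (m : M) : M := Circle.exp s • m

omit [TopologicalSpace M] [T2Space M] in
@[simp] theorem rot_zero (m : M) : rot 0 m = m := by simp [rot]

theorem rot_add (s t : ℝ) (m : M) : rot (s + t) m = rot s (rot t m) := by
  simp [rot, Circle.exp_add, mul_smul]

theorem rot_two_pi (m : M) : rot (2 * Real.pi) m = m := by simp [rot]

@[simp] theorem rot_neg_rot (s : ℝ) (m : M) : rot (-s) (rot s m) = m := by
  rw [← rot_add]; simp

@[simp] theorem rot_rot_neg (s : ℝ) (m : M) : rot s (rot (-s) m) = m := by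
  rw [← rot_add]; simp

theorem rot_periodic (m : M) : Function.Periodic (fun s => rot s m) (2 * Real.pi) := fun s => by
  change rot (s + 2 * Real.pi) m = rot s m
  rw [rot_add, rot_two_pi]

variable (E) in
theorem contMDiff_rot : ContMDiff (𝓘(ℝ, E).prod 𝓘(ℝ, ℝ)) 𝓘(ℝ, E) ∞
    (fun p : M × ℝ => rot p.2 p.1) :=
  ContMDiff.smul (I := 𝓡 1) (contMDiff_circleExp.comp contMDiff_snd) contMDiff_fst

variable (E) in
/-- The rotation `Φ_s` as a diffeomorphism. -/
def rotDiffeo (s : ℝ) : M ≃ₘ^∞⟮𝓘(ℝ, E), 𝓘(ℝ, E)⟯ M :=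
  Diffeomorph.smul (𝓡 1) 𝓘(ℝ, E) ∞ (Circle.exp s)

theorem coe_rotDiffeo (s : ℝ) : (rotDiffeo E s : M → M) = rot s := rfl

/-- The function `f ∘ Φ_s`. -/
def rotFn (s : ℝ) (f : SmoothFn E M) : SmoothFn E M :=
  ⟨f ∘ rot s, f.contMDiff.comp (rotDiffeo E s).contMDiff⟩

@[simp] theorem rotFn_apply (s : ℝ) (f : SmoothFn E M) (m : M) : rotFn s f m = f (rot s m) := rfl

theorem rotFn_rotFn (s t : ℝ) (f : SmoothFn E M) : rotFn s (rotFn t f) = rotFn (s + t) f := by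
  ext m; simp [add_comm s t, rot_add]

theorem JointlySmooth.rot {f : ℝ → M → ℝ} (hf : JointlySmooth E f) :
    JointlySmooth E (fun s m => f s (rot s m)) :=
  ContMDiff.comp (g := fun p : M × ℝ => f p.2 p.1) (f := fun p : M × ℝ => (NearlyPeriodic.rot p.2 p.1, p.2)) hf
    ((contMDiff_rot E).prodMk contMDiff_snd)

theorem JointlySmooth.neg {f : ℝ → M → ℝ} (hf : JointlySmooth E f) :
    JointlySmooth E (fun s m => f (-s) m) :=
  ContMDiff.comp (g := fun p : M × ℝ => f p.2 p.1) (f := fun p : M × ℝ => (p.1, -p.2)) hf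
    (contMDiff_fst.prodMk contMDiff_snd.neg)

theorem jointlySmooth_rotFn (f : SmoothFn E M) : JointlySmooth E (fun s => rotFn s f) :=
  (JointlySmooth.const (P := ℝ) f).rot

theorem continuous_rotFn (f : SmoothFn E M) (m : M) : Continuous fun s => f (rot s m) :=
  ((jointlySmooth_rotFn f).param m).continuous

variable {R₀ : SmoothVF E M} (hR₀ : ∀ m, R₀ m = generator E m)
include hR₀

theorem hasDerivAt_rot (f : SmoothFn E M) (m : M) (s : ℝ) :
    HasDerivAt (fun s => f (rot s m)) (⁅R₀, f⁆ (rot s m)) s := by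
  have h0 : ∀ m, HasDerivAt (fun s => f (rot s m)) (⁅R₀, f⁆ m) 0 := by
    intro m
    have h1 : MDifferentiableAt 𝓘(ℝ, ℝ) 𝓘(ℝ, E) (fun θ : ℝ => rot θ m) 0 :=
      (ContMDiff.comp (g := fun p : M × ℝ => rot p.2 p.1) (f := fun s : ℝ => (m, s))
        (contMDiff_rot E) (contMDiff_const.prodMk contMDiff_id)).mdifferentiableAt (by simp)
    have h2 := mvfderiv_comp_apply (v := (1 : ℝ)) (0 : ℝ) (f.mdiff (rot 0 m)) h1
    have h3 : HasDerivAt (fun s => f (rot s m))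
        (mvfderiv 𝓘(ℝ, ℝ) ((f : M → ℝ) ∘ fun θ : ℝ => rot θ m) 0 (1 : ℝ)) 0 := by
      have h4 : DifferentiableAt ℝ (fun s => f (rot s m)) 0 :=
        ((jointlySmooth_rotFn f).param m).differentiable (by simp) _
      exact h4.hasFDerivAt.hasDerivAt.congr_deriv
        (congrArg (fun L : ℝ →L[ℝ] ℝ => L 1) (mfderiv_eq_fderiv (f := fun s => f (rot s m)) (x := 0))).symm
    refine h3.congr_deriv (h2.trans ?_)
    rw [lie_fn_apply, lieFun, hR₀ m, rot_zero]
    rfl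
  have h1 := h0 (rot s m)
  rw [← sub_self s] at h1
  refine (h1.comp_sub_const s s).congr_of_eventuallyEq (Filter.Eventually.of_forall fun r => ?_)
  simp [← rot_add]

/-- The generator is invariant under the action that it generates. -/
theorem lie_rotFn (f : SmoothFn E M) (s : ℝ) : ⁅R₀, rotFn s f⁆ = rotFn s ⁅R₀, f⁆ := by
  ext m
  have h1 := hasDerivAt_rot hR₀ (rotFn s f) m 0
  have h2 := hasDerivAt_rot hR₀ f m (s + 0)
  have h3 : HasDerivAt (fun r => f (rot (s + r) m)) (⁅R₀, f⁆ (rot (s + 0) m)) 0 :=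
    HasDerivAt.comp_const_add s 0 h2
  have h4 : (fun r => rotFn s f (rot r m)) = fun r => f (rot (s + r) m) := by
    ext r; simp [rot_add]
  rw [h4, rot_zero] at h1
  simpa using h1.unique h3

theorem rot_eq_of_lie_eq_zero {f : SmoothFn E M} (hf : ⁅R₀, f⁆ = 0) (s : ℝ) (m : M) :
    f (rot s m) = f m := by
  have := is_const_of_deriv_eq_zero (f := fun s => f (rot s m))
    (fun s => (hasDerivAt_rot hR₀ f m s).differentiableAt)
    (fun s => by rw [(hasDerivAt_rot hR₀ f m s).deriv, hf]; rfl) s 0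
  simpa using this

theorem lie_eq_zero_of_rot_eq {f : SmoothFn E M} (hf : ∀ s m, f (rot s m) = f m) :
    ⁅R₀, f⁆ = 0 := by
  ext m
  have h1 := hasDerivAt_rot hR₀ f m 0
  simp only [hf, rot_zero] at h1
  exact h1.unique (hasDerivAt_const _ _)

end Rotation

section Averages

/-- The weight of the average over the circle. -/
def weight₀ : ℝ → ℝ := fun _ => (2 * Real.pi)⁻¹

/-- The weight `(s - π) / 2π`: its derivative is the weight of the average, and it takes the values
`-1/2` and `1/2` at the ends of the period. -/
def weight₁ : ℝ → ℝ := fun s => (2 * Real.pi)⁻¹ * (s - Real.pi)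

theorem contDiff_weight₀ : ContDiff ℝ ∞ weight₀ := contDiff_const
theorem contDiff_weight₁ : ContDiff ℝ ∞ weight₁ := contDiff_const.mul (contDiff_id.sub contDiff_const)

theorem integral_weight₀_mul_deriv {q q' : ℝ → ℝ} (hq : ∀ s, HasDerivAt q (q' s) s)
    (hc : Continuous q') (hp : q (2 * Real.pi) = q 0) :
    ∫ s in (0 : ℝ)..(2 * Real.pi), weight₀ s * q' s = 0 := by
  simp only [weight₀]
  rw [intervalIntegral.integral_const_mul,
    intervalIntegral.integral_eq_sub_of_hasDerivAt (fun s _ => hq s) (hc.intervalIntegrable _ _)]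
  simp [hp]

/-- Integration by parts against the sawtooth weight. The jump of the weight at the period produces the
value `q 0`; its slope produces the mean value of `q`. -/
theorem integral_weight₁_mul_deriv {q q' : ℝ → ℝ} (hq : ∀ s, HasDerivAt q (q' s) s)
    (hc : Continuous q') (hp : q (2 * Real.pi) = q 0) :
    ∫ s in (0 : ℝ)..(2 * Real.pi), weight₁ s * q' s
      = q 0 - ∫ s in (0 : ℝ)..(2 * Real.pi), weight₀ s * q s := by
  have h1 : ∀ s, HasDerivAt weight₁ (weight₀ s) s := fun s => by
    have := ((hasDerivAt_id s).sub_const Real.pi).const_mul (2 * Real.pi)⁻¹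
    exact this.congr_deriv (mul_one _)
  have := intervalIntegral.integral_mul_deriv_eq_deriv_mul (a := 0) (b := 2 * Real.pi)
    (fun s _ => h1 s) (fun s _ => hq s) (contDiff_weight₀.continuous.intervalIntegrable _ _)
    (hc.intervalIntegrable _ _)
  rw [this, hp]
  have hpi := Real.pi_ne_zero
  simp only [weight₁]
  field_simp
  ring

theorem intervalIntegrable_weight {w q : ℝ → ℝ} (hw : ContDiff ℝ ∞ w) (hq : Continuous q)
    (a b : ℝ) : IntervalIntegrable (fun s => w s * q s) volume a b :=
  (hw.continuous.mul hq).intervalIntegrable a b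

/-- The weighted orbit integral `m ↦ ∫₀^{2π} w(s) f(Φ_s m) ds`. -/
def orbitInt (w : ℝ → ℝ) (hw : ContDiff ℝ ∞ w) : SmoothFn E M →ₗ[ℝ] SmoothFn E M where
  toFun f := ⟨fun m => ∫ s in (0 : ℝ)..(2 * Real.pi), w s * f (rot s m),
    contMDiff_intervalIntegral (h := fun m s => w s * f (rot s m))
      ((JointlySmooth.of_param hw).mul (jointlySmooth_rotFn f)) _ _⟩
  map_add' f g := by
    ext m
    change ∫ s in (0 : ℝ)..(2 * Real.pi), w s * (f (rot s m) + g (rot s m)) = _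
    simp only [mul_add]
    exact intervalIntegral.integral_add
      (intervalIntegrable_weight hw (continuous_rotFn f m) _ _)
      (intervalIntegrable_weight hw (continuous_rotFn g m) _ _)
  map_smul' c f := by
    ext m
    change ∫ s in (0 : ℝ)..(2 * Real.pi), w s * (c * f (rot s m)) = _
    simp only [mul_left_comm _ c]
    exact intervalIntegral.integral_const_mul _ _

theorem orbitInt_apply (w : ℝ → ℝ) (hw : ContDiff ℝ ∞ w) (f : SmoothFn E M) (m : M) :
    orbitInt w hw f m = ∫ s in (0 : ℝ)..(2 * Real.pi), w s * f (rot s m) := rfl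

variable (E M) in
/-- The average over the circle action. -/
def avg : SmoothFn E M →ₗ[ℝ] SmoothFn E M := orbitInt weight₀ contDiff_weight₀

variable (E M) in
/-- The homotopy operator for `L_{R₀}`: `R₀ (hom f) = f - avg f` and `avg (hom f) = 0`. -/
def hom : SmoothFn E M →ₗ[ℝ] SmoothFn E M :=
  orbitInt weight₁ contDiff_weight₁ - avg E M ∘ₗ orbitInt weight₁ contDiff_weight₁

theorem avg_apply (f : SmoothFn E M) (m : M) :
    avg E M f m = ∫ s in (0 : ℝ)..(2 * Real.pi), weight₀ s * f (rot s m) := rfl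

theorem avg_of_rot_eq {f : SmoothFn E M} {m : M} (hf : ∀ s, f (rot s m) = f m) :
    avg E M f m = f m := by
  rw [avg_apply]
  simp only [hf, weight₀, intervalIntegral.integral_const, sub_zero, smul_eq_mul]
  have := Real.pi_ne_zero
  field_simp

theorem avg_rot (f : SmoothFn E M) (r : ℝ) (m : M) : avg E M f (rot r m) = avg E M f m := by
  rw [avg_apply, avg_apply]
  simp only [weight₀, intervalIntegral.integral_const_mul]
  congr 1
  have h1 : Function.Periodic (fun s => f (rot s m)) (2 * Real.pi) := fun s => by
    simp only [rot_periodic m s]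
  have h2 := h1.intervalIntegral_add_eq 0 r
  rw [zero_add] at h2
  simp only [← rot_add]
  rw [h2, intervalIntegral.integral_comp_add_right (fun s => f (rot s m)) r, zero_add, add_comm]

theorem avg_avg (f : SmoothFn E M) : avg E M (avg E M f) = avg E M f := by
  ext m; exact avg_of_rot_eq fun s => avg_rot f s m

theorem avg_hom (f : SmoothFn E M) : avg E M (hom E M f) = 0 := by
  simp [hom, avg_avg]

variable {R₀ : SmoothVF E M} (hR₀ : ∀ m, R₀ m = generator E m)
include hR₀

theorem lie_avg (f : SmoothFn E M) : ⁅R₀, avg E M f⁆ = 0 :=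
  lie_eq_zero_of_rot_eq hR₀ fun s m => avg_rot f s m

theorem lie_orbitInt (w : ℝ → ℝ) (hw : ContDiff ℝ ∞ w) (f : SmoothFn E M) :
    ⁅R₀, orbitInt w hw f⁆ = orbitInt w hw ⁅R₀, f⁆ := by
  ext m
  rw [orbitInt_apply]
  have := mvfderiv_intervalIntegral (h := fun m s => w s * f (rot s m))
    ((JointlySmooth.of_param hw).mul (jointlySmooth_rotFn f)) m (R₀ m) 0 (2 * Real.pi)
  refine this.trans (intervalIntegral.integral_congr fun s _ => ?_)
  have h2 := lie_smul (w s) R₀ (rotFn s f)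
  rw [lie_rotFn hR₀] at h2
  exact congrArg (fun g : SmoothFn E M => g m) h2

theorem avg_lie (f : SmoothFn E M) : avg E M ⁅R₀, f⁆ = 0 := by
  rw [avg, ← lie_orbitInt hR₀]; exact lie_avg hR₀ f

/-- The homological equation `R₀ g = f - avg f` is solved by `g = hom f`. -/
theorem lie_hom (f : SmoothFn E M) : ⁅R₀, hom E M f⁆ = f - avg E M f := by
  have h1 : hom E M f = orbitInt weight₁ contDiff_weight₁ f
    - avg E M (orbitInt weight₁ contDiff_weight₁ f) := rfl
  rw [h1, lie_sub, lie_avg hR₀, sub_zero, lie_orbitInt hR₀]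
  ext m
  rw [orbitInt_apply]
  refine (integral_weight₁_mul_deriv (fun s => hasDerivAt_rot hR₀ f m s)
    (continuous_rotFn ⁅R₀, f⁆ m) (by simp [rot_two_pi])).trans ?_
  rw [rot_zero]
  rfl

end Averages

section AveragesVF

/-- The pullback `Φ_s^* Y` of a vector field under a rotation. -/
def pull (s : ℝ) (Y : SmoothVF E M) : VF E M :=
  VectorField.mpullback 𝓘(ℝ, E) 𝓘(ℝ, E) (rot s) Y

theorem lieFun_pull (s : ℝ) (Y : SmoothVF E M) (f : SmoothFn E M) (m : M) :
    lieFun (pull s Y) f m = ⁅Y, rotFn (-s) f⁆ (rot s m) := by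
  have h := mvfderiv_comp_mpullback (rotDiffeo E s) Y (g := rotFn (-s) f) (m := m)
    ((rotFn (-s) f).mdiff _)
  rw [coe_rotDiffeo] at h
  have h2 : (rotFn (-s) f : M → ℝ) ∘ rot s = f := by ext m; simp
  rw [h2] at h
  exact h

theorem jointlySmooth_lie_rotFn (Y : SmoothVF E M) (f : SmoothFn E M) :
    JointlySmooth E (fun s m => ⁅Y, rotFn (-s) f⁆ m) :=
  (jointlySmooth_rotFn f).neg.lie Y

theorem jointlySmooth_lieFun_pull (Y : SmoothVF E M) (f : SmoothFn E M) :
    JointlySmooth E (fun s => lieFun (pull s Y) f) := by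
  simp only [JointlySmooth, lieFun_pull]
  exact (jointlySmooth_lie_rotFn Y f).rot

theorem smoothVFFamily_pull (Y : SmoothVF E M) : SmoothVFFamily (fun s => pull s Y) :=
  smoothVFFamily_of_lie (jointlySmooth_lieFun_pull Y)

theorem continuous_pull (Y : SmoothVF E M) (m : M) :
    Continuous (fun s => tangentCoord (pull s Y m)) := by
  obtain ⟨x, e, h⟩ := exists_local_frame (E := E) m
  have h1 : (fun s => tangentCoord (pull s Y m))
      = fun s => ∑ i, lieFun (pull s Y) (x i) m • tangentCoord (e i m) := by
    ext s
    exact h.self_of_nhds (pull s Y m)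
  rw [h1]
  exact continuous_finsetSum _ fun i _ =>
    ((jointlySmooth_lieFun_pull Y (x i)).param m).continuous.smul continuous_const

/-- The rotated vector field `Φ_s^* Y` as a smooth vector field. -/
def pullVF (s : ℝ) (Y : SmoothVF E M) : SmoothVF E M :=
  ⟨pull s Y, fun m => ContMDiff.comp (g := fun p : M × ℝ => Bundle.TotalSpace.mk' E
      (E := (TangentSpace 𝓘(ℝ, E) : M → Type _)) p.1 (pull p.2 Y p.1)) (f := fun m => (m, s))
      (smoothVFFamily_pull Y) (contMDiff_id.prodMk contMDiff_const) m⟩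

theorem lie_pullVF (s : ℝ) (Y : SmoothVF E M) (f : SmoothFn E M) :
    ⁅pullVF s Y, f⁆ = rotFn s ⁅Y, rotFn (-s) f⁆ := by
  ext m; exact lieFun_pull s Y f m

theorem pullVF_pullVF (s t : ℝ) (Y : SmoothVF E M) :
    pullVF s (pullVF t Y) = pullVF (s + t) Y := by
  refine SmoothVF.ext_lieD fun f => ?_
  simp only [← lie_eq_lieD, lie_pullVF, rotFn_rotFn]
  congr 3
  ring

theorem rotFn_zero (f : SmoothFn E M) : rotFn 0 f = f := by ext m; simp

theorem pullVF_zero (Y : SmoothVF E M) : pullVF 0 Y = Y := by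
  refine SmoothVF.ext_lieD fun f => ?_
  simp only [← lie_eq_lieD, lie_pullVF, neg_zero, rotFn_zero]

theorem pullVF_two_pi (Y : SmoothVF E M) : pullVF (2 * Real.pi) Y = Y := by
  have h : ∀ g : SmoothFn E M, rotFn (2 * Real.pi) g = g := fun g => by ext m; simp [rot_two_pi]
  have h' : ∀ g : SmoothFn E M, rotFn (-(2 * Real.pi)) g = g := fun g => by
    conv_lhs => rw [← h g]
    rw [rotFn_rotFn, neg_add_cancel, rotFn_zero]
  refine SmoothVF.ext_lieD fun f => ?_
  simp only [← lie_eq_lieD, lie_pullVF, h, h']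

/-- The weighted orbit integral `∫₀^{2π} w(s) Φ_s^* Y ds` of a vector field. -/
def orbitIntVFAux (w : ℝ → ℝ) (Y : SmoothVF E M) : VF E M := fun m =>
  (∫ s in (0 : ℝ)..(2 * Real.pi), w s • tangentCoord (pull s Y m) : E)

theorem lieFun_orbitIntVFAux {w : ℝ → ℝ} (hw : ContDiff ℝ ∞ w) (Y : SmoothVF E M)
    (f : SmoothFn E M) (m : M) : lieFun (orbitIntVFAux w Y) f m
      = ∫ s in (0 : ℝ)..(2 * Real.pi), w s * ⁅pullVF s Y, f⁆ m := by
  haveI := FiniteDimensional.complete ℝ E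
  let L : E →L[ℝ] ℝ := mvfderiv 𝓘(ℝ, E) f m
  have h1 := L.intervalIntegral_comp_comm (μ := volume) (a := 0) (b := 2 * Real.pi)
    (f := fun s => w s • tangentCoord (pull s Y m))
    ((hw.continuous.smul (continuous_pull Y m)).intervalIntegrable _ _)
  refine Eq.trans h1.symm (intervalIntegral.integral_congr fun s _ => ?_)
  simp only [map_smul, smul_eq_mul]
  rfl

theorem contMDiff_lieFun_orbitIntVFAux {w : ℝ → ℝ} (hw : ContDiff ℝ ∞ w) (Y : SmoothVF E M)
    (f : SmoothFn E M) : ContMDiff 𝓘(ℝ, E) 𝓘(ℝ, ℝ) ∞ (lieFun (orbitIntVFAux w Y) f) := by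
  have h : lieFun (orbitIntVFAux w Y) f
      = fun m => ∫ s in (0 : ℝ)..(2 * Real.pi), w s * ⁅pullVF s Y, f⁆ m :=
    funext fun m => lieFun_orbitIntVFAux hw Y f m
  rw [h]
  exact contMDiff_intervalIntegral (h := fun m s => w s * ⁅pullVF s Y, f⁆ m)
    ((JointlySmooth.of_param hw).mul (jointlySmooth_lieFun_pull Y f)) _ _

/-- The weighted orbit integral of a vector field, as a smooth vector field. -/
def orbitIntVF (w : ℝ → ℝ) (hw : ContDiff ℝ ∞ w) (Y : SmoothVF E M) : SmoothVF E M :=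
  (exists_smoothVF_of_lie (contMDiff_lieFun_orbitIntVFAux hw Y)).choose

theorem lie_orbitIntVF (w : ℝ → ℝ) (hw : ContDiff ℝ ∞ w) (Y : SmoothVF E M)
    (f : SmoothFn E M) (m : M) : ⁅orbitIntVF w hw Y, f⁆ m
      = ∫ s in (0 : ℝ)..(2 * Real.pi), w s * ⁅pullVF s Y, f⁆ m := by
  rw [← lieFun_orbitIntVFAux hw, lie_fn_apply, orbitIntVF,
    (exists_smoothVF_of_lie (contMDiff_lieFun_orbitIntVFAux hw Y)).choose_spec]

/-- The average of a vector field over the circle action. -/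
def avgVF (Y : SmoothVF E M) : SmoothVF E M := orbitIntVF weight₀ contDiff_weight₀ Y

/-- The homotopy operator for the bracket with `R₀`. -/
def homVF (Y : SmoothVF E M) : SmoothVF E M := orbitIntVF weight₁ contDiff_weight₁ Y

/-- Averaged vector fields commute with the rotations, as derivations of the functions. -/
theorem rotFn_lie_avgVF (Y : SmoothVF E M) (f : SmoothFn E M) (r : ℝ) :
    rotFn r ⁅avgVF Y, f⁆ = ⁅avgVF Y, rotFn r f⁆ := by
  ext m
  rw [rotFn_apply, avgVF, lie_orbitIntVF, lie_orbitIntVF]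
  simp only [weight₀, intervalIntegral.integral_const_mul]
  congr 1
  have h0 : ∀ s, ⁅pullVF s Y, f⁆ (rot r m) = ⁅pullVF (s + r) Y, rotFn r f⁆ m := by
    intro s
    rw [add_comm s r, ← pullVF_pullVF, lie_pullVF r, rotFn_rotFn, neg_add_cancel, rotFn_zero]
    rfl
  simp only [h0]
  have h1 : Function.Periodic (fun s => ⁅pullVF s Y, rotFn r f⁆ m) (2 * Real.pi) := fun s => by
    simp only [← pullVF_pullVF s, pullVF_two_pi]
  have h2 := h1.intervalIntegral_add_eq 0 r
  rw [zero_add] at h2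
  rw [h2, intervalIntegral.integral_comp_add_right (fun s => ⁅pullVF s Y, rotFn r f⁆ m) r,
    zero_add, add_comm]

/-- Averaged vector fields are invariant under the rotations. -/
theorem pullVF_avgVF (Y : SmoothVF E M) (r : ℝ) : pullVF r (avgVF Y) = avgVF Y := by
  refine SmoothVF.ext_lieD fun f => ?_
  simp only [← lie_eq_lieD, lie_pullVF, rotFn_lie_avgVF, rotFn_rotFn, add_neg_cancel, rotFn_zero]

/-- Derivative along the diagonal of a function of two variables. -/
theorem hasDerivAt_diag {K : ℝ → ℝ → ℝ} {A B s : ℝ}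
    (hK : DifferentiableAt ℝ (fun p : ℝ × ℝ => K p.1 p.2) (s, s))
    (hA : HasDerivAt (fun a => K a s) A s) (hB : HasDerivAt (K s) B s) :
    HasDerivAt (fun a => K a a) (A + B) s := by
  have h := hK.hasFDerivAt
  have h1 := (HasFDerivAt.comp (g := fun p : ℝ × ℝ => K p.1 p.2) (f := fun a => (a, s)) s h
    (hasFDerivAt_prodMk_left (𝕜 := ℝ) s s)).hasDerivAt
  have h2 := (HasFDerivAt.comp (g := fun p : ℝ × ℝ => K p.1 p.2) (f := fun a => (s, a)) s h
    (hasFDerivAt_prodMk_right (𝕜 := ℝ) s s)).hasDerivAt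
  have h3 := (HasFDerivAt.comp (g := fun p : ℝ × ℝ => K p.1 p.2) (f := fun a => (a, a)) s h
    ((hasFDerivAt_id (𝕜 := ℝ) s).prodMk (hasFDerivAt_id (𝕜 := ℝ) s))).hasDerivAt
  have e1 := hA.unique h1
  have e2 := hB.unique h2
  refine HasDerivAt.congr_deriv (f := fun a => K a a) h3 ?_
  rw [e1, e2]
  simp only [ContinuousLinearMap.comp_apply, ContinuousLinearMap.inl_apply,
    ContinuousLinearMap.inr_apply, ← map_add]
  simp

variable {R₀ : SmoothVF E M} (hR₀ : ∀ m, R₀ m = generator E m)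
include hR₀

/-- The pullback `Φ_s^* Y` has derivative `[R₀, Φ_s^* Y]` in `s`. -/
theorem hasDerivAt_pullVF (Y : SmoothVF E M) (f : SmoothFn E M) (m : M) (s : ℝ) :
    HasDerivAt (fun s => ⁅pullVF s Y, f⁆ m) (⁅⁅R₀, pullVF s Y⁆, f⁆ m) s := by
  have h1 : (fun s => ⁅pullVF s Y, f⁆ m) = fun s => (fun a b => ⁅Y, rotFn (-a) f⁆ (rot b m)) s s := by
    ext s; rw [lie_pullVF]; rfl
  have e : ⁅⁅R₀, pullVF s Y⁆, f⁆ m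
      = -⁅Y, rotFn (-s) ⁅R₀, f⁆⁆ (rot s m) + ⁅R₀, ⁅Y, rotFn (-s) f⁆⁆ (rot s m) := by
    rw [lie_lie, lie_pullVF, lie_pullVF]
    change ⁅R₀, rotFn s ⁅Y, rotFn (-s) f⁆⁆ m - ⁅Y, rotFn (-s) ⁅R₀, f⁆⁆ (rot s m) = _
    rw [lie_rotFn hR₀, rotFn_apply]
    ring
  rw [h1, e]
  refine hasDerivAt_diag (K := fun a b => ⁅Y, rotFn (-a) f⁆ (rot b m)) ?_ ?_ ?_
  · have h2 : ContMDiff 𝓘(ℝ, ℝ × ℝ) 𝓘(ℝ, ℝ) ∞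
        (fun p : ℝ × ℝ => ⁅Y, rotFn (-p.1) f⁆ (rot p.2 m)) := by
      refine ContMDiff.comp (g := fun p : M × ℝ => ⁅Y, rotFn (-p.2) f⁆ p.1)
        (f := fun p : ℝ × ℝ => (rot p.2 m, p.1)) (jointlySmooth_lie_rotFn Y f) ?_
      refine ContMDiff.prodMk ?_ contDiff_fst.contMDiff
      exact ContMDiff.comp (g := fun p : M × ℝ => rot p.2 p.1) (f := fun p : ℝ × ℝ => (m, p.2))
        (contMDiff_rot E) (contMDiff_const.prodMk contDiff_snd.contMDiff)
    exact h2.contDiff.differentiable (by simp) _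
  · have h3 := hasDerivAt_mvfderiv (h := fun m s => f (rot (-s) m))
      (h' := fun m s => -⁅R₀, f⁆ (rot (-s) m)) (jointlySmooth_rotFn f).neg
      (fun m t => by
        have := (hasDerivAt_rot hR₀ f m (-t)).comp t (hasDerivAt_neg t)
        simpa using! this) (rot s m) (Y (rot s m)) s
    have h4 := lie_neg Y (rotFn (-s) ⁅R₀, f⁆)
    have h5 := congrArg (fun g : SmoothFn E M => g (rot s m)) h4
    exact h3.congr_deriv h5
  · exact hasDerivAt_rot hR₀ ⁅Y, rotFn (-s) f⁆ m s

theorem lie_orbitIntVF_lie (w : ℝ → ℝ) (hw : ContDiff ℝ ∞ w) (Y : SmoothVF E M)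
    (f : SmoothFn E M) (m : M) : ⁅⁅R₀, orbitIntVF w hw Y⁆, f⁆ m
      = ∫ s in (0 : ℝ)..(2 * Real.pi), w s * ⁅⁅R₀, pullVF s Y⁆, f⁆ m := by
  have h0 : ∀ g : SmoothFn E M, JointlySmooth E (fun s m => w s * ⁅pullVF s Y, g⁆ m) := fun g =>
    (JointlySmooth.of_param hw).mul (jointlySmooth_lieFun_pull Y g)
  have h1 : ⁅R₀, ⁅orbitIntVF w hw Y, f⁆⁆ m
      = ∫ s in (0 : ℝ)..(2 * Real.pi), w s * ⁅R₀, ⁅pullVF s Y, f⁆⁆ m := by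
    have h2 : ((⁅orbitIntVF w hw Y, f⁆ : SmoothFn E M) : M → ℝ)
        = fun m => ∫ s in (0 : ℝ)..(2 * Real.pi), w s * ⁅pullVF s Y, f⁆ m :=
      funext fun m => lie_orbitIntVF w hw Y f m
    rw [lie_fn_apply, lieFun, h2]
    refine (mvfderiv_intervalIntegral (h := fun m s => w s * ⁅pullVF s Y, f⁆ m) (h0 f) m (R₀ m)
      0 (2 * Real.pi)).trans (intervalIntegral.integral_congr fun s _ => ?_)
    exact congrArg (fun g : SmoothFn E M => g m) (lie_smul (w s) R₀ ⁅pullVF s Y, f⁆)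
  have hc1 : Continuous fun s => w s * ⁅R₀, ⁅pullVF s Y, f⁆⁆ m :=
    hw.continuous.mul
      (((JointlySmooth.lie (jointlySmooth_lieFun_pull Y f) R₀).param m).continuous)
  have hc2 : Continuous fun s => w s * ⁅pullVF s Y, ⁅R₀, f⁆⁆ m := ((h0 ⁅R₀, f⁆).param m).continuous
  rw [lie_lie]
  change ⁅R₀, ⁅orbitIntVF w hw Y, f⁆⁆ m - ⁅orbitIntVF w hw Y, ⁅R₀, f⁆⁆ m = _
  rw [h1, lie_orbitIntVF, ← intervalIntegral.integral_sub (hc1.intervalIntegrable _ _)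
    (hc2.intervalIntegrable _ _)]
  refine intervalIntegral.integral_congr fun s _ => ?_
  simp only [lie_lie]
  change _ = w s * (_ - _)
  ring

theorem continuous_lie_pullVF (Y : SmoothVF E M) (f : SmoothFn E M) (m : M) :
    Continuous fun s => ⁅⁅R₀, pullVF s Y⁆, f⁆ m := by
  simp only [lie_lie]
  exact Continuous.sub (((JointlySmooth.lie (jointlySmooth_lieFun_pull Y f) R₀).param m).continuous)
    ((jointlySmooth_lieFun_pull Y ⁅R₀, f⁆).param m).continuous

theorem lie_avgVF (Y : SmoothVF E M) : ⁅R₀, avgVF Y⁆ = 0 := by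
  refine SmoothVF.ext_lieD fun f => ?_
  ext m
  refine (lie_orbitIntVF_lie hR₀ _ _ Y f m).trans ?_
  rw [integral_weight₀_mul_deriv (fun s => hasDerivAt_pullVF hR₀ Y f m s)
    (continuous_lie_pullVF hR₀ Y f m) (by rw [pullVF_two_pi, pullVF_zero]), ← lie_eq_lieD, zero_lie]
  rfl

/-- The homological equation `[R₀, Z] = Y - avgVF Y` is solved by `Z = homVF Y`. -/
theorem lie_homVF (Y : SmoothVF E M) : ⁅R₀, homVF Y⁆ = Y - avgVF Y := by
  refine SmoothVF.ext_lieD fun f => ?_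
  ext m
  refine (lie_orbitIntVF_lie hR₀ _ _ Y f m).trans ?_
  rw [integral_weight₁_mul_deriv (fun s => hasDerivAt_pullVF hR₀ Y f m s)
    (continuous_lie_pullVF hR₀ Y f m) (by rw [pullVF_two_pi, pullVF_zero]), ← lie_eq_lieD, sub_lie]
  change _ = ⁅Y, f⁆ m - ⁅avgVF Y, f⁆ m
  rw [avgVF, lie_orbitIntVF, pullVF_zero]

end AveragesVF
end NearlyPeriodic

/-! ### Formal Lie transformations -/

namespace NearlyPeriodic
open MeasureTheory Set

section FormalTransformations
open Finset HasAntidiagonal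

/-- The coefficients of the product `b(u, v)` of two formal series in one variable. -/
def cauchy {V₁ V₂ V₃ : Type*} [AddCommGroup V₁] [Module ℝ V₁] [AddCommGroup V₂] [Module ℝ V₂]
    [AddCommGroup V₃] [Module ℝ V₃] (b : V₁ →ₗ[ℝ] V₂ →ₗ[ℝ] V₃) (u : ℕ → V₁) (v : ℕ → V₂) (n : ℕ) :
    V₃ :=
  ∑ p ∈ antidiagonal n, b (u p.1) (v p.2)

/-- The constant formal series. -/
def constSeq {V : Type*} [Zero V] (x : V) (n : ℕ) : V := if n = 0 then x else 0

theorem cauchy_constSeq_left {V₁ V₂ V₃ : Type*} [AddCommGroup V₁] [Module ℝ V₁] [AddCommGroup V₂]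
    [Module ℝ V₂] [AddCommGroup V₃] [Module ℝ V₃] (b : V₁ →ₗ[ℝ] V₂ →ₗ[ℝ] V₃) (x : V₁) (v : ℕ → V₂)
    (n : ℕ) : cauchy b (constSeq x) v n = b x (v n) := by
  rw [cauchy, sum_eq_single (0, n)]
  · simp [constSeq]
  · rintro ⟨i, j⟩ h1 h2
    have : i ≠ 0 := by rintro rfl; simp_all
    simp [constSeq, this]
  · simp

theorem cauchy_constSeq_right {V₁ V₂ V₃ : Type*} [AddCommGroup V₁] [Module ℝ V₁] [AddCommGroup V₂]
    [Module ℝ V₂] [AddCommGroup V₃] [Module ℝ V₃] (b : V₁ →ₗ[ℝ] V₂ →ₗ[ℝ] V₃) (u : ℕ → V₁) (x : V₂)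
    (n : ℕ) : cauchy b u (constSeq x) n = b (u n) x := by
  rw [cauchy, sum_eq_single (n, 0)]
  · simp [constSeq]
  · rintro ⟨i, j⟩ h1 h2
    have : j ≠ 0 := by rintro rfl; simp_all
    simp [constSeq, this]
  · simp

/-- The exchange of the two middle indices in a fourfold convolution. -/
theorem sum_antidiagonal_exchange {V : Type*} [AddCommMonoid V] (f : ℕ → ℕ → ℕ → ℕ → V) (n : ℕ) :
    ∑ p ∈ antidiagonal n, ∑ q ∈ antidiagonal p.1, ∑ r ∈ antidiagonal p.2, f q.1 q.2 r.1 r.2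
      = ∑ p ∈ antidiagonal n, ∑ q ∈ antidiagonal p.1, ∑ r ∈ antidiagonal p.2,
          f q.1 r.1 q.2 r.2 := by
  simp only [← sum_product', sum_sigma']
  refine sum_nbij' (fun x => ⟨(x.2.1.1 + x.2.2.1, x.2.1.2 + x.2.2.2),
    ((x.2.1.1, x.2.2.1), (x.2.1.2, x.2.2.2))⟩) (fun x => ⟨(x.2.1.1 + x.2.2.1, x.2.1.2 + x.2.2.2),
    ((x.2.1.1, x.2.2.1), (x.2.1.2, x.2.2.2))⟩) ?_ ?_ ?_ ?_ ?_
  · rintro ⟨⟨a, b⟩, ⟨c, d⟩, ⟨e, g⟩⟩ h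
    simp at h ⊢
    omega
  · rintro ⟨⟨a, b⟩, ⟨c, d⟩, ⟨e, g⟩⟩ h
    simp at h ⊢
    omega
  · rintro ⟨⟨a, b⟩, ⟨c, d⟩, ⟨e, g⟩⟩ h
    simp at h
    obtain ⟨h1, rfl, rfl⟩ := h
    rfl
  · rintro ⟨⟨a, b⟩, ⟨c, d⟩, ⟨e, g⟩⟩ h
    simp at h
    obtain ⟨h1, rfl, rfl⟩ := h
    rfl
  · rintro ⟨⟨a, b⟩, ⟨c, d⟩, ⟨e, g⟩⟩ h
    rfl

theorem sum_antidiagonal_assoc {V : Type*} [AddCommMonoid V] (f : ℕ → ℕ → ℕ → V) (n : ℕ) :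
    ∑ p ∈ antidiagonal n, ∑ q ∈ antidiagonal p.2, f p.1 q.1 q.2
      = ∑ p ∈ antidiagonal n, ∑ q ∈ antidiagonal p.1, f q.1 q.2 p.2 := by
  simp only [sum_sigma']
  refine sum_nbij' (fun x => ⟨(x.1.1 + x.2.1, x.2.2), (x.1.1, x.2.1)⟩)
    (fun x => ⟨(x.2.1, x.2.2 + x.1.2), (x.2.2, x.1.2)⟩) ?_ ?_ ?_ ?_ ?_
  · rintro ⟨⟨a, b⟩, ⟨c, d⟩⟩ h
    simp at h ⊢
    omega
  · rintro ⟨⟨a, b⟩, ⟨c, d⟩⟩ h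
    simp at h ⊢
    omega
  · rintro ⟨⟨a, b⟩, ⟨c, d⟩⟩ h
    simp at h
    obtain ⟨h1, rfl⟩ := h
    rfl
  · rintro ⟨⟨a, b⟩, ⟨c, d⟩⟩ h
    simp at h
    obtain ⟨h1, rfl⟩ := h
    rfl
  · rintro ⟨⟨a, b⟩, ⟨c, d⟩⟩ h
    rfl

variable {𝔤 : Type*} [LieRing 𝔤] [LieAlgebra ℝ 𝔤]
  {V : Type*} [AddCommGroup V] [Module ℝ V] [LieRingModule 𝔤 V] [LieModule ℝ 𝔤 V]

variable (𝔤 V) in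
/-- The action of a Lie algebra on a module, as a bilinear map. -/
def lieAct : 𝔤 →ₗ[ℝ] V →ₗ[ℝ] V :=
  LinearMap.mk₂ ℝ (fun X v => ⁅X, v⁆) add_lie smul_lie lie_add (fun c X v => lie_smul c X v)

@[simp] theorem lieAct_apply (X : 𝔤) (v : V) : lieAct 𝔤 V X v = ⁅X, v⁆ := rfl

/-- The coefficients `Tₙ` of the formal operator series `T = 1 + T₁ + T₂ + ⋯` which satisfies
`n Tₙ = ∑_{k ≥ 1} W_k T_{n - k}`, i.e. `ε dT/dε = W T` for `W = ∑ εᵏ W_k`. -/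
def transCoeff (W : ℕ → 𝔤) : ℕ → V →ₗ[ℝ] V
  | 0 => LinearMap.id
  | n + 1 => ((n : ℝ) + 1)⁻¹ • ∑ k : Fin (n + 1), lieAct 𝔤 V (W (k + 1)) ∘ₗ transCoeff W (n - k)
decreasing_by omega

@[simp] theorem transCoeff_zero (W : ℕ → 𝔤) (v : V) : transCoeff W 0 v = v := by
  rw [transCoeff]; rfl

theorem transCoeff_succ (W : ℕ → 𝔤) (n : ℕ) (v : V) : transCoeff W (n + 1) v
    = ((n : ℝ) + 1)⁻¹ • ∑ p ∈ antidiagonal n, ⁅W (p.1 + 1), transCoeff W p.2 v⁆ := by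
  rw [transCoeff, Nat.sum_antidiagonal_eq_sum_range_succ_mk, Finset.sum_range]
  simp

/-- The differential equation `ε dT/dε = W T` for the series `T = ∑ εⁿ Tₙ`, degree by degree. -/
theorem smul_transCoeff {W : ℕ → 𝔤} (hW : W 0 = 0) (n : ℕ) (v : V) :
    (n : ℝ) • transCoeff W n v = ∑ p ∈ antidiagonal n, ⁅W p.1, transCoeff W p.2 v⁆ := by
  cases n with
  | zero => simp [hW]
  | succ n =>
    rw [Nat.sum_antidiagonal_succ, transCoeff_succ, smul_smul, hW, zero_lie, zero_add]
    have : ((n : ℝ) + 1) ≠ 0 := by positivity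
    simp [this]

/-- Uniqueness for the recursion which defines `transCoeff`. -/
theorem seq_ext_of_smul_eq {W : ℕ → 𝔤} (hW : W 0 = 0) {z z' : ℕ → V} (h0 : z 0 = z' 0)
    (hz : ∀ n : ℕ, (n : ℝ) • z n = ∑ p ∈ antidiagonal n, ⁅W p.1, z p.2⁆)
    (hz' : ∀ n : ℕ, (n : ℝ) • z' n = ∑ p ∈ antidiagonal n, ⁅W p.1, z' p.2⁆) : z = z' := by
  ext n
  induction n using Nat.strong_induction_on with
  | _ n ih =>
    cases n with
    | zero => exact h0
    | succ n =>
      have h : ((n + 1 : ℕ) : ℝ) • z (n + 1) = ((n + 1 : ℕ) : ℝ) • z' (n + 1) := by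
        rw [hz, hz', Nat.sum_antidiagonal_succ, Nat.sum_antidiagonal_succ, hW, zero_lie, zero_lie]
        congr 1
        refine sum_congr rfl fun p hp => ?_
        rw [ih p.2 (by have := mem_antidiagonal.1 hp; omega)]
      exact smul_right_injective V (by positivity : ((n + 1 : ℕ) : ℝ) ≠ 0) h

/-- The action of the formal operator series `T` on formal series. -/
def trans (W : ℕ → 𝔤) (u : ℕ → V) (n : ℕ) : V :=
  ∑ p ∈ antidiagonal n, transCoeff W p.1 (u p.2)

theorem trans_eq (W : ℕ → 𝔤) (u : ℕ → V) (n : ℕ) :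
    trans W u n = u n + ∑ k ∈ range n, transCoeff W (n - k) (u k) := by
  have : trans W u n = ∑ p ∈ antidiagonal n, transCoeff W p.2 (u p.1) := by
    rw [trans, ← Nat.sum_antidiagonal_swap]; rfl
  rw [this, Nat.sum_antidiagonal_eq_sum_range_succ_mk, sum_range_succ, add_comm]
  simp

theorem trans_constSeq (W : ℕ → 𝔤) (x : V) (n : ℕ) :
    trans W (constSeq x) n = transCoeff W n x := by
  rw [trans, sum_eq_single (n, 0)]
  · simp [constSeq]
  · rintro ⟨i, j⟩ h1 h2
    have : j ≠ 0 := by rintro rfl; simp_all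
    simp [constSeq, this]
  · simp

/-- The coefficients of the inverse of `T` applied to a formal series. -/
def transInv (W : ℕ → 𝔤) (v : ℕ → V) : ℕ → V
  | n => v n - ∑ k : Fin n, transCoeff W (n - k) (transInv W v k)

theorem trans_transInv (W : ℕ → 𝔤) (v : ℕ → V) : trans W (transInv W v) = v := by
  ext n
  rw [trans_eq, transInv, Finset.sum_range]
  simp

theorem transInv_eq (W : ℕ → 𝔤) (v : ℕ → V) (n : ℕ) :
    transInv W v n = v n - ∑ k ∈ range n, transCoeff W (n - k) (transInv W v k) := by
  rw [transInv, Finset.sum_range]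

/-- A formal transformation preserves the order and the leading coefficient of a series. -/
theorem trans_leading {W : ℕ → 𝔤} {u : ℕ → V} {n : ℕ} (h : ∀ k < n, trans W u k = 0) :
    (∀ k < n, u k = 0) ∧ trans W u n = u n := by
  have h1 : ∀ k < n, u k = 0 := by
    intro k
    induction k using Nat.strong_induction_on with
    | _ k ih =>
      intro hk
      have := h k hk
      rw [trans_eq, sum_eq_zero] at this
      · simpa using this
      · intro j hj
        have hj' := Finset.mem_range.1 hj
        rw [ih j hj' (by omega), map_zero]
  refine ⟨h1, ?_⟩
  rw [trans_eq, sum_eq_zero, add_zero]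
  intro j hj
  rw [h1 j (Finset.mem_range.1 hj), map_zero]

/-- Formal transformations preserve the submodules that are stable under Lie derivatives. -/
theorem transCoeff_mem (W : ℕ → 𝔤) (S : LieSubmodule ℝ 𝔤 V) {v : V} (hv : v ∈ S) (n : ℕ) :
    transCoeff W n v ∈ S := by
  induction n using Nat.strong_induction_on with
  | _ n ih =>
    cases n with
    | zero => simpa using hv
    | succ n =>
      rw [transCoeff_succ]
      refine S.smul_mem _ (sum_mem fun p hp => S.lie_mem (ih _ ?_))
      have := mem_antidiagonal.1 hp
      omega

theorem transInv_mem (W : ℕ → 𝔤) (S : LieSubmodule ℝ 𝔤 V) {v : ℕ → V} (hv : ∀ n, v n ∈ S) (n : ℕ) :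
    transInv W v n ∈ S := by
  induction n using Nat.strong_induction_on with
  | _ n ih =>
    rw [transInv_eq]
    refine sub_mem (hv n) (sum_mem fun k hk => transCoeff_mem W S (ih k (Finset.mem_range.1 hk)) _)

/-- An invariant vector is fixed by the operator series `T`. -/
theorem transCoeff_eq_zero (W : ℕ → 𝔤) {v : V} (hv : ∀ X : 𝔤, ⁅X, v⁆ = 0) {n : ℕ} (hn : n ≠ 0) :
    transCoeff W n v = 0 := by
  obtain ⟨n, rfl⟩ := Nat.exists_eq_succ_of_ne_zero hn
  induction n using Nat.strong_induction_on with
  | _ n ih =>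
    rw [transCoeff_succ, sum_eq_zero, smul_zero]
    rintro ⟨i, j⟩ hp
    rcases j with _ | j
    · simp [hv]
    · have := mem_antidiagonal.1 hp
      rw [ih j (by simp at this; omega) (by simp), lie_zero]

/-- If `T q` has invariant coefficients, then it equals `q`. -/
theorem eq_of_trans_invariant (W : ℕ → 𝔤) {q : ℕ → V} (h : ∀ n (X : 𝔤), ⁅X, trans W q n⁆ = 0)
    (n : ℕ) : trans W q n = q n := by
  induction n using Nat.strong_induction_on with
  | _ n ih =>
    rw [trans_eq, sum_eq_zero, add_zero]
    intro k hk
    have hk := Finset.mem_range.1 hk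
    exact transCoeff_eq_zero W (fun X => by rw [← ih k hk]; exact h k X) (by omega)

variable {V₁ V₂ : Type*} [AddCommGroup V₁] [Module ℝ V₁] [LieRingModule 𝔤 V₁] [LieModule ℝ 𝔤 V₁]
  [AddCommGroup V₂] [Module ℝ V₂] [LieRingModule 𝔤 V₂] [LieModule ℝ 𝔤 V₂]

/-- Formal transformations are compatible with every invariant bilinear pairing, by the Leibniz rule for
the differential equation that they satisfy. -/
theorem transCoeff_bilin {W : ℕ → 𝔤} (hW : W 0 = 0) (b : V₁ →ₗ[ℝ] V₂ →ₗ[ℝ] V)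
    (hb : ∀ (X : 𝔤) u v, ⁅X, b u v⁆ = b ⁅X, u⁆ v + b u ⁅X, v⁆) (u : V₁) (v : V₂) (n : ℕ) :
    transCoeff W n (b u v)
      = ∑ p ∈ antidiagonal n, b (transCoeff W p.1 u) (transCoeff W p.2 v) := by
  refine congrFun (seq_ext_of_smul_eq hW (z := fun n => transCoeff W n (b u v))
    (z' := fun n => ∑ p ∈ antidiagonal n, b (transCoeff W p.1 u) (transCoeff W p.2 v))
    (by simp) (fun n => smul_transCoeff hW n _) fun n => ?_) n
  have h1 : (n : ℝ) • ∑ p ∈ antidiagonal n, b (transCoeff W p.1 u) (transCoeff W p.2 v)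
      = ∑ p ∈ antidiagonal n, (b ((p.1 : ℝ) • transCoeff W p.1 u) (transCoeff W p.2 v)
        + b (transCoeff W p.1 u) ((p.2 : ℝ) • transCoeff W p.2 v)) := by
    rw [smul_sum]
    refine sum_congr rfl fun p hp => ?_
    rw [← mem_antidiagonal.1 hp, Nat.cast_add, add_smul]
    simp
  rw [h1]
  simp only [smul_transCoeff hW, map_sum, LinearMap.sum_apply, sum_add_distrib, lie_sum, hb]
  congr 1
  · exact (sum_antidiagonal_assoc (fun i j k => b ⁅W i, transCoeff W j u⁆ (transCoeff W k v)) n).symm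
  · rw [sum_antidiagonal_assoc (fun i j k => b (transCoeff W i u) ⁅W j, transCoeff W k v⁆),
      sum_antidiagonal_assoc (fun i j k => b (transCoeff W j u) ⁅W i, transCoeff W k v⁆)]
    refine sum_congr rfl fun p _ => ?_
    rw [← Nat.sum_antidiagonal_swap]
    rfl

/-- The formal operator series `T` is compatible with every invariant bilinear operation. -/
theorem trans_cauchy {W : ℕ → 𝔤} (hW : W 0 = 0) (b : V₁ →ₗ[ℝ] V₂ →ₗ[ℝ] V)
    (hb : ∀ (X : 𝔤) u v, ⁅X, b u v⁆ = b ⁅X, u⁆ v + b u ⁅X, v⁆) (u : ℕ → V₁) (v : ℕ → V₂) :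
    trans W (cauchy b u v) = cauchy b (trans W u) (trans W v) := by
  ext n
  simp only [trans, cauchy, map_sum, LinearMap.sum_apply, transCoeff_bilin hW b hb]
  have h := sum_antidiagonal_exchange
    (fun i j k l => b (transCoeff W i (u k)) (transCoeff W j (v l))) n
  have e : ∀ p : ℕ × ℕ, ∑ x ∈ antidiagonal p.2, ∑ y ∈ antidiagonal p.1,
      b (transCoeff W y.1 (u x.1)) (transCoeff W y.2 (v x.2))
      = ∑ y ∈ antidiagonal p.1, ∑ x ∈ antidiagonal p.2,
      b (transCoeff W y.1 (u x.1)) (transCoeff W y.2 (v x.2)) := fun p => sum_comm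
  simp only [e]
  rw [h]
  exact sum_congr rfl fun p _ => sum_comm

theorem lieAct_lie (X : 𝔤) (Y : 𝔤) (v : V) :
    ⁅X, lieAct 𝔤 V Y v⁆ = lieAct 𝔤 V ⁅X, Y⁆ v + lieAct 𝔤 V Y ⁅X, v⁆ := leibniz_lie X Y v

/-- If `R` is conjugated to the constant series `R₀`, then `L_R T = T L_{R₀}`. -/
theorem cauchy_lie_trans {W : ℕ → 𝔤} (hW : W 0 = 0) {R : ℕ → 𝔤} {R₀ : 𝔤}
    (hR : ∀ n, R n = transCoeff W n R₀) (v : ℕ → V) :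
    cauchy (lieAct 𝔤 V) R (trans W v) = trans W (fun n => ⁅R₀, v n⁆) := by
  have h1 : R = trans W (constSeq R₀) := funext fun n => by rw [trans_constSeq, hR]
  have h2 : (fun n => ⁅R₀, v n⁆) = cauchy (lieAct 𝔤 V) (constSeq R₀) v :=
    funext fun n => by rw [cauchy_constSeq_left]; rfl
  rw [h2, trans_cauchy hW (lieAct 𝔤 V) lieAct_lie, ← h1]

/-- The first nonvanishing coefficient of `L_R u` lies in the image of `L_{R₀}`. -/
theorem exists_lie_eq_of_leading {W : ℕ → 𝔤} (hW : W 0 = 0) {R : ℕ → 𝔤} {R₀ : 𝔤}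
    (hR : ∀ n, R n = transCoeff W n R₀) (u : ℕ → V) (n : ℕ)
    (h : ∀ k < n, cauchy (lieAct 𝔤 V) R u k = 0) :
    ∃ v : V, cauchy (lieAct 𝔤 V) R u n = ⁅R₀, v⁆ := by
  refine ⟨transInv W u n, ?_⟩
  rw [← trans_transInv W u, cauchy_lie_trans hW hR] at h ⊢
  rw [trans_transInv]
  exact (trans_leading h).2

end FormalTransformations

section FormalForms
open Finset HasAntidiagonal

variable {𝔤 : Type*} [LieRing 𝔤] [LieAlgebra ℝ 𝔤]
  {A : Type*} [AddCommGroup A] [Module ℝ A] [LieRingModule 𝔤 A] [LieModule ℝ 𝔤 A]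

variable (𝔤) in
/-- The differential of a function, as a linear map on vector fields. -/
def differential : A →ₗ[ℝ] 𝔤 →ₗ[ℝ] A := (lieAct 𝔤 A).flip

@[simp] theorem differential_apply (f : A) (X : 𝔤) : differential 𝔤 f X = ⁅X, f⁆ := rfl

variable (𝔤 A) in
/-- The closed `1`-forms: those with `L_X β = d(β(X))` for every `X`. -/
def closedForms : LieSubmodule ℝ 𝔤 (𝔤 →ₗ[ℝ] A) where
  carrier := {β | ∀ X : 𝔤, ⁅X, β⁆ = differential 𝔤 (β X)}
  add_mem' h h' X := by simp [h X, h' X]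
  zero_mem' X := by simp
  smul_mem' c β h X := by simp [h X]
  lie_mem {X β} h Y := by
    rw [h X]
    ext Z
    simp only [LieHom.lie_apply, differential_apply]
    rw [leibniz_lie Y Z, add_sub_cancel_left]

/-- The higher coefficients of `T` map closed forms to exact forms. -/
theorem transCoeff_exact (W : ℕ → 𝔤) {β : 𝔤 →ₗ[ℝ] A} (hβ : β ∈ closedForms 𝔤 A) {n : ℕ}
    (hn : n ≠ 0) : transCoeff W n β ∈ LinearMap.range (differential 𝔤 : A →ₗ[ℝ] 𝔤 →ₗ[ℝ] A) := by
  obtain ⟨n, rfl⟩ := Nat.exists_eq_succ_of_ne_zero hn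
  rw [transCoeff_succ]
  refine Submodule.smul_mem _ _ (sum_mem fun p _ => ?_)
  rw [transCoeff_mem W (closedForms 𝔤 A) hβ p.2 (W (p.1 + 1))]
  exact LinearMap.mem_range_self _ _

/-- On closed forms a formal transformation is homotopic to the identity: it changes them by exact
forms only. -/
theorem transInv_sub_exact (W : ℕ → 𝔤) {β : ℕ → 𝔤 →ₗ[ℝ] A} (hβ : ∀ n, β n ∈ closedForms 𝔤 A)
    (n : ℕ) : ∃ f : A, transInv W β n = β n + differential 𝔤 f := by
  have h : ∑ k ∈ range n, transCoeff W (n - k) (transInv W β k)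
      ∈ LinearMap.range (differential 𝔤 : A →ₗ[ℝ] 𝔤 →ₗ[ℝ] A) :=
    sum_mem fun k hk => transCoeff_exact W (transInv_mem W _ hβ k)
      (by have := Finset.mem_range.1 hk; omega)
  obtain ⟨f, hf⟩ := h
  refine ⟨-f, ?_⟩
  rw [transInv_eq, ← hf, map_neg, sub_eq_add_neg]

theorem apply_lie (X : 𝔤) (β : 𝔤 →ₗ[ℝ] A) (Y : 𝔤) :
    ⁅X, (LinearMap.id : (𝔤 →ₗ[ℝ] A) →ₗ[ℝ] 𝔤 →ₗ[ℝ] A) β Y⁆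
      = (LinearMap.id : (𝔤 →ₗ[ℝ] A) →ₗ[ℝ] 𝔤 →ₗ[ℝ] A) ⁅X, β⁆ Y
        + (LinearMap.id : (𝔤 →ₗ[ℝ] A) →ₗ[ℝ] 𝔤 →ₗ[ℝ] A) β ⁅X, Y⁆ := by
  simp

/-- If `R` is conjugated to `R₀` and the series `β(R)` has invariant coefficients, then these are
the values on `R₀` of the conjugated series of forms. -/
theorem cauchy_apply_eq {W : ℕ → 𝔤} (hW : W 0 = 0) {R : ℕ → 𝔤} {R₀ : 𝔤}
    (hR : ∀ n, R n = transCoeff W n R₀) (β : ℕ → 𝔤 →ₗ[ℝ] A)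
    (h : ∀ n (X : 𝔤), ⁅X, cauchy LinearMap.id β R n⁆ = 0) (n : ℕ) :
    cauchy LinearMap.id β R n = transInv W β n R₀ := by
  have h1 : R = trans W (constSeq R₀) := funext fun n => by rw [trans_constSeq, hR]
  have h2 : cauchy LinearMap.id β R = trans W (fun n => transInv W β n R₀) := by
    have h3 : (fun n => transInv W β n R₀) = cauchy LinearMap.id (transInv W β) (constSeq R₀) :=
      funext fun n => by rw [cauchy_constSeq_right]; rfl
    rw [h3, trans_cauchy hW _ apply_lie, trans_transInv, ← h1]
  rw [h2] at h ⊢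
  exact eq_of_trans_invariant W h n

end FormalForms
end NearlyPeriodic

/-! ### Normal form of a roto-rate -/

namespace NearlyPeriodic
open MeasureTheory Set

variable {E : Type*} [NormedAddCommGroup E] [NormedSpace ℝ E] [FiniteDimensional ℝ E]
  {M : Type*} [TopologicalSpace M] [ChartedSpace E M] [IsManifold 𝓘(ℝ, E) ∞ M] [T2Space M]

section Paths
open Finset HasAntidiagonal

/-- `u` is a smooth path of functions, with derivative `u'`. -/
structure HasPathDeriv (u u' : ℝ → SmoothFn E M) : Prop where
  smooth : JointlySmooth E (fun s => u s)
  deriv : ∀ m s, HasDerivAt (fun s => u s m) (u' s m) s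

namespace HasPathDeriv
variable {u u' v v' : ℝ → SmoothFn E M}

theorem sub (hu : HasPathDeriv u u') (hv : HasPathDeriv v v') :
    HasPathDeriv (fun s => u s - v s) (fun s => u' s - v' s) :=
  ⟨hu.smooth.sub hv.smooth, fun m s => (hu.deriv m s).sub (hv.deriv m s)⟩

theorem smul (c : ℝ) (hu : HasPathDeriv u u') :
    HasPathDeriv (fun s => c • u s) (fun s => c • u' s) :=
  ⟨(JointlySmooth.of_param contDiff_const).mul hu.smooth, fun m s => (hu.deriv m s).const_mul c⟩

theorem sum {ι : Type*} {t : Finset ι} {u u' : ι → ℝ → SmoothFn E M}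
    (h : ∀ i ∈ t, HasPathDeriv (u i) (u' i)) :
    HasPathDeriv (fun s => ∑ i ∈ t, u i s) (fun s => ∑ i ∈ t, u' i s) where
  smooth := by
    have h1 := JointlySmooth.sum fun i hi => (h i hi).smooth
    exact ContMDiff.congr h1 fun p => SmoothFn.coe_sum _ _ _
  deriv m s := by
    simp only [SmoothFn.coe_sum]
    exact HasDerivAt.fun_sum fun i hi => (h i hi).deriv m s

theorem lie (X : SmoothVF E M) (hu : HasPathDeriv u u') :
    HasPathDeriv (fun s => ⁅X, u s⁆) (fun s => ⁅X, u' s⁆) :=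
  ⟨hu.smooth.lie X, fun m s => hasDerivAt_mvfderiv (h := fun m s => u s m)
    (h' := fun m s => u' s m) hu.smooth hu.deriv m (X m) s⟩

theorem transCoeff (W : ℕ → SmoothVF E M) (hu : HasPathDeriv u u') (n : ℕ) :
    HasPathDeriv (fun s => transCoeff W n (u s)) (fun s => NearlyPeriodic.transCoeff W n (u' s)) := by
  induction n using Nat.strong_induction_on with
  | _ n ih =>
    cases n with
    | zero => simpa only [transCoeff_zero] using hu
    | succ n =>
      simp only [transCoeff_succ]
      refine smul _ (sum fun p hp => lie _ (ih _ ?_))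
      have := mem_antidiagonal.1 hp
      omega

theorem transInv (W : ℕ → SmoothVF E M) {u u' : ℝ → ℕ → SmoothFn E M}
    (hu : ∀ n, HasPathDeriv (fun s => u s n) (fun s => u' s n)) (n : ℕ) :
    HasPathDeriv (fun s => transInv W (u s) n) (fun s => NearlyPeriodic.transInv W (u' s) n) := by
  induction n using Nat.strong_induction_on with
  | _ n ih =>
    have h := (hu n).sub (sum (t := range n) fun k hk =>
      transCoeff W (ih k (Finset.mem_range.1 hk)) (n - k))
    simp only [transInv_eq W _ n]
    exact h

variable [MulAction Circle M] [ContMDiffSMul (𝓡 1) 𝓘(ℝ, E) ∞ Circle M]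

/-- The derivative of a path of functions seen from the rotating frame. -/
theorem rot_neg (hu : HasPathDeriv u u') {R₀ : SmoothVF E M} (hR₀ : ∀ m, R₀ m = generator E m)
    (m : M) (s : ℝ) : HasDerivAt (fun s => u s (rot (-s) m))
      ((u' s - ⁅R₀, u s⁆) (rot (-s) m)) s := by
  have h := hasDerivAt_diag (K := fun a b => u a (rot (-b) m)) (s := s)
    (A := u' s (rot (-s) m)) (B := -⁅R₀, u s⁆ (rot (-s) m)) ?_ (hu.deriv _ _) ?_
  · exact h.congr_deriv (sub_eq_add_neg _ _).symm
  · have h2 : ContMDiff 𝓘(ℝ, ℝ × ℝ) 𝓘(ℝ, ℝ) ∞ (fun p : ℝ × ℝ => u p.1 (rot (-p.2) m)) := by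
      refine ContMDiff.comp (g := fun p : M × ℝ => u p.2 p.1)
        (f := fun p : ℝ × ℝ => (rot (-p.2) m, p.1)) hu.smooth ?_
      refine ContMDiff.prodMk ?_ contDiff_fst.contMDiff
      exact ContMDiff.comp (g := fun p : M × ℝ => rot p.2 p.1) (f := fun p : ℝ × ℝ => (m, -p.2))
        (contMDiff_rot E) (contMDiff_const.prodMk contDiff_snd.neg.contMDiff)
    exact h2.contDiff.differentiable (by simp) _
  · have := (hasDerivAt_rot hR₀ (u s) m (-s)).comp s (hasDerivAt_neg s)
    exact this.congr_deriv (by simp)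

end HasPathDeriv
end Paths

section NormalForm
open Finset HasAntidiagonal

theorem trans_sub {𝔤 V : Type*} [LieRing 𝔤] [LieAlgebra ℝ 𝔤] [AddCommGroup V] [Module ℝ V]
    [LieRingModule 𝔤 V] [LieModule ℝ 𝔤 V] (W : ℕ → 𝔤) (u v : ℕ → V) (n : ℕ) :
    trans W (fun k => u k - v k) n = trans W u n - trans W v n := by
  simp [trans]

variable [MulAction Circle M] [ContMDiffSMul (𝓡 1) 𝓘(ℝ, E) ∞ Circle M]

/-- The part of the equation `n Rₙ = ∑_{k ≥ 1} [W_k, R_{n - k}]` that does not involve `W_n`, with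
`n` shifted by one. -/
def normalRest (R W : ℕ → SmoothVF E M) (n : ℕ) : SmoothVF E M :=
  ((n : ℝ) + 1) • R (n + 1) - ∑ k ∈ range n, ⁅W (k + 1), R (n - k)⁆

/-- The generators of the formal transformation to normal form: `W_n` solves
`n Rₙ = ∑_{k ≥ 1} [W_k, R_{n - k}]` up to a rotation-invariant error. -/
def normalGen (R : ℕ → SmoothVF E M) : ℕ → SmoothVF E M
  | 0 => 0
  | n + 1 => -homVF (((n : ℝ) + 1) • R (n + 1) - ∑ k : Fin n, ⁅normalGen R (k + 1), R (n - k)⁆)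

theorem normalGen_succ (R : ℕ → SmoothVF E M) (n : ℕ) :
    normalGen R (n + 1) = -homVF (normalRest R (normalGen R) n) := by
  rw [normalGen, normalRest, Finset.sum_range]

/-- The conditions on a formal vector field `R` (for fixed `γ`) which say that `exp(2π L_R) = 1`. -/
def FormallyPeriodic (R : ℕ → SmoothVF E M) : Prop :=
  ∀ f : SmoothFn E M, ∃ u : ℝ → ℕ → SmoothFn E M,
    (∀ n, HasPathDeriv (fun s => u s n) (fun s => cauchy (lieAct _ _) R (u s) n)) ∧
    u 0 = constSeq f ∧ u (2 * Real.pi) = constSeq f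

/-- If `R` agrees with a conjugate of `R₀` below degree `N`, up to a rotation-invariant field `X` in
degree `N`, then the periodicity of the flow of `R` forces `X = 0`: it moves `f` by `2π X f` in
degree `N`. -/
theorem lie_eq_zero_of_formallyPeriodic {R W : ℕ → SmoothVF E M} (hW : W 0 = 0)
    (hR₀ : ∀ m, R 0 m = generator E m) (hper : FormallyPeriodic R) {N : ℕ} (hN : N ≠ 0)
    (h : ∀ k < N, R k = transCoeff W k (R 0)) {X : SmoothVF E M}
    (hX : R N = transCoeff W N (R 0) + X)
    (hinv : ∀ (f : SmoothFn E M) s, rotFn s ⁅X, f⁆ = ⁅X, rotFn s f⁆) (f : SmoothFn E M) :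
    ⁅X, f⁆ = 0 := by
  obtain ⟨u, hu, hu0, hu1⟩ := hper f
  set R' : ℕ → SmoothVF E M := fun k => transCoeff W k (R 0) with hR'
  -- In normal form coordinates the flow is that of `R₀` up to degree `N`.
  have hw := HasPathDeriv.transInv W hu
  set w : ℝ → ℕ → SmoothFn E M := fun s => transInv W (u s) with hw_def
  have hcau : ∀ s n, cauchy (lieAct _ _) R' (u s) n = trans W (fun n => ⁅R 0, w s n⁆) n := by
    intro s n
    rw [← cauchy_lie_trans hW (fun _ => rfl) (w s), hw_def, trans_transInv]
  have hdiff : ∀ s n, n ≤ N → cauchy (lieAct _ (SmoothFn E M)) R (u s) n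
      = cauchy (lieAct _ _) R' (u s) n + if n = N then ⁅X, u s 0⁆ else 0 := by
    intro s n hn
    rcases hn.lt_or_eq with hn | rfl
    · rw [if_neg hn.ne, add_zero]
      refine Finset.sum_congr rfl fun p hp => ?_
      rw [h p.1 (by have := mem_antidiagonal.1 hp; omega)]
    · obtain ⟨N, rfl⟩ := Nat.exists_eq_succ_of_ne_zero hN
      rw [if_pos rfl, cauchy, cauchy, Nat.sum_antidiagonal_succ', Nat.sum_antidiagonal_succ', hX]
      have : ∀ p ∈ antidiagonal N, lieAct _ (SmoothFn E M) (R p.1) (u s (p.2 + 1))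
          = lieAct _ _ (R' p.1) (u s (p.2 + 1)) := fun p hp => by
        rw [h p.1 (by have := mem_antidiagonal.1 hp; omega)]
      rw [Finset.sum_congr rfl this, map_add, LinearMap.add_apply]
      have e : lieAct _ (SmoothFn E M) X (u s (N + 1, 0).2) = ⁅X, u s 0⁆ := rfl
      rw [e, hR']
      abel
  have hlead : ∀ s, (∀ k < N, transInv W (cauchy (lieAct _ _) R (u s)) k - ⁅R 0, w s k⁆ = 0) ∧
      transInv W (cauchy (lieAct _ _) R (u s)) N - ⁅R 0, w s N⁆ = ⁅X, u s 0⁆ := by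
    intro s
    have h1 : ∀ n ≤ N, trans W (fun k => transInv W (cauchy (lieAct _ _) R (u s)) k - ⁅R 0, w s k⁆) n
        = if n = N then ⁅X, u s 0⁆ else 0 := by
      intro n hn
      rw [trans_sub, trans_transInv, hdiff s n hn, hcau]
      abel
    have h2 := trans_leading (W := W) (n := N)
      (u := fun k => transInv W (cauchy (lieAct _ _) R (u s)) k - ⁅R 0, w s k⁆)
      (fun k hk => by rw [h1 k hk.le, if_neg hk.ne])
    refine ⟨h2.1, ?_⟩
    rw [← h2.2, h1 N le_rfl, if_pos rfl]
  have hw0 : ∀ s, u s 0 = w s 0 := fun s => by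
    rw [hw_def]
    simp only []
    rw [transInv_eq]
    simp
  -- The coefficient of degree `0` is transported by the rotations.
  have hrot : ∀ s, u s 0 = rotFn s f := by
    intro s
    ext m
    have hd := fun s => (hw 0).rot_neg hR₀ (rot s m)
    have hc := is_const_of_deriv_eq_zero (f := fun r => w r 0 (rot (-r) (rot s m)))
      (fun r => (hd s r).differentiableAt)
      (fun r => by rw [(hd s r).deriv, (hlead r).1 0 (Nat.pos_of_ne_zero hN)]; rfl) s 0
    simp only [rot_neg_rot, neg_zero, rot_zero] at hc
    rw [hw0, hc, ← hw0, hu0]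
    rfl
  ext m
  -- In the rotating frame the coefficient of degree `N` grows linearly, with slope `X f`.
  have hd : ∀ r, HasDerivAt (fun r => w r N (rot (-r) m) - r * ⁅X, f⁆ m) 0 r := by
    intro r
    have h3 := ((hw N).rot_neg hR₀ m r).sub ((hasDerivAt_id r).mul_const (⁅X, f⁆ m))
    refine h3.congr_deriv ?_
    rw [(hlead r).2, hrot, ← hinv]
    simp
  have hc := is_const_of_deriv_eq_zero (f := fun r => w r N (rot (-r) m) - r * ⁅X, f⁆ m)
    (fun r => (hd r).differentiableAt) (fun r => (hd r).deriv) (2 * Real.pi) 0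
  have hp : rot (-(2 * Real.pi)) m = m := by
    conv_lhs => rw [← rot_two_pi m]
    simp
  have hww : w (2 * Real.pi) N = w 0 N := by rw [hw_def]; simp only [hu0, hu1]
  simp only [hp, hww, neg_zero, rot_zero] at hc
  have := Real.pi_pos
  have h4 : 2 * Real.pi * ⁅X, f⁆ m = 0 := by linarith
  simpa [this.ne'] using h4

/-- A formal vector field with `exp(2π L_R) = 1` is conjugated to its zeroth coefficient. -/
theorem eq_transCoeff_normalGen {R : ℕ → SmoothVF E M}
    (hR₀ : ∀ m, R 0 m = generator E m) (hper : FormallyPeriodic R) (n : ℕ) :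
    R n = transCoeff (normalGen R) n (R 0) := by
  have hW : normalGen R 0 = 0 := by rw [normalGen]
  induction n using Nat.strong_induction_on with
  | _ n ih =>
    cases n with
    | zero => simp
    | succ n =>
      have hpos : ((n : ℝ) + 1) ≠ 0 := by positivity
      have h1 : ((n : ℝ) + 1) • transCoeff (normalGen R) (n + 1) (R 0)
          = ((n : ℝ) + 1) • R (n + 1) - avgVF (normalRest R (normalGen R) n) := by
        rw [transCoeff_succ, smul_smul, mul_inv_cancel₀ hpos, one_smul,
          Nat.sum_antidiagonal_eq_sum_range_succ_mk, sum_range_succ]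
        have h2 : ∀ k ∈ range n, ⁅normalGen R (k + 1), transCoeff (normalGen R) (n - k) (R 0)⁆
            = ⁅normalGen R (k + 1), R (n - k)⁆ := fun k hk => by
          rw [← ih (n - k) (by omega)]
        rw [Finset.sum_congr rfl h2, Nat.sub_self, transCoeff_zero]
        simp only []
        rw [normalGen_succ, neg_lie, lie_skew, lie_homVF hR₀, normalRest]
        abel
      -- The obstruction to the normal form in degree `n + 1` is an averaged field.
      set X : SmoothVF E M := ((n : ℝ) + 1)⁻¹ • avgVF (normalRest R (normalGen R) n) with hX
      have h3 : R (n + 1) = transCoeff (normalGen R) (n + 1) (R 0) + X := by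
        apply smul_right_injective _ hpos
        simp only [smul_add]
        rw [h1, hX, smul_smul, mul_inv_cancel₀ hpos, one_smul, sub_add_cancel]
      have h4 : ∀ f : SmoothFn E M, ⁅X, f⁆ = 0 :=
        lie_eq_zero_of_formallyPeriodic hW hR₀ hper (Nat.succ_ne_zero n) ih h3 fun f s => by
          rw [hX, smul_lie, smul_lie, ← rotFn_lie_avgVF]
          rfl
      have h5 : X = 0 := SmoothVF.ext_lieD fun f => by
        rw [← lie_eq_lieD, h4, ← lie_eq_lieD, zero_lie]
      rw [h5, add_zero] at h3
      exact h3

end NormalForm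
end NearlyPeriodic

/-! ### Taylor expansion of families of functions -/

namespace NearlyPeriodic
open MeasureTheory Set

section Hadamard
open Finset

variable {E' : Type*} [NormedAddCommGroup E'] [NormedSpace ℝ E']
  {H : Type*} [TopologicalSpace H] {I : ModelWithCorners ℝ E' H}
  {N : Type*} [TopologicalSpace N] [ChartedSpace H N] [IsManifold I ∞ N]

variable (I) in
/-- `h` is smooth as a function on `N × ℝ`. -/
def SmoothLine (h : N → ℝ → ℝ) : Prop :=
  ContMDiff (I.prod 𝓘(ℝ, ℝ)) 𝓘(ℝ, ℝ) ∞ (fun p : N × ℝ => h p.1 p.2)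

theorem SmoothLine.contDiff {h : N → ℝ → ℝ} (hh : SmoothLine I h) (n : N) :
    ContDiff ℝ ∞ (h n) := by
  rw [← contMDiff_iff_contDiff]
  exact ContMDiff.comp (g := fun p : N × ℝ => h p.1 p.2) (f := fun t => (n, t)) hh
    (contMDiff_const.prodMk contMDiff_id)

theorem SmoothLine.deriv {h : N → ℝ → ℝ} (hh : SmoothLine I h) :
    SmoothLine I (fun n => deriv (h n)) := by
  intro p
  have := ContMDiffAt.mfderiv (x₀ := p) (m := ∞) (n := ∞) (I := 𝓘(ℝ, ℝ)) (I' := 𝓘(ℝ, ℝ))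
    (J := I.prod 𝓘(ℝ, ℝ)) (fun p : N × ℝ => h p.1) (fun p => p.2)
    (ContMDiff.contMDiffAt (ContMDiff.comp (g := fun p : N × ℝ => h p.1 p.2)
      (f := fun q : (N × ℝ) × ℝ => (q.1.1, q.2)) hh
      ((contMDiff_fst.comp contMDiff_fst).prodMk contMDiff_snd))) contMDiffAt_snd (by simp)
  have h2 := this.clm_apply (contMDiffAt_const (c := (1 : ℝ)))
  refine h2.congr_of_eventuallyEq (Filter.Eventually.of_forall fun q => ?_)
  simp [inTangentCoordinates, ContinuousLinearMap.inCoordinates, mfderiv_eq_fderiv]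
  rfl

variable [I.Boundaryless]

/-- Hadamard's lemma in the direction of a parameter. -/
theorem SmoothLine.exists_hadamard {h : N → ℝ → ℝ} (hh : SmoothLine I h) :
    ∃ k : N → ℝ → ℝ, SmoothLine I k ∧ ∀ n t, h n t = h n 0 + t * k n t := by
  refine ⟨fun n t => ∫ u in (0 : ℝ)..1, _root_.deriv (h n) (u * t), ?_, fun n t => ?_⟩
  · refine contMDiff_intervalIntegral (I := I.prod 𝓘(ℝ, ℝ))
      (h := fun (p : N × ℝ) (u : ℝ) => _root_.deriv (h p.1) (u * p.2)) ?_ 0 1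
    refine ContMDiff.comp (g := fun p : N × ℝ => _root_.deriv (h p.1) p.2)
      (f := fun q : (N × ℝ) × ℝ => (q.1.1, q.2 * q.1.2)) hh.deriv ?_
    exact (contMDiff_fst.comp contMDiff_fst).prodMk
      (contMDiff_snd.mul (contMDiff_snd.comp contMDiff_fst))
  · rw [intervalIntegral.mul_integral_comp_mul_right, zero_mul, one_mul,
      intervalIntegral.integral_deriv_eq_sub
        (fun x _ => (hh.contDiff n).differentiable (by simp) x)
        ((hh.deriv.contDiff n).continuous.intervalIntegrable _ _)]
    ring

/-- Taylor's formula in the direction of a parameter. -/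
theorem SmoothLine.exists_taylor {h : N → ℝ → ℝ} (hh : SmoothLine I h) :
    ∃ (c : ℕ → N → ℝ) (k : ℕ → N → ℝ → ℝ), (∀ j, ContMDiff I 𝓘(ℝ, ℝ) ∞ (c j)) ∧
      (∀ j, SmoothLine I (k j)) ∧
      ∀ j n t, h n t = ∑ i ∈ range j, t ^ i * c i n + t ^ j * k j n t := by
  have hH : ∀ f : {f : N → ℝ → ℝ // SmoothLine I f}, ∃ k : {f : N → ℝ → ℝ // SmoothLine I f},
      ∀ n t, f.1 n t = f.1 n 0 + t * k.1 n t := fun f => by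
    obtain ⟨k, hk, h⟩ := f.2.exists_hadamard
    exact ⟨⟨k, hk⟩, h⟩
  -- The coefficients are the values at `t = 0` of the iterated Hadamard quotients.
  choose q hq using hH
  let k : ℕ → {f : N → ℝ → ℝ // SmoothLine I f} := fun j => q^[j] ⟨h, hh⟩
  refine ⟨fun j n => (k j).1 n 0, fun j => (k j).1, fun j => ?_, fun j => (k j).2, fun j n t => ?_⟩
  · exact ContMDiff.comp (g := fun p : N × ℝ => (k j).1 p.1 p.2) (f := fun n => (n, (0 : ℝ)))
      (k j).2 (contMDiff_id.prodMk contMDiff_const)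
  · induction j with
    | zero => simp [k]
    | succ j ih =>
      have e : k (j + 1) = q (k j) := Function.iterate_succ_apply' q j _
      beta_reduce at ih ⊢
      rw [ih, sum_range_succ, e, hq (k j) n t]
      ring

end Hadamard

section Uniqueness
open Finset Asymptotics Filter

/-- A polynomial of degree less than `N` which is `O(tᴺ)` vanishes. -/
theorem coeff_eq_zero_of_isBigO {N : ℕ} {c : ℕ → ℝ}
    (h : (fun t : ℝ => ∑ i ∈ range N, t ^ i * c i) =O[𝓝[≠] 0] fun t => t ^ N) :
    ∀ i < N, c i = 0 := by
  induction N generalizing c with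
  | zero => simp
  | succ N ih =>
    have h0 : c 0 = 0 := by
      have h1 : Tendsto (fun t : ℝ => ∑ i ∈ range (N + 1), t ^ i * c i) (𝓝[≠] 0) (𝓝 (c 0)) := by
        have : Continuous (fun t : ℝ => ∑ i ∈ range (N + 1), t ^ i * c i) := by fun_prop
        have h2 := (this.tendsto 0).mono_left (nhdsWithin_le_nhds (s := {0}ᶜ))
        simpa [sum_range_succ'] using h2
      have h3 : Tendsto (fun t : ℝ => t ^ (N + 1)) (𝓝[≠] 0) (𝓝 0) := by
        have : Continuous (fun t : ℝ => t ^ (N + 1)) := by fun_prop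
        have h2 := (this.tendsto 0).mono_left (nhdsWithin_le_nhds (s := {0}ᶜ))
        simpa using h2
      exact tendsto_nhds_unique h1 (h.trans_tendsto h3)
    have h4 : (fun t : ℝ => ∑ i ∈ range N, t ^ i * c (i + 1)) =O[𝓝[≠] 0] fun t => t ^ N := by
      have h5 := (isBigO_refl (fun t : ℝ => t⁻¹) (𝓝[≠] 0)).mul h
      refine h5.congr' ?_ ?_
      · filter_upwards [self_mem_nhdsWithin] with t ht
        have ht : t ≠ 0 := ht
        rw [sum_range_succ', h0, mul_zero, add_zero, mul_sum]
        refine sum_congr rfl fun i _ => ?_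
        field_simp
        ring
      · filter_upwards [self_mem_nhdsWithin] with t ht
        have ht : t ≠ 0 := ht
        field_simp
        ring
    intro i hi
    rcases i with _ | i
    · exact h0
    · exact ih h4 i (by omega)

theorem isBigO_pow_mul {N : ℕ} {k : ℝ → ℝ} (hk : Continuous k) :
    (fun t : ℝ => t ^ N * k t) =O[𝓝 0] fun t => t ^ N := by
  have h1 : k =O[𝓝 0] (fun _ => (1 : ℝ)) := hk.continuousAt.isBigO_one ℝ
  simpa using (isBigO_refl (fun t : ℝ => t ^ N) (𝓝 0)).mul h1

/-- A smooth function vanishes to order `N` at the origin if it does so along every line. -/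
theorem isBigO_of_lines {Γ : Type*} [NormedAddCommGroup Γ] [NormedSpace ℝ Γ]
    [FiniteDimensional ℝ Γ] {φ : Γ → ℝ} (hφ : ContDiff ℝ ∞ φ) {N : ℕ}
    (h : ∀ γ : Γ, (fun t : ℝ => φ (t • γ)) =O[𝓝 0] fun t => t ^ N) :
    φ =O[𝓝 0] fun γ : Γ => ‖γ‖ ^ N := by
  have hs : SmoothLine 𝓘(ℝ, Γ) (fun (γ : Γ) (t : ℝ) => φ (t • γ)) :=
    hφ.contMDiff.comp (contMDiff_snd.smul contMDiff_fst)
  obtain ⟨c, k, -, hk, hT⟩ := hs.exists_taylor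
  have hc : ∀ γ, ∀ i < N, c i γ = 0 := by
    intro γ
    refine coeff_eq_zero_of_isBigO ?_
    have h1 := (h γ).sub (isBigO_pow_mul (N := N) ((hk N).contDiff γ).continuous)
    refine (h1.congr_left fun t => ?_).mono nhdsWithin_le_nhds
    rw [hT N γ t]; ring
  have hφk : ∀ γ t, φ (t • γ) = t ^ N * k N γ t := fun γ t => by
    rw [hT N γ t, sum_eq_zero fun i hi => by rw [hc γ i (Finset.mem_range.1 hi), mul_zero], zero_add]
  have hcont : Continuous (fun p : Γ × ℝ => k N p.1 p.2) := (hk N).continuous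
  obtain ⟨C, hC⟩ := ((isCompact_closedBall (0 : Γ) 1).prod (isCompact_Icc (a := (0 : ℝ))
    (b := 1))).exists_bound_of_continuousOn hcont.continuousOn
  refine IsBigO.of_bound C ?_
  filter_upwards [Metric.closedBall_mem_nhds (0 : Γ) one_pos] with γ hγ
  have e : ‖γ‖ • (‖γ‖⁻¹ • γ) = γ := by
    rcases eq_or_ne γ 0 with rfl | h0
    · simp
    · rw [smul_smul, mul_inv_cancel₀ (norm_ne_zero_iff.2 h0), one_smul]
  have h1 := hφk (‖γ‖⁻¹ • γ) ‖γ‖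
  rw [e] at h1
  rw [h1, norm_mul, mul_comm]
  gcongr
  refine hC (‖γ‖⁻¹ • γ, ‖γ‖) ⟨?_, norm_nonneg _, by simpa using hγ⟩
  rw [mem_closedBall_zero_iff, norm_smul, norm_inv, norm_norm]
  exact inv_mul_le_one

end Uniqueness

section TaylorSeries
open Finset Asymptotics Filter

variable {E : Type*} [NormedAddCommGroup E] [NormedSpace ℝ E]
  {M : Type*} [TopologicalSpace M] [ChartedSpace E M]

/-- The family `f_t` of functions has the Taylor series `∑ tⁿ cₙ` at `t = 0`, with remainders that
are smooth in all variables. -/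
def HasTaylor (f : ℝ → M → ℝ) (c : ℕ → SmoothFn E M) : Prop :=
  ∀ N : ℕ, ∃ r : ℝ → M → ℝ, JointlySmooth E r ∧
    ∀ t m, f t m = ∑ i ∈ range N, t ^ i * c i m + t ^ N * r t m

namespace HasTaylor
variable {f g : ℝ → M → ℝ} {c d : ℕ → SmoothFn E M}

theorem smooth (h : HasTaylor f c) : JointlySmooth E f := by
  obtain ⟨r, hr, h⟩ := h 0
  simpa [JointlySmooth, h] using hr

theorem isBigO (h : HasTaylor f c) (N : ℕ) (m : M) :
    (fun t => f t m - ∑ i ∈ range N, t ^ i * c i m) =O[𝓝 0] fun t => t ^ N := by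
  obtain ⟨r, hr, h⟩ := h N
  refine (isBigO_pow_mul (N := N) (hr.param m).continuous).congr_left fun t => ?_
  rw [h t m]; ring

theorem coeff_eq_of_isBigO (hf : HasTaylor f c) (hg : HasTaylor g d) {N : ℕ} {m : M}
    (h : (fun t => f t m - g t m) =O[𝓝 0] fun t => t ^ N) : ∀ i < N, c i m = d i m := by
  intro i hi
  have := coeff_eq_zero_of_isBigO (c := fun i => c i m - d i m) (N := N) ?_ i hi
  · exact sub_eq_zero.1 this
  · refine (((h.sub (hf.isBigO N m)).add (hg.isBigO N m)).congr_left fun t => ?_).mono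
      nhdsWithin_le_nhds
    simp only [mul_sub, sum_sub_distrib]
    ring

theorem unique (hf : HasTaylor f c) (hf' : HasTaylor f d) : c = d := by
  ext n m
  refine hf.coeff_eq_of_isBigO hf' (N := n + 1) ?_ n (by omega)
  simpa using isBigO_zero _ _

theorem congr (hf : HasTaylor f c) (h : ∀ t m, g t m = f t m) : HasTaylor g c := by
  have : g = f := by ext t m; exact h t m
  rwa [this]

theorem add (hf : HasTaylor f c) (hg : HasTaylor g d) :
    HasTaylor (fun t m => f t m + g t m) (fun n => c n + d n) := fun N => by
  obtain ⟨r, hr, h⟩ := hf N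
  obtain ⟨s, hs, h'⟩ := hg N
  refine ⟨_, hr.add hs, fun t m => ?_⟩
  beta_reduce
  rw [h, h']
  simp only [ContMDiffMap.coe_add, Pi.add_apply, mul_add, sum_add_distrib]
  ring

theorem const_smul (a : ℝ) (hf : HasTaylor f c) :
    HasTaylor (fun t m => a * f t m) (fun n => a • c n) := fun N => by
  obtain ⟨r, hr, h⟩ := hf N
  refine ⟨_, (JointlySmooth.of_param (contDiff_const (c := a))).mul hr, fun t m => ?_⟩
  beta_reduce
  rw [h, mul_add, mul_sum]
  congr 1
  · refine sum_congr rfl fun i _ => ?_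
    simp only [ContMDiffMap.coe_smul, Pi.smul_apply, smul_eq_mul]
    ring
  · ring

theorem sub (hf : HasTaylor f c) (hg : HasTaylor g d) :
    HasTaylor (fun t m => f t m - g t m) (fun n => c n - d n) := by
  have h := hf.add (hg.const_smul (-1))
  convert! h using 2
  · ext m; ring
  · ext m; simp [sub_eq_add_neg]

theorem zero : HasTaylor (fun _ _ => 0) (fun _ => (0 : SmoothFn E M)) := fun N =>
  ⟨fun _ _ => 0, contMDiff_const, fun t m => by simp⟩

theorem sum {ι : Type*} {s : Finset ι} {f : ι → ℝ → M → ℝ} {c : ι → ℕ → SmoothFn E M}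
    (h : ∀ i ∈ s, HasTaylor (f i) (c i)) :
    HasTaylor (fun t m => ∑ i ∈ s, f i t m) (fun n => ∑ i ∈ s, c i n) := by
  classical
  induction s using Finset.induction_on with
  | empty => simpa using zero
  | insert a s ha ih =>
    simp only [sum_insert ha]
    exact (h a (mem_insert_self _ _)).add (ih fun i hi => h i (mem_insert_of_mem hi))

theorem mul_id (hf : HasTaylor f c) :
    HasTaylor (fun t m => t * f t m) (fun n => if n = 0 then 0 else c (n - 1)) := fun N => by
  rcases N with _ | N
  · refine ⟨fun t m => t * f t m, (JointlySmooth.of_param contDiff_id).mul hf.smooth, by simp⟩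
  · obtain ⟨r, hr, h⟩ := hf N
    refine ⟨r, hr, fun t m => ?_⟩
    beta_reduce
    rw [sum_range_succ', h, mul_add, mul_sum]
    simp only [Nat.add_one_ne_zero, if_false, if_true, Nat.add_sub_cancel]
    change _ = _ + t ^ 0 * 0 + _
    rw [mul_zero, add_zero]
    congr 1
    · refine sum_congr rfl fun i _ => ?_
      ring
    · ring

theorem mul_pow (k : ℕ) (hf : HasTaylor f c) :
    HasTaylor (fun t m => t ^ k * f t m) (fun n => if n < k then 0 else c (n - k)) := by
  induction k with
  | zero => simpa using hf
  | succ k ih =>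
    have h := ih.mul_id
    convert! h using 2 with t n
    · ext m; ring
    · rcases n with _ | n
      · simp
      · simp

/-- Pointwise estimates determine the Taylor coefficients of a family which is known to be smooth. -/
theorem of_isBigO
    (h : ∀ N m, (fun t => f t m - ∑ i ∈ range N, t ^ i * c i m) =O[𝓝 0] fun t => t ^ N)
    (hd : HasTaylor f d) : HasTaylor f c := by
  have : c = d := by
    ext n m
    have := coeff_eq_zero_of_isBigO (c := fun i => c i m - d i m) (N := n + 1) ?_ n (by omega)
    · exact sub_eq_zero.1 this
    · refine (((hd.isBigO (n + 1) m).sub (h (n + 1) m)).congr_left fun t => ?_).mono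
        nhdsWithin_le_nhds
      simp only [mul_sub, sum_sub_distrib]
      ring
  rwa [this]

theorem comp_mul (a : ℝ) (hf : HasTaylor f c) :
    HasTaylor (fun t => f (t * a)) (fun n => a ^ n • c n) := fun N => by
  obtain ⟨r, hr, h⟩ := hf N
  refine ⟨fun t m => a ^ N * r (t * a) m, (JointlySmooth.of_param contDiff_const).mul ?_, fun t m => ?_⟩
  · exact ContMDiff.comp (g := fun p : M × ℝ => r p.2 p.1) (f := fun p : M × ℝ => (p.1, p.2 * a)) hr
      (contMDiff_fst.prodMk (contMDiff_snd.mul contMDiff_const))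
  · beta_reduce
    rw [h]
    congr 1
    · refine sum_congr rfl fun i _ => ?_
      simp only [ContMDiffMap.coe_smul, Pi.smul_apply, smul_eq_mul, _root_.mul_pow]
      ring
    · rw [_root_.mul_pow]; ring

variable [IsManifold 𝓘(ℝ, E) ∞ M]

theorem lie [FiniteDimensional ℝ E] [T2Space M] (X : SmoothVF E M) (hf : HasTaylor f c) :
    HasTaylor (fun t => lieFun X (f t)) (fun n => ⁅X, c n⁆) := fun N => by
  obtain ⟨r, hr, h⟩ := hf N
  refine ⟨_, hr.lie X, fun t m => ?_⟩
  let rt : SmoothFn E M := ⟨r t, hr.slice t⟩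
  have e : f t = ((∑ i ∈ range N, t ^ i • c i + t ^ N • rt : SmoothFn E M) : M → ℝ) := by
    ext m
    rw [h]
    simp only [ContMDiffMap.coe_add, Pi.add_apply, SmoothFn.coe_sum, ContMDiffMap.coe_smul,
      Pi.smul_apply, smul_eq_mul]
    rfl
  beta_reduce
  rw [e, ← lie_fn_apply, lie_add, lie_sum]
  simp only [lie_smul]
  simp only [ContMDiffMap.coe_add, Pi.add_apply, SmoothFn.coe_sum, ContMDiffMap.coe_smul,
      Pi.smul_apply, smul_eq_mul]
  rfl

end HasTaylor

variable [IsManifold 𝓘(ℝ, E) ∞ M]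

/-- A smooth family which depends on a further parameter `p` has Taylor coefficients that depend
smoothly on `p`. -/
theorem exists_hasTaylor_family {P : Type*} [NormedAddCommGroup P] [NormedSpace ℝ P]
    {f : P → ℝ → M → ℝ}
    (hf : ContMDiff ((𝓘(ℝ, E).prod 𝓘(ℝ, P)).prod 𝓘(ℝ, ℝ)) 𝓘(ℝ, ℝ) ∞
      (fun q : (M × P) × ℝ => f q.1.2 q.2 q.1.1)) :
    ∃ c : ℕ → P → SmoothFn E M, (∀ n, JointlySmooth E (fun p => c n p)) ∧
      ∀ p, HasTaylor (f p) (fun n => c n p) := by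
  have hs : SmoothLine (𝓘(ℝ, E).prod 𝓘(ℝ, P)) (fun (x : M × P) t => f x.2 t x.1) := hf
  obtain ⟨c, k, hc, hk, hT⟩ := hs.exists_taylor
  refine ⟨fun n p => ⟨fun m => c n (m, p),
    ContMDiff.comp (g := c n) (f := fun m => (m, p)) (hc n) (contMDiff_id.prodMk contMDiff_const)⟩,
    fun n => hc n, fun p N => ⟨fun t m => k N (m, p) t, ?_, fun t m => hT N (m, p) t⟩⟩
  exact ContMDiff.comp (g := fun q : (M × P) × ℝ => k N q.1 q.2)
    (f := fun q : M × ℝ => ((q.1, p), q.2)) (hk N)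
    ((contMDiff_fst.prodMk contMDiff_const).prodMk contMDiff_snd)

theorem JointlySmooth.exists_hasTaylor {f : ℝ → M → ℝ} (hf : JointlySmooth E f) :
    ∃ c : ℕ → SmoothFn E M, HasTaylor f c := by
  obtain ⟨c, -, h⟩ := exists_hasTaylor_family (P := ℝ) (f := fun _ => f)
    (ContMDiff.comp (g := fun p : M × ℝ => f p.2 p.1)
      (f := fun q : (M × ℝ) × ℝ => (q.1.1, q.2)) hf
      ((contMDiff_fst.comp contMDiff_fst).prodMk contMDiff_snd))
  exact ⟨_, h 0⟩

theorem JointlySmooth.comp_line {Γ : Type*} [NormedAddCommGroup Γ] [NormedSpace ℝ Γ] {f : Γ → M → ℝ}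
    (hf : JointlySmooth E f) (γ : Γ) : JointlySmooth E (fun t : ℝ => f (t • γ)) :=
  ContMDiff.comp (g := fun p : M × Γ => f p.2 p.1) (f := fun p : M × ℝ => (p.1, p.2 • γ)) hf
    (contMDiff_fst.prodMk (contMDiff_snd.smul contMDiff_const))

/-- The homogeneous Taylor coefficients of a smooth family of functions. -/
theorem JointlySmooth.exists_hasTaylor_lines {Γ : Type*} [NormedAddCommGroup Γ] [NormedSpace ℝ Γ]
    {f : Γ → M → ℝ} (hf : JointlySmooth E f) :
    ∃ c : ℕ → Γ → SmoothFn E M, (∀ n, JointlySmooth E (fun p => c n p)) ∧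
      (∀ n (s : ℝ) γ, c n (s • γ) = s ^ n • c n γ) ∧
      ∀ γ, HasTaylor (fun t : ℝ => f (t • γ)) (fun n => c n γ) := by
  obtain ⟨c, hc, h⟩ := exists_hasTaylor_family (P := Γ) (f := fun γ t => f (t • γ))
    (ContMDiff.comp (g := fun p : M × Γ => f p.2 p.1)
      (f := fun q : (M × Γ) × ℝ => (q.1.1, q.2 • q.1.2)) hf
      ((contMDiff_fst.comp contMDiff_fst).prodMk
        (contMDiff_snd.smul (contMDiff_snd.comp contMDiff_fst))))
  refine ⟨c, hc, fun n s γ => ?_, h⟩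
  have h1 := h (s • γ)
  have h2 := (h γ).comp_mul s
  simp only [mul_smul] at h2
  exact congrFun (h1.unique h2) n

end TaylorSeries
end NearlyPeriodic

/-! ### The Borel lemma on manifolds -/

namespace NearlyPeriodic
open MeasureTheory Set

section Borel
open Finset Asymptotics Filter

/-- The numerical estimate which makes the cut-off series converge after division by `rᴺ`. -/
theorem borel_tail_bound {c l r : ℝ} {n N : ℕ} (hc : 0 ≤ c) (hl : 1 ≤ l) (hlc : 4 ^ n * c ≤ l)
    (hr : 0 ≤ r) (hrl : l * r ≤ 2) (hn : N < n) : c * r ^ n ≤ r ^ N * (1 / 2) ^ n := by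
  have hl0 : 0 < l := by linarith
  obtain ⟨k, rfl⟩ := Nat.exists_eq_add_of_lt hn
  have h1 : r ≤ 2 / l := by rw [le_div_iff₀ hl0]; linarith
  have h2 : r ^ (k + 1) ≤ 2 ^ (N + k + 1) / l := by
    calc r ^ (k + 1) ≤ (2 / l) ^ (k + 1) := by gcongr
      _ = 2 ^ (k + 1) / l ^ (k + 1) := div_pow _ _ _
      _ ≤ 2 ^ (N + k + 1) / l := by
        gcongr
        · norm_num
        · omega
        · exact le_self_pow₀ hl (by omega)
  have h3 : c * (2 ^ (N + k + 1) / l) ≤ (1 / 2) ^ (N + k + 1) := by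
    rw [mul_div_assoc', div_le_iff₀ hl0, one_div, inv_pow, ← div_eq_inv_mul,
      le_div_iff₀ (by positivity)]
    calc c * 2 ^ (N + k + 1) * 2 ^ (N + k + 1) = 4 ^ (N + k + 1) * c := by
          rw [show (4 : ℝ) = 2 * 2 by norm_num, mul_pow]; ring
      _ ≤ l := hlc
  calc c * r ^ (N + k + 1) = r ^ N * (c * r ^ (k + 1)) := by ring
    _ ≤ r ^ N * (c * (2 ^ (N + k + 1) / l)) := by gcongr
    _ ≤ r ^ N * (1 / 2) ^ (N + k + 1) := by gcongr

variable {V : Type*} [NormedAddCommGroup V] [NormedSpace ℝ V] [FiniteDimensional ℝ V]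
  {Γ : Type*} [NormedAddCommGroup Γ] [NormedSpace ℝ Γ] [FiniteDimensional ℝ Γ]

/-- The dilation `(x, γ) ↦ (x, l γ)`. -/
def dilation (V Γ : Type*) [NormedAddCommGroup V] [NormedSpace ℝ V]
    [NormedAddCommGroup Γ] [NormedSpace ℝ Γ] (l : ℝ) : V × Γ →L[ℝ] V × Γ :=
  (ContinuousLinearMap.id ℝ V).prodMap (l • ContinuousLinearMap.id ℝ Γ)

theorem norm_dilation_le {l : ℝ} (hl : 1 ≤ l) : ‖dilation V Γ l‖ ≤ l := by
  refine ContinuousLinearMap.opNorm_le_bound _ (by linarith) fun p => ?_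
  have e : dilation V Γ l p = (p.1, l • p.2) := rfl
  rw [e, Prod.norm_def, Prod.norm_def, norm_smul, Real.norm_eq_abs, abs_of_pos (by linarith : 0 < l)]
  refine max_le ?_ ?_
  · calc ‖p.1‖ ≤ max ‖p.1‖ ‖p.2‖ := le_max_left _ _
      _ ≤ l * max ‖p.1‖ ‖p.2‖ := le_mul_of_one_le_left (le_max_of_le_left (norm_nonneg _)) hl
  · gcongr
    exact le_max_right _ _

/-- Borel's lemma: every series of homogeneous terms, supported over a fixed compact set, is the
Taylor series of a smooth function. -/
theorem exists_borel_sum {f : ℕ → V × Γ → ℝ} (hf : ∀ n, ContDiff ℝ ∞ (f n)) {K : Set V}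
    (hK : IsCompact K) (hfK : ∀ n x γ, x ∉ K → f n (x, γ) = 0)
    (hom : ∀ n (s : ℝ) x γ, f n (x, s • γ) = s ^ n * f n (x, γ)) :
    ∃ g : V × Γ → ℝ, ContDiff ℝ ∞ g ∧ (∀ x γ, x ∉ K → g (x, γ) = 0) ∧
      ∀ N x γ, (fun t : ℝ => g (x, t • γ) - ∑ i ∈ range N, t ^ i * f i (x, γ))
        =O[𝓝 0] fun t => t ^ N := by
  obtain ⟨χ, hχ1, hχ2⟩ : ∃ χ : ContDiffBump (0 : Γ), χ.rIn = 1 ∧ χ.rOut = 2 :=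
    ⟨⟨1, 2, one_pos, one_lt_two⟩, rfl, rfl⟩
  let φ : ℕ → V × Γ → ℝ := fun n p => χ p.2 * f n p
  have hφ : ∀ n, ContDiff ℝ ∞ (φ n) := fun n => (χ.contDiff.comp contDiff_snd).mul (hf n)
  have hφs : ∀ n, HasCompactSupport (φ n) := fun n => by
    refine HasCompactSupport.intro (hK.prod (isCompact_closedBall (0 : Γ) 2)) fun p hp => ?_
    by_cases h1 : p.1 ∈ K
    · have h2 : p.2 ∉ Metric.closedBall (0 : Γ) 2 := fun h2 => hp ⟨h1, h2⟩
      have : χ p.2 = 0 := χ.zero_of_le_dist (by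
        rw [hχ2]; simpa using (not_le.1 (fun h => h2 (by simpa using h))).le)
      simp [φ, this]
    · simp [φ, show f n p = 0 from hfK n p.1 p.2 h1]
  have hC : ∀ n k, ∃ C, ∀ p, ‖iteratedFDeriv ℝ k (φ n) p‖ ≤ C := fun n k =>
    ((hφs n).iteratedFDeriv k).exists_bound_of_continuous
      ((hφ n).continuous_iteratedFDeriv (by exact_mod_cast le_top))
  choose C hC using hC
  have hC0 : ∀ n k, 0 ≤ C n k := fun n k => (norm_nonneg _).trans (hC n k 0)
  have hc : ∀ n, ∃ c, 0 ≤ c ∧ ∀ x γ, |f n (x, γ)| ≤ c * ‖γ‖ ^ n := fun n => by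
    obtain ⟨c, hc⟩ := (hK.prod (isCompact_closedBall (0 : Γ) 1)).exists_bound_of_continuousOn
      (hf n).continuous.continuousOn
    refine ⟨max c 0, le_max_right _ _, fun x γ => ?_⟩
    by_cases hx : x ∈ K
    · have e : ‖γ‖ • (‖γ‖⁻¹ • γ) = γ := by
        rcases eq_or_ne γ 0 with rfl | h0
        · simp
        · rw [smul_smul, mul_inv_cancel₀ (norm_ne_zero_iff.2 h0), one_smul]
      have h1 := hom n ‖γ‖ x (‖γ‖⁻¹ • γ)
      rw [e] at h1
      rw [h1, abs_mul, abs_pow, abs_norm, mul_comm]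
      gcongr
      refine (hc (x, ‖γ‖⁻¹ • γ) ⟨hx, ?_⟩).trans (le_max_left _ _)
      rw [mem_closedBall_zero_iff, norm_smul, norm_inv, norm_norm]
      exact inv_mul_le_one
    · rw [hfK n x γ hx]
      simp only [abs_zero]
      positivity
  choose c hc0 hc using hc
  -- The cut-off radius `1 / l n` is small enough to control the derivatives of order less than `n`.
  let l : ℕ → ℝ := fun n => 1 + 2 ^ n * ∑ k ∈ range n, C n k + 4 ^ n * c n
  have hsum0 : ∀ n, 0 ≤ ∑ k ∈ range n, C n k := fun n => sum_nonneg fun k _ => hC0 n k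
  have hl1 : ∀ n, 1 ≤ l n := fun n => by
    have := hsum0 n
    have := hc0 n
    simp only [l]
    have h1 : 0 ≤ 2 ^ n * ∑ k ∈ range n, C n k := by positivity
    have h2 : 0 ≤ 4 ^ n * c n := by positivity
    linarith
  have hlc : ∀ n, 4 ^ n * c n ≤ l n := fun n => by
    have := hsum0 n
    simp only [l]
    have h1 : 0 ≤ 2 ^ n * ∑ k ∈ range n, C n k := by positivity
    linarith
  have hlC : ∀ n, ∀ k < n, 2 ^ n * C n k ≤ l n := fun n k hk => by
    have := hc0 n
    have h2 : 0 ≤ 4 ^ n * c n := by positivity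
    have h3 : C n k ≤ ∑ k ∈ range n, C n k :=
      single_le_sum (fun k _ => hC0 n k) (Finset.mem_range.2 hk)
    have h4 : 2 ^ n * C n k ≤ 2 ^ n * ∑ k ∈ range n, C n k := by gcongr
    simp only [l]
    linarith
  have hl0 : ∀ n, 0 < l n := fun n => lt_of_lt_of_le one_pos (hl1 n)
  let F : ℕ → V × Γ → ℝ := fun n p => ((l n)⁻¹) ^ n • φ n (dilation V Γ (l n) p)
  have hF : ∀ n x γ, F n (x, γ) = χ (l n • γ) * f n (x, γ) := fun n x γ => by
    have h1 : φ n (dilation V Γ (l n) (x, γ)) = χ (l n • γ) * f n (x, l n • γ) := rfl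
    simp only [F]
    rw [h1, hom, smul_eq_mul]
    have h2 : (l n)⁻¹ ^ n * l n ^ n = 1 := by
      rw [← mul_pow, inv_mul_cancel₀ (hl0 n).ne', one_pow]
    linear_combination χ (l n • γ) * f n (x, γ) * h2
  have hFs : ∀ n, ContDiff ℝ ∞ (F n) := fun n =>
    ((hφ n).comp (dilation V Γ (l n)).contDiff).const_smul _
  have hFd : ∀ n k p, ‖iteratedFDeriv ℝ k (F n) p‖ ≤ ((l n)⁻¹) ^ n * (C n k * l n ^ k) := by
    intro n k p
    have hcd : ContDiff ℝ k (φ n ∘ dilation V Γ (l n)) :=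
      (((hφ n).comp (dilation V Γ (l n)).contDiff)).of_le (by exact_mod_cast le_top)
    have h1 : iteratedFDeriv ℝ k (F n) p
        = ((l n)⁻¹) ^ n • iteratedFDeriv ℝ k (φ n ∘ dilation V Γ (l n)) p :=
      iteratedFDeriv_const_smul_apply (a := ((l n)⁻¹) ^ n) (f := φ n ∘ dilation V Γ (l n))
        (x := p) hcd.contDiffAt
    rw [h1, norm_smul, (dilation V Γ (l n)).iteratedFDeriv_comp_right (hφ n) p
      (by exact_mod_cast le_top), Real.norm_eq_abs, abs_of_pos (by have := hl0 n; positivity)]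
    gcongr
    · have := hl0 n; positivity
    refine (ContinuousMultilinearMap.norm_compContinuousLinearMap_le _ _).trans ?_
    rw [prod_const, card_univ, Fintype.card_fin]
    gcongr
    · exact hC0 n k
    · exact hC n k _
    · exact norm_dilation_le (hl1 n)
  -- The derivatives of order `k` of the summands are dominated by a convergent series.
  let v : ℕ → ℕ → ℝ := fun k n => if k < n then (1 / 2) ^ n else ((l n)⁻¹) ^ n * (C n k * l n ^ k)
  have hv : ∀ k, Summable (v k) := fun k => by
    refine (summable_nat_add_iff (k + 1)).1 ?_
    have h2 := (summable_nat_add_iff (f := fun n => (1 / 2 : ℝ) ^ n) (k + 1)).2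
      summable_geometric_two
    refine h2.congr fun n => ?_
    simp only [v]
    rw [if_pos (by omega)]
  have hFv : ∀ k n p, ‖iteratedFDeriv ℝ k (F n) p‖ ≤ v k n := by
    intro k n p
    simp only [v]
    split_ifs with hk
    · refine (hFd n k p).trans ?_
      obtain ⟨j, rfl⟩ := Nat.exists_eq_add_of_lt hk
      have hL := hl1 (k + j + 1)
      have hL0 := hl0 (k + j + 1)
      have h3 := hlC (k + j + 1) k hk
      set L := l (k + j + 1)
      have h4 : L⁻¹ ^ (k + j + 1) * (C (k + j + 1) k * L ^ k)
          = C (k + j + 1) k / L ^ (j + 1) := by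
        have h5 : L⁻¹ ^ k * L ^ k = 1 := by
          rw [← mul_pow, inv_mul_cancel₀ hL0.ne', one_pow]
        rw [div_eq_mul_inv, ← inv_pow, show k + j + 1 = k + (j + 1) by ring, pow_add]
        linear_combination L⁻¹ ^ (j + 1) * C (k + (j + 1)) k * h5
      rw [h4, div_le_iff₀ (by positivity), one_div, inv_pow, ← div_eq_inv_mul,
        le_div_iff₀ (by positivity), mul_comm]
      exact h3.trans (le_self_pow₀ hL (by omega))
    · exact hFd n k p
  have hF0 : ∀ p, Summable fun n => F n p := fun p => by
    refine Summable.of_norm_bounded (hv 0) fun n => ?_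
    simpa using hFv 0 n p
  refine ⟨fun p => ∑' n, F n p, ?_, fun x γ hx => ?_, fun N x γ => ?_⟩
  · exact contDiff_tsum (N := ⊤) (fun n => hFs n) (fun k _ => hv k) (fun k n p _ => hFv k n p)
  · simp [hF, hfK _ _ _ hx]
  · let B : ℕ → ℝ := fun n => (1 / 2) ^ n + if n = N then c N else 0
    have hB : Summable B := summable_geometric_two.add
      (summable_of_ne_finset_zero (s := {N}) fun n hn => if_neg (by simpa using hn))
    have hbound : ∀ t : ℝ, ∀ n, N ≤ n → ‖F n (x, t • γ)‖ ≤ (|t| ^ N * ‖γ‖ ^ N) * B n := by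
      intro t n hn
      rw [hF, ← mul_pow, norm_mul, Real.norm_eq_abs, Real.norm_eq_abs, abs_of_nonneg χ.nonneg]
      have h1 : |f n (x, t • γ)| ≤ c n * (|t| * ‖γ‖) ^ n := by
        simpa [norm_smul] using hc n x (t • γ)
      have hr : 0 ≤ |t| * ‖γ‖ := by positivity
      have hχ : χ (l n • t • γ) ≤ 1 := χ.le_one
      rcases hn.eq_or_lt with rfl | hn
      · simp only [B, if_true]
        calc χ (l N • t • γ) * |f N (x, t • γ)| ≤ 1 * (c N * (|t| * ‖γ‖) ^ N) := by
              gcongr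
          _ ≤ (|t| * ‖γ‖) ^ N * ((1 / 2) ^ N + c N) := by
              have : 0 ≤ (|t| * ‖γ‖) ^ N * (1 / 2) ^ N := by positivity
              nlinarith
      · simp only [B, if_neg hn.ne', add_zero]
        by_cases h2 : l n * (|t| * ‖γ‖) ≤ 2
        · calc χ (l n • t • γ) * |f n (x, t • γ)| ≤ 1 * (c n * (|t| * ‖γ‖) ^ n) := by
                gcongr
            _ ≤ _ := by
                rw [one_mul]
                exact borel_tail_bound (hc0 n) (hl1 n) (hlc n) hr h2 hn
        · have : χ (l n • t • γ) = 0 := χ.zero_of_le_dist (by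
            rw [hχ2, dist_zero_right, norm_smul, norm_smul, Real.norm_eq_abs, Real.norm_eq_abs,
              abs_of_pos (hl0 n)]
            exact (not_le.1 h2).le)
          rw [this, zero_mul]
          positivity
    -- The first `N` cut-off functions equal `1` near the origin, so the corresponding terms are exact.
    have hev : ∀ᶠ t : ℝ in 𝓝 0, ∀ i ∈ range N, χ (l i • t • γ) = 1 := by
      rw [Finset.eventually_all]
      intro i _
      have hcont : Continuous fun t : ℝ => l i • t • γ := by fun_prop
      have := hcont.tendsto' 0 0 (by simp)
      filter_upwards [this (Metric.closedBall_mem_nhds (0 : Γ) one_pos)] with t ht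
      exact χ.one_of_mem_closedBall (by rw [hχ1]; exact ht)
    refine IsBigO.of_bound (‖γ‖ ^ N * ∑' n, B (n + N)) ?_
    filter_upwards [hev] with t ht
    have h1 := (hF0 (x, t • γ)).sum_add_tsum_nat_add N
    have h2 : ∑ i ∈ range N, F i (x, t • γ) = ∑ i ∈ range N, t ^ i * f i (x, γ) :=
      sum_congr rfl fun i hi => by rw [hF, ht i hi, one_mul, hom]
    rw [← h1, h2, add_sub_cancel_left]
    have h3 := tsum_of_norm_bounded (f := fun n => F (n + N) (x, t • γ))
      (((summable_nat_add_iff N).2 hB).hasSum.mul_left (|t| ^ N * ‖γ‖ ^ N))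
      (fun n => hbound t (n + N) (by omega))
    refine h3.trans (le_of_eq ?_)
    rw [norm_pow, Real.norm_eq_abs]
    ring

end Borel

section BorelManifold
open Finset Asymptotics Filter

variable {E : Type*} [NormedAddCommGroup E] [NormedSpace ℝ E] [FiniteDimensional ℝ E]
  {M : Type*} [TopologicalSpace M] [ChartedSpace E M] [IsManifold 𝓘(ℝ, E) ∞ M] [T2Space M]
  {Γ : Type*} [NormedAddCommGroup Γ] [NormedSpace ℝ Γ] [FiniteDimensional ℝ Γ]

/-- Borel's lemma for functions on `M` that are cut off by a function supported in a chart. -/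
theorem exists_borel_sum_chart {g : ℕ → Γ → SmoothFn E M}
    (hg : ∀ n, JointlySmooth E (fun γ => g n γ))
    (hom : ∀ n (s : ℝ) γ, g n (s • γ) = s ^ n • g n γ) (m₀ : M) {ρ : M → ℝ}
    (hρ : ContMDiff 𝓘(ℝ, E) 𝓘(ℝ, ℝ) ∞ ρ) (hc : HasCompactSupport ρ)
    (hs : tsupport ρ ⊆ (extChartAt 𝓘(ℝ, E) m₀).source) :
    ∃ G : Γ → M → ℝ, JointlySmooth E G ∧ (∀ γ m, m ∉ tsupport ρ → G γ m = 0) ∧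
      ∀ N m γ, (fun t : ℝ => G (t • γ) m - ∑ i ∈ range N, t ^ i * (ρ m * g i γ m))
        =O[𝓝 0] fun t => t ^ N := by
  classical
  set e := extChartAt 𝓘(ℝ, E) m₀ with he
  have hopen : IsOpen e.target := isOpen_extChartAt_target m₀
  have hsopen : IsOpen e.source := isOpen_extChartAt_source m₀
  set K := e '' tsupport ρ with hKdef
  have hKc : IsCompact K := hc.isCompact.image_of_continuousOn
    ((continuousOn_extChartAt m₀).mono hs)
  have hKt : ∀ x ∈ e.target, x ∉ K → e.symm x ∉ tsupport ρ := fun x hx hxK h =>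
    hxK ⟨e.symm x, h, e.right_inv hx⟩
  have hmK : ∀ m ∈ e.source, m ∉ tsupport ρ → e m ∉ K := fun m hm hmρ h => by
    obtain ⟨m', hm', h⟩ := h
    rw [e.injOn (hs hm') hm h] at hm'
    exact hmρ hm'
  let f : ℕ → E × Γ → ℝ := fun n p =>
    if p.1 ∈ e.target then ρ (e.symm p.1) * g n p.2 (e.symm p.1) else 0
  have hfK : ∀ n x γ, x ∉ K → f n (x, γ) = 0 := fun n x γ hx => by
    simp only [f]
    split_ifs with h
    · rw [image_eq_zero_of_notMem_tsupport (hKt x h hx), zero_mul]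
    · rfl
  have hf : ∀ n, ContDiff ℝ ∞ (f n) := fun n => by
    rw [contDiff_iff_contDiffAt]
    rintro ⟨x, γ⟩
    by_cases hx : x ∈ e.target
    · have h0 : ContMDiffOn (𝓘(ℝ, E).prod 𝓘(ℝ, Γ)) 𝓘(ℝ, ℝ) ∞
          (fun p : E × Γ => ρ (e.symm p.1) * g n p.2 (e.symm p.1)) (e.target ×ˢ univ) := by
        have h1 : ContMDiffOn (𝓘(ℝ, E).prod 𝓘(ℝ, Γ)) 𝓘(ℝ, E) ∞
            (fun p : E × Γ => e.symm p.1) (e.target ×ˢ univ) :=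
          (contMDiffOn_extChartAt_symm m₀).comp contMDiffOn_fst (fun p hp => hp.1)
        exact (hρ.comp_contMDiffOn h1).mul
          (ContMDiff.comp_contMDiffOn (g := fun p : M × Γ => g n p.2 p.1)
            (f := fun p : E × Γ => (e.symm p.1, p.2)) (hg n) (h1.prodMk contMDiffOn_snd))
      rw [← modelWithCornersSelf_prod, chartedSpaceSelf_prod] at h0
      have h2 := (contMDiffOn_iff_contDiffOn.1 h0).contDiffAt
        ((hopen.prod isOpen_univ).mem_nhds (⟨hx, mem_univ γ⟩ : (x, γ) ∈ e.target ×ˢ univ))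
      refine h2.congr_of_eventuallyEq ?_
      filter_upwards [(hopen.prod isOpen_univ).mem_nhds
        (⟨hx, mem_univ γ⟩ : (x, γ) ∈ e.target ×ˢ univ)] with p hp
      simp [f, hp.1]
    · have hxK : x ∉ K := fun h => hx (by
        obtain ⟨m, hm, rfl⟩ := h
        exact e.map_source (hs hm))
      refine (contDiffAt_const (c := (0 : ℝ))).congr_of_eventuallyEq ?_
      filter_upwards [(hKc.isClosed.isOpen_compl.prod isOpen_univ).mem_nhds
        (⟨hxK, mem_univ γ⟩ : (x, γ) ∈ Kᶜ ×ˢ univ)] with p hp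
      exact hfK n p.1 p.2 hp.1
  have hfhom : ∀ n (s : ℝ) x γ, f n (x, s • γ) = s ^ n * f n (x, γ) := fun n s x γ => by
    simp only [f]
    split_ifs
    · rw [hom]
      change _ * (s ^ n * _) = _
      ring
    · simp
  obtain ⟨G, hG, hGK, hGT⟩ := exists_borel_sum hf hKc hfK hfhom
  have hG0 : ∀ γ m, m ∉ tsupport ρ → (if m ∈ e.source then G (e m, γ) else 0) = 0 :=
    fun γ m hm => by
      split_ifs with h
      · exact hGK _ _ (hmK m h hm)
      · rfl
  refine ⟨fun γ m => if m ∈ e.source then G (e m, γ) else 0, ?_, hG0, fun N m γ => ?_⟩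
  · rintro ⟨m, γ⟩
    by_cases hm : m ∈ e.source
    · have hG' : ContMDiff (𝓘(ℝ, E).prod 𝓘(ℝ, Γ)) 𝓘(ℝ, ℝ) ∞ G := by
        have := hG.contMDiff
        rw [modelWithCornersSelf_prod, ← chartedSpaceSelf_prod] at this
        exact this
      have h1 : ContMDiffAt (𝓘(ℝ, E).prod 𝓘(ℝ, Γ)) 𝓘(ℝ, ℝ) ∞
          (fun p : M × Γ => G (e p.1, p.2)) (m, γ) := by
        refine hG'.contMDiffAt.comp (f := fun p : M × Γ => (e p.1, p.2)) (m, γ) ?_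
        refine ContMDiffAt.prodMk ?_ contMDiffAt_snd
        exact ContMDiffAt.comp (g := e) (m, γ)
          (contMDiffAt_extChartAt' (by simpa [e] using hm)) contMDiffAt_fst
      refine h1.congr_of_eventuallyEq ?_
      filter_upwards [(hsopen.prod isOpen_univ).mem_nhds
        (⟨hm, mem_univ γ⟩ : (m, γ) ∈ e.source ×ˢ univ)] with p hp
      simp [hp.1]
    · have hmρ : m ∉ tsupport ρ := fun h => hm (hs h)
      refine (contMDiffAt_const (c := (0 : ℝ))).congr_of_eventuallyEq ?_
      filter_upwards [((isClosed_tsupport ρ).isOpen_compl.prod isOpen_univ).mem_nhds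
        (⟨hmρ, mem_univ γ⟩ : (m, γ) ∈ (tsupport ρ)ᶜ ×ˢ univ)] with p hp
      exact hG0 p.2 p.1 hp.1
  · by_cases hm : m ∈ e.source
    · refine (hGT N (e m) γ).congr_left fun t => ?_
      simp [f, hm, e.map_source hm, e.left_inv hm]
    · have hmρ : m ∉ tsupport ρ := fun h => hm (hs h)
      simp only [hG0 _ _ hmρ, image_eq_zero_of_notMem_tsupport hmρ]
      simpa using isBigO_zero _ _

/-- Borel's lemma for functions on a manifold: a formal series of homogeneous families of functions
is the Taylor series of a smooth family of functions. -/
theorem exists_borel_family [SecondCountableTopology M] {g : ℕ → Γ → SmoothFn E M}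
    (hg : ∀ n, JointlySmooth E (fun γ => g n γ))
    (hom : ∀ n (s : ℝ) γ, g n (s • γ) = s ^ n • g n γ) :
    ∃ G : Γ → M → ℝ, JointlySmooth E G ∧
      ∀ γ, HasTaylor (fun t : ℝ => G (t • γ)) (fun n => g n γ) := by
  classical
  have : LocallyCompactSpace M := Manifold.locallyCompact_of_finiteDimensional 𝓘(ℝ, E)
  obtain ⟨ι, fs, -⟩ := SmoothBumpCovering.exists_isSubordinate 𝓘(ℝ, E) (M := M) isClosed_univ
    (U := fun _ => univ) (fun _ _ => Filter.univ_mem)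
  set ρ := fs.toSmoothPartitionOfUnity with hρ
  have hsub : ∀ i, tsupport (ρ i) ⊆ tsupport (fs i) := fun i =>
    closure_mono (fs.support_toSmoothPartitionOfUnity_subset i)
  have hsrc : ∀ i, tsupport (ρ i) ⊆ (extChartAt 𝓘(ℝ, E) (fs.c i)).source := fun i => by
    rw [extChartAt_source]
    exact (hsub i).trans (fs i).tsupport_subset_chartAt_source
  have hcpt : ∀ i, HasCompactSupport (ρ i) := fun i =>
    ((fs i).hasCompactSupport).of_isClosed_subset (isClosed_tsupport _) (hsub i)
  have key := fun i => exists_borel_sum_chart hg hom (fs.c i) (ρ i).contMDiff (hcpt i) (hsrc i)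
  choose G hG hG0 hGT using key
  have hlf : LocallyFinite fun i => tsupport (ρ i) := ρ.locallyFinite.closure
  have hfin : ∀ m, {i | m ∈ tsupport (ρ i)}.Finite := fun m => hlf.point_finite m
  have hsm : JointlySmooth E (fun γ m => ∑ᶠ i, G i γ m) := by
    refine contMDiff_finsum (f := fun i (p : M × Γ) => G i p.2 p.1) (fun i => hG i) ?_
    refine (hlf.preimage_continuous (continuous_fst (X := M) (Y := Γ))).subset fun i p hp => ?_
    by_contra h
    exact hp (hG0 i p.2 p.1 h)
  refine ⟨_, hsm, fun γ => ?_⟩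
  obtain ⟨d, hd⟩ := (hsm.comp_line γ).exists_hasTaylor
  refine HasTaylor.of_isBigO (fun N m => ?_) hd
  have h1 : ∀ γ, ∑ᶠ i, G i γ m = ∑ i ∈ (hfin m).toFinset, G i γ m := fun γ =>
    finsum_eq_sum_of_support_subset _ fun i hi => by
      by_contra h
      exact hi (hG0 i γ m (by simpa using h))
  have h2 : ∑ i ∈ (hfin m).toFinset, ρ i m = 1 := by
    rw [← ρ.sum_eq_one (mem_univ m)]
    refine (finsum_eq_sum_of_support_subset _ fun i hi => ?_).symm
    simpa using subset_tsupport (ρ i) hi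
  -- Only finitely many of the charts of the partition of unity contribute at `m`.
  have h3 := IsBigO.sum (s := (hfin m).toFinset) fun i _ => hGT i N m γ
  refine h3.congr_left fun t => ?_
  rw [h1, Finset.sum_apply, sum_sub_distrib, sum_comm]
  congr 1
  refine sum_congr rfl fun i _ => ?_
  rw [← mul_sum, ← sum_mul, h2, one_mul]

end BorelManifold
end NearlyPeriodic

/-! ### Taylor expansion along lines in the parameter space -/

namespace NearlyPeriodic
open MeasureTheory Set

variable {E : Type*} [NormedAddCommGroup E] [NormedSpace ℝ E]
  {M : Type*} [TopologicalSpace M] [ChartedSpace E M]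

section TruncatedTaylor
open Finset Asymptotics Filter HasAntidiagonal

/-- The family `f_t` is smooth, and its Taylor coefficients of degree at most `N` are `cₙ`. -/
structure HasTaylorUpTo (N : ℕ) (f : ℝ → M → ℝ) (c : ℕ → SmoothFn E M) : Prop where
  smooth : JointlySmooth E f
  isBigO : ∀ m, (fun t => f t m - ∑ i ∈ range (N + 1), t ^ i * c i m) =O[𝓝 0] fun t => t ^ (N + 1)

theorem HasTaylor.upTo {f : ℝ → M → ℝ} {c : ℕ → SmoothFn E M} (h : HasTaylor f c) (N : ℕ) :
    HasTaylorUpTo N f c := ⟨h.smooth, h.isBigO (N + 1)⟩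

namespace HasTaylorUpTo
variable {N : ℕ} {f g : ℝ → M → ℝ} {c d : ℕ → SmoothFn E M}

theorem congr_coeff (h : HasTaylorUpTo N f c) (hcd : ∀ n ≤ N, c n = d n) :
    HasTaylorUpTo N f d := by
  refine ⟨h.smooth, fun m => (h.isBigO m).congr_left fun t => ?_⟩
  congr 1
  refine sum_congr rfl fun i hi => ?_
  rw [hcd i (by have := Finset.mem_range.1 hi; omega)]

theorem congr_isBigO (h : HasTaylorUpTo N f c) (hg : JointlySmooth E g)
    (hfg : ∀ m, (fun t => g t m - f t m) =O[𝓝 0] fun t => t ^ (N + 1)) : HasTaylorUpTo N g c :=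
  ⟨hg, fun m => ((hfg m).add (h.isBigO m)).congr_left fun t => by ring⟩

theorem congr (h : HasTaylorUpTo N f c) (hfg : ∀ t m, g t m = f t m) : HasTaylorUpTo N g c := by
  have : g = f := by ext t m; exact hfg t m
  rwa [this]

theorem isBigO_iff (h : HasTaylorUpTo N f c) (m : M) :
    ((fun t => f t m) =O[𝓝 0] fun t => t ^ (N + 1)) ↔ ∀ n ≤ N, c n m = 0 := by
  constructor
  · intro h1 n hn
    refine coeff_eq_zero_of_isBigO (c := fun i => c i m) (N := N + 1) ?_ n (by omega)
    refine ((h1.sub (h.isBigO m)).congr_left fun t => ?_).mono nhdsWithin_le_nhds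
    ring
  · intro h1
    refine (h.isBigO m).congr_left fun t => ?_
    rw [sum_eq_zero fun i hi => by
      rw [h1 i (by have := Finset.mem_range.1 hi; omega), mul_zero], sub_zero]

theorem sub (hf : HasTaylorUpTo N f c) (hg : HasTaylorUpTo N g d) :
    HasTaylorUpTo N (fun t m => f t m - g t m) (fun n => c n - d n) := by
  refine ⟨hf.smooth.sub hg.smooth, fun m =>
    ((hf.isBigO m).sub (hg.isBigO m)).congr_left fun t => ?_⟩
  have : ∀ i, (c i - d i) m = c i m - d i m := fun i => rfl
  simp only [this, mul_sub, sum_sub_distrib]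
  ring

theorem coeff_eq (hf : HasTaylorUpTo N f c) (hf' : HasTaylorUpTo N f d) : ∀ n ≤ N, c n = d n := by
  intro n hn
  ext m
  have h := ((hf.sub hf').isBigO_iff m).1 (by simpa using isBigO_zero _ _) n hn
  exact sub_eq_zero.1 h

variable [IsManifold 𝓘(ℝ, E) ∞ M]

theorem exists_hasTaylor (h : HasTaylorUpTo N f c) :
    ∃ c', HasTaylor f c' ∧ ∀ n ≤ N, c' n = c n := by
  obtain ⟨c', hc'⟩ := h.smooth.exists_hasTaylor
  exact ⟨c', hc', (hc'.upTo N).coeff_eq h⟩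

end HasTaylorUpTo

variable [IsManifold 𝓘(ℝ, E) ∞ M]

/-- A polynomial in `t` whose coefficients have Taylor series themselves. -/
theorem hasTaylorUpTo_sum {N : ℕ} {f : ℕ → ℝ → M → ℝ} {c : ℕ → ℕ → SmoothFn E M}
    (h : ∀ k, HasTaylorUpTo N (f k) (c k)) :
    HasTaylorUpTo N (fun t m => ∑ k ∈ range (N + 1), t ^ k * f k t m)
      (fun n => ∑ p ∈ antidiagonal n, c p.1 p.2) := by
  choose c' hc' hcc using fun k => (h k).exists_hasTaylor
  refine ((HasTaylor.sum (s := range (N + 1)) fun k _ => (hc' k).mul_pow k).upTo N).congr_coeff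
    fun n hn => ?_
  rw [Nat.sum_antidiagonal_eq_sum_range_succ_mk, ← sum_subset (range_mono (by omega : n + 1 ≤ N + 1))]
  · refine sum_congr rfl fun k hk => ?_
    have := Finset.mem_range.1 hk
    rw [if_neg (by omega), hcc k _ (by omega)]
  · intro k _ hk
    rw [if_pos (by simpa using hk)]

/-- The partial sum `∑_{k ≤ N} tᵏ R_k`. -/
def lineSum (R : ℕ → SmoothVF E M) (N : ℕ) (t : ℝ) : SmoothVF E M :=
  ∑ k ∈ range (N + 1), t ^ k • R k

theorem lineSum_apply (R : ℕ → SmoothVF E M) (N : ℕ) (t : ℝ) (m : M) :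
    lineSum R N t m = ∑ k ∈ range (N + 1), t ^ k • R k m := by
  rw [lineSum, SmoothVF.coe_sum]
  rfl

variable [FiniteDimensional ℝ E] [T2Space M]

/-- The Taylor coefficients of the derivative of a family of functions along a truncated series of vector
fields are those of the product of formal series. -/
theorem HasTaylorUpTo.lie_lineSum {N : ℕ} {f : ℝ → M → ℝ} {c : ℕ → SmoothFn E M}
    (h : HasTaylorUpTo N f c) (R : ℕ → SmoothVF E M) :
    HasTaylorUpTo N (fun t => lieFun (lineSum R N t) (f t)) (cauchy (lieAct _ _) R c) := by
  obtain ⟨c', hc', hcc⟩ := h.exists_hasTaylor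
  refine (HasTaylorUpTo.congr_coeff (hasTaylorUpTo_sum (c := fun k l => ⁅R k, c' l⁆)
    fun k => (hc'.lie (R k)).upTo N) fun n hn => ?_).congr fun t m => ?_
  · refine sum_congr rfl fun p hp => ?_
    rw [hcc p.2 (by have := mem_antidiagonal.1 hp; omega)]
    rfl
  · rw [lieFun, lineSum_apply, map_sum]
    refine sum_congr rfl fun k _ => ?_
    rw [map_smul]
    rfl

theorem HasTaylorUpTo.lie {N : ℕ} {f : ℝ → M → ℝ} {c : ℕ → SmoothFn E M}
    (h : HasTaylorUpTo N f c) (X : SmoothVF E M) :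
    HasTaylorUpTo N (fun t => lieFun X (f t)) (fun n => ⁅X, c n⁆) := by
  obtain ⟨c', hc', hcc⟩ := h.exists_hasTaylor
  exact ((hc'.lie X).upTo N).congr_coeff fun n hn => by rw [hcc n hn]

/-- The Taylor coefficients of a path of `1`-forms. -/
theorem exists_taylorForm {β : ℝ → OneForm E M}
    (hβ : ∀ Y : SmoothVF E M, JointlySmooth E (fun t m => β t m (Y m))) :
    ∃ b : ℕ → SmoothVF E M →ₗ[ℝ] SmoothFn E M,
      (∀ Y : SmoothVF E M, HasTaylor (fun t m => β t m (Y m)) (fun n => b n Y)) ∧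
      ∀ n f Y, b n (fmul f Y) = f * b n Y := by
  choose c hc using fun Y => (hβ Y).exists_hasTaylor
  have hadd : ∀ X Y n, c (X + Y) n = c X n + c Y n := fun X Y n =>
    congrFun ((hc (X + Y)).unique (((hc X).add (hc Y)).congr fun t m => map_add (β t m) _ _)) n
  have hsmul : ∀ (a : ℝ) X n, c (a • X) n = a • c X n := fun a X n =>
    congrFun ((hc (a • X)).unique (((hc X).const_smul a).congr fun t m => map_smul (β t m) _ _)) n
  have hmul : ∀ (f : SmoothFn E M) X n, c (fmul f X) n = f * c X n := fun f X n => by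
    refine congrFun ((hc (fmul f X)).unique (d := fun n => f * c X n) fun N => ?_) n
    obtain ⟨r, hr, h⟩ := hc X N
    refine ⟨fun t m => f m * r t m, (JointlySmooth.const f).mul hr, fun t m => ?_⟩
    have h1 : β t m (fmul f X m) = f m * β t m (X m) := map_smul (β t m) (f m) (X m)
    beta_reduce at h ⊢
    rw [h1, h t m, mul_add, mul_sum]
    congr 1
    · exact sum_congr rfl fun i _ => mul_left_comm _ _ _
    · exact mul_left_comm _ _ _
  exact ⟨fun n => ⟨⟨fun Y => c Y n, fun X Y => hadd X Y n⟩, fun a X => hsmul a X n⟩, hc,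
    fun n f Y => hmul f Y n⟩

/-- The Taylor coefficients of the contraction of a family of `1`-forms with a truncated series of vector
fields are those of the product of formal series. -/
theorem hasTaylorUpTo_apply_lineSum {β : ℝ → OneForm E M}
    {b : ℕ → SmoothVF E M →ₗ[ℝ] SmoothFn E M}
    (hb : ∀ Y : SmoothVF E M, HasTaylor (fun t m => β t m (Y m)) (fun n => b n Y))
    (R : ℕ → SmoothVF E M) (N : ℕ) :
    HasTaylorUpTo N (fun t m => β t m (lineSum R N t m)) (cauchy LinearMap.id b R) := by
  refine (HasTaylorUpTo.congr_coeff (hasTaylorUpTo_sum (c := fun k l => b l (R k))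
    fun k => (hb (R k)).upTo N) fun n hn => ?_).congr fun t m => ?_
  · rw [cauchy, ← Nat.sum_antidiagonal_swap]
    rfl
  · rw [lineSum_apply, map_sum]
    exact sum_congr rfl fun k _ => map_smul (β t m) _ _

/-- The Taylor coefficients of `L_R β`. -/
theorem hasTaylorUpTo_lieOneForm {β : ℝ → OneForm E M}
    {b : ℕ → SmoothVF E M →ₗ[ℝ] SmoothFn E M}
    (hb : ∀ Y : SmoothVF E M, HasTaylor (fun t m => β t m (Y m)) (fun n => b n Y))
    (R : ℕ → SmoothVF E M) (N : ℕ) (Y : SmoothVF E M) :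
    HasTaylorUpTo N (fun t => lieOneForm (lineSum R N t) (β t) Y)
      (fun n => cauchy (lieAct _ _) R b n Y) := by
  refine (HasTaylorUpTo.congr_coeff (hasTaylorUpTo_sum
    (c := fun k l => ⁅R k, b l Y⁆ - b l ⁅R k, Y⁆)
    fun k => (((hb Y).lie (R k)).sub (hb ⁅R k, Y⁆)).upTo N) fun n hn => ?_).congr fun t m => ?_
  · rw [cauchy, LinearMap.sum_apply]
    exact sum_congr rfl fun p _ => rfl
  · have h1 : lieFun (lineSum R N t) (fun x => β t x (Y x)) m
        = ∑ k ∈ range (N + 1), t ^ k * lieFun (R k) (fun x => β t x (Y x)) m := by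
      rw [lieFun, lineSum_apply, map_sum]
      refine sum_congr rfl fun k _ => ?_
      rw [map_smul]
      rfl
    have h2 : β t m (VectorField.mlieBracket 𝓘(ℝ, E) (lineSum R N t) Y m)
        = ∑ k ∈ range (N + 1), t ^ k * β t m (⁅R k, Y⁆ m) := by
      rw [← bracket_apply, lineSum, sum_lie, SmoothVF.coe_sum, map_sum]
      refine sum_congr rfl fun k _ => ?_
      rw [smul_lie]
      exact map_smul (β t m) _ _
    rw [lieOneForm, h1, h2, ← sum_sub_distrib]
    exact sum_congr rfl fun k _ => by ring

end TruncatedTaylor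

section Families
variable [IsManifold 𝓘(ℝ, E) ∞ M] [FiniteDimensional ℝ E] [T2Space M]
  {Γ : Type*} [NormedAddCommGroup Γ] [NormedSpace ℝ Γ]

theorem SmoothOneFormFamily.comp_line {θ : Γ → OneForm E M} (hθ : SmoothOneFormFamily θ) (γ : Γ) :
    SmoothOneFormFamily (fun t : ℝ => θ (t • γ)) :=
  ContMDiff.comp (g := fun p : M × Γ => Bundle.TotalSpace.mk' (E →L[ℝ] ℝ)
      (E := fun m : M => TangentSpace 𝓘(ℝ, E) m →L[ℝ] ℝ) p.1 (θ p.2 p.1))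
    (f := fun p : M × ℝ => (p.1, p.2 • γ)) hθ
    (contMDiff_fst.prodMk (contMDiff_snd.smul contMDiff_const))

theorem FormalSeries.term_smul {V : Type*} [AddCommGroup V] [Module ℝ V] (a : FormalSeries Γ V)
    (n : ℕ) (s : ℝ) (γ : Γ) : a.term n (s • γ) = s ^ n • a.term n γ := by
  rw [term, term, MultilinearMap.map_smul_univ (a n) (fun _ => s) (fun _ => γ)]
  simp

theorem FormalSeries.partialSum_line (R : FormalSeries Γ (SmoothVF E M)) (N : ℕ) (t : ℝ) (γ : Γ) :
    R.partialSum N (t • γ) = lineSum (fun n => R.term n γ) N t := by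
  simp only [partialSum, term_smul, lineSum]

variable [FiniteDimensional ℝ Γ]

/-- The homogeneous terms of a formal vector field depend smoothly on `γ`, because a multilinear map
is polynomial in the coordinates with respect to a basis. -/
theorem FormalSeries.smoothVFFamily_term (R : FormalSeries Γ (SmoothVF E M)) (n : ℕ) :
    SmoothVFFamily (fun γ => (R.term n γ : VF E M)) := by
  refine smoothVFFamily_of_lie fun f => ?_
  let b := Module.finBasis ℝ Γ
  have h : ∀ γ m, lieFun (R.term n γ) f m
      = ∑ i : Fin n → Fin (Module.finrank ℝ Γ), (∏ j, b.repr γ (i j)) * ⁅R n (fun j => b (i j)), f⁆ m := by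
    intro γ m
    have h1 : R.term n γ = ∑ i : Fin n → Fin (Module.finrank ℝ Γ),
        (∏ j, b.repr γ (i j)) • R n (fun j => b (i j)) := by
      conv_lhs => rw [term, ← b.sum_repr γ]
      rw [MultilinearMap.map_sum]
      exact Finset.sum_congr rfl fun i _ => MultilinearMap.map_smul_univ _ _ _
    rw [← lie_fn_apply, h1, sum_lie, SmoothFn.coe_sum]
    refine Finset.sum_congr rfl fun i _ => ?_
    rw [smul_lie]
    rfl
  have h2 : JointlySmooth E (fun γ m => ∑ i : Fin n → Fin (Module.finrank ℝ Γ),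
      (∏ j, b.repr γ (i j)) * ⁅R n (fun j => b (i j)), f⁆ m) := by
    refine JointlySmooth.sum fun i _ => (JointlySmooth.of_param ?_).mul (JointlySmooth.const _)
    exact contDiff_prod fun j _ => (b.coord (i j)).toContinuousLinearMap.contDiff
  exact ContMDiff.congr h2 fun p => h p.2 p.1

theorem FormalSeries.jointlySmooth_lie_term (R : FormalSeries Γ (SmoothVF E M)) (n : ℕ)
    {f : Γ → SmoothFn E M} (hf : JointlySmooth E (fun γ => f γ)) :
    JointlySmooth E (fun γ => (⁅R.term n γ, f γ⁆ : SmoothFn E M)) :=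
  hf.mvfderiv (R.smoothVFFamily_term n)

end Families
end NearlyPeriodic

/-! ### The normalized primitive -/

namespace NearlyPeriodic
open MeasureTheory Set

variable {E : Type*} [NormedAddCommGroup E] [NormedSpace ℝ E] [FiniteDimensional ℝ E]
  {M : Type*} [TopologicalSpace M] [ChartedSpace E M] [IsManifold 𝓘(ℝ, E) ∞ M] [T2Space M]
  [MulAction Circle M] [ContMDiffSMul (𝓡 1) 𝓘(ℝ, E) ∞ Circle M]
  {Γ : Type*} [NormedAddCommGroup Γ] [NormedSpace ℝ Γ]

section Homological
open Finset HasAntidiagonal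

/-- The solution `(gₙ, μₙ)` of the homological equation `h = μ + L_R g` in which the part of `L_R μ`
that lies in the image of `L_{R₀}` is cancelled degree by degree. -/
def homologicalPair (h : ℕ → SmoothFn E M) (R : ℕ → SmoothVF E M) :
    ℕ → SmoothFn E M × SmoothFn E M
  | n =>
    (hom E M (h n - ∑ k : Fin n, ⁅R (n - k), (homologicalPair h R k).1⁆
        + hom E M (∑ k : Fin n, ⁅R (n - k), (homologicalPair h R k).2⁆)),
      avg E M (h n - ∑ k : Fin n, ⁅R (n - k), (homologicalPair h R k).1⁆)
        - hom E M (∑ k : Fin n, ⁅R (n - k), (homologicalPair h R k).2⁆))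

theorem homologicalPair_fst (h : ℕ → SmoothFn E M) (R : ℕ → SmoothVF E M) (n : ℕ) :
    (homologicalPair h R n).1 = hom E M (h n - ∑ k ∈ range n, ⁅R (n - k), (homologicalPair h R k).1⁆
        + hom E M (∑ k ∈ range n, ⁅R (n - k), (homologicalPair h R k).2⁆)) := by
  rw [homologicalPair, Finset.sum_range, Finset.sum_range]

theorem homologicalPair_snd (h : ℕ → SmoothFn E M) (R : ℕ → SmoothVF E M) (n : ℕ) :
    (homologicalPair h R n).2 = avg E M (h n - ∑ k ∈ range n, ⁅R (n - k), (homologicalPair h R k).1⁆)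
        - hom E M (∑ k ∈ range n, ⁅R (n - k), (homologicalPair h R k).2⁆) := by
  rw [homologicalPair, Finset.sum_range, Finset.sum_range]

theorem cauchy_lie_eq (R : ℕ → SmoothVF E M) (g : ℕ → SmoothFn E M) (n : ℕ) :
    cauchy (lieAct _ _) R g n = ⁅R 0, g n⁆ + ∑ k ∈ range n, ⁅R (n - k), g k⁆ := by
  rw [cauchy, ← Nat.sum_antidiagonal_swap, Nat.sum_antidiagonal_eq_sum_range_succ_mk,
    sum_range_succ, add_comm]
  simp

/-- `h = μ + L_R g`. -/
theorem homologicalPair_eq {R : ℕ → SmoothVF E M} (hR₀ : ∀ m, R 0 m = generator E m)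
    (h : ℕ → SmoothFn E M) (n : ℕ) :
    h n = (homologicalPair h R n).2
      + cauchy (lieAct _ _) R (fun n => (homologicalPair h R n).1) n := by
  rw [cauchy_lie_eq, homologicalPair_fst h R n, homologicalPair_snd, lie_hom hR₀, map_add, avg_hom]
  abel

/-- The function `μ` is invariant under `L_R`: the first nonvanishing coefficient of `L_R μ` would be
both an average and in the image of `L_{R₀}`. -/
theorem cauchy_homologicalPair_snd {R : ℕ → SmoothVF E M} (hR₀ : ∀ m, R 0 m = generator E m)
    {W : ℕ → SmoothVF E M} (hW : W 0 = 0) (hR : ∀ n, R n = transCoeff W n (R 0))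
    (h : ℕ → SmoothFn E M) (n : ℕ) :
    cauchy (lieAct _ _) R (fun n => (homologicalPair h R n).2) n = 0 := by
  induction n using Nat.strong_induction_on with
  | _ n ih =>
    obtain ⟨v, hv⟩ := exists_lie_eq_of_leading hW hR (fun n => (homologicalPair h R n).2) n ih
    have h1 : cauchy (lieAct _ _) R (fun n => (homologicalPair h R n).2) n
        = avg E M (∑ k ∈ range n, ⁅R (n - k), (homologicalPair h R k).2⁆) := by
      rw [cauchy_lie_eq, homologicalPair_snd h R n, lie_sub, lie_avg hR₀, lie_hom hR₀]
      abel
    have h2 : avg E M (cauchy (lieAct _ _) R (fun n => (homologicalPair h R n).2) n) = 0 := by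
      rw [hv, avg_lie hR₀]
    rw [h1, avg_avg] at h2
    rw [h1, h2]

/-- The solution of the homological equation inherits homogeneity in the parameter from its data; this
is what makes the coefficients `gₙ` admissible in Borel's lemma. -/
theorem homologicalPair_smul {h h' : ℕ → SmoothFn E M} {R R' : ℕ → SmoothVF E M} {s : ℝ}
    (hh : ∀ n, h' n = s ^ n • h n) (hR : ∀ n, R' n = s ^ n • R n) (n : ℕ) :
    homologicalPair h' R' n = s ^ n • homologicalPair h R n := by
  induction n using Nat.strong_induction_on with
  | _ n ih =>
    have e1 : ∑ k ∈ range n, ⁅R' (n - k), (homologicalPair h' R' k).1⁆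
        = s ^ n • ∑ k ∈ range n, ⁅R (n - k), (homologicalPair h R k).1⁆ := by
      rw [smul_sum]
      refine sum_congr rfl fun k hk => ?_
      have hk := Finset.mem_range.1 hk
      rw [ih k hk, hR, smul_lie, Prod.smul_fst, lie_smul, smul_smul, ← pow_add,
        Nat.sub_add_cancel hk.le]
    have e2 : ∑ k ∈ range n, ⁅R' (n - k), (homologicalPair h' R' k).2⁆
        = s ^ n • ∑ k ∈ range n, ⁅R (n - k), (homologicalPair h R k).2⁆ := by
      rw [smul_sum]
      refine sum_congr rfl fun k hk => ?_
      have hk := Finset.mem_range.1 hk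
      rw [ih k hk, hR, smul_lie, Prod.smul_snd, lie_smul, smul_smul, ← pow_add,
        Nat.sub_add_cancel hk.le]
    refine Prod.ext ?_ ?_
    · rw [homologicalPair_fst, e1, e2, hh, ← smul_sub, map_smul, ← smul_add, map_smul, Prod.smul_fst,
        homologicalPair_fst]
    · rw [homologicalPair_snd, e1, e2, hh, ← smul_sub, map_smul, map_smul, ← smul_sub,
        Prod.smul_snd, homologicalPair_snd]

theorem JointlySmooth.orbitInt {w : ℝ → ℝ} (hw : ContDiff ℝ ∞ w) {f : Γ → SmoothFn E M}
    (hf : JointlySmooth E (fun γ => f γ)) :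
    JointlySmooth E (fun γ => NearlyPeriodic.orbitInt w hw (f γ)) := by
  refine contMDiff_intervalIntegral (I := 𝓘(ℝ, E).prod 𝓘(ℝ, Γ))
    (h := fun (p : M × Γ) s => w s * f p.2 (NearlyPeriodic.rot s p.1)) ?_ _ _
  refine ContMDiff.mul (hw.contMDiff.comp contMDiff_snd) ?_
  refine ContMDiff.comp (g := fun p : M × Γ => f p.2 p.1)
    (f := fun q : (M × Γ) × ℝ => (NearlyPeriodic.rot q.2 q.1.1, q.1.2)) hf ?_
  refine ContMDiff.prodMk ?_ (contMDiff_snd.comp contMDiff_fst)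
  exact ContMDiff.comp (g := fun p : M × ℝ => NearlyPeriodic.rot p.2 p.1)
    (f := fun q : (M × Γ) × ℝ => (q.1.1, q.2)) (contMDiff_rot E)
    ((contMDiff_fst.comp contMDiff_fst).prodMk contMDiff_snd)

theorem JointlySmooth.avg {f : Γ → SmoothFn E M} (hf : JointlySmooth E (fun γ => f γ)) :
    JointlySmooth E (fun γ => NearlyPeriodic.avg E M (f γ)) := hf.orbitInt contDiff_weight₀

theorem JointlySmooth.hom {f : Γ → SmoothFn E M} (hf : JointlySmooth E (fun γ => f γ)) :
    JointlySmooth E (fun γ => NearlyPeriodic.hom E M (f γ)) :=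
  (hf.orbitInt contDiff_weight₁).sub
    (JointlySmooth.avg (f := fun γ => NearlyPeriodic.orbitInt weight₁ contDiff_weight₁ (f γ))
      (hf.orbitInt contDiff_weight₁))

variable [FiniteDimensional ℝ Γ]

theorem jointlySmooth_homologicalPair {h : ℕ → Γ → SmoothFn E M}
    (hh : ∀ n, JointlySmooth E (fun γ => h n γ)) (R : FormalSeries Γ (SmoothVF E M)) (n : ℕ) :
    JointlySmooth E (fun γ => (homologicalPair (fun n => h n γ) (fun n => R.term n γ) n).1) ∧
    JointlySmooth E (fun γ => (homologicalPair (fun n => h n γ) (fun n => R.term n γ) n).2) := by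
  induction n using Nat.strong_induction_on with
  | _ n ih =>
    have e1 : JointlySmooth E (fun γ => (∑ k ∈ range n, ⁅R.term (n - k) γ,
        (homologicalPair (fun n => h n γ) (fun n => R.term n γ) k).1⁆ : SmoothFn E M)) := by
      simp only [JointlySmooth, SmoothFn.coe_sum]
      exact JointlySmooth.sum fun k hk =>
        R.jointlySmooth_lie_term (n - k) (ih k (Finset.mem_range.1 hk)).1
    have e2 : JointlySmooth E (fun γ => (∑ k ∈ range n, ⁅R.term (n - k) γ,
        (homologicalPair (fun n => h n γ) (fun n => R.term n γ) k).2⁆ : SmoothFn E M)) := by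
      simp only [JointlySmooth, SmoothFn.coe_sum]
      exact JointlySmooth.sum fun k hk =>
        R.jointlySmooth_lie_term (n - k) (ih k (Finset.mem_range.1 hk)).2
    have e3 := (hh n).sub e1
    constructor
    · simp only [homologicalPair_fst _ _ n]
      refine JointlySmooth.hom (f := fun γ => h n γ - ∑ k ∈ range n, ⁅R.term (n - k) γ,
        (homologicalPair (fun n => h n γ) (fun n => R.term n γ) k).1⁆
        + NearlyPeriodic.hom E M (∑ k ∈ range n, ⁅R.term (n - k) γ,
        (homologicalPair (fun n => h n γ) (fun n => R.term n γ) k).2⁆)) ?_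
      exact e3.add (JointlySmooth.hom (f := fun γ => ∑ k ∈ range n, ⁅R.term (n - k) γ,
        (homologicalPair (fun n => h n γ) (fun n => R.term n γ) k).2⁆) e2)
    · simp only [homologicalPair_snd _ _ n]
      exact (JointlySmooth.avg (f := fun γ => h n γ - ∑ k ∈ range n, ⁅R.term (n - k) γ,
        (homologicalPair (fun n => h n γ) (fun n => R.term n γ) k).1⁆) e3).sub
        (JointlySmooth.hom (f := fun γ => ∑ k ∈ range n, ⁅R.term (n - k) γ,
        (homologicalPair (fun n => h n γ) (fun n => R.term n γ) k).2⁆) e2)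

/-- A primitive can be changed by an exact form in such a way that its contraction with `R` becomes
invariant under `L_R` in the sense of formal power series. -/
theorem exists_normalizing_function [SecondCountableTopology M] {ϑ : Γ → OneForm E M}
    (hϑ : SmoothOneFormFamily ϑ) {R : FormalSeries Γ (SmoothVF E M)}
    (hR₀ : ∀ γ m, R.term 0 γ m = generator E m)
    (hR : ∀ γ, ∃ W : ℕ → SmoothVF E M, W 0 = 0 ∧ ∀ n, R.term n γ = transCoeff W n (R.term 0 γ)) :
    ∃ g : Γ → M → ℝ, JointlySmooth E g ∧ ∀ γ, ∃ μ : ℕ → SmoothFn E M,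
      (∀ n, cauchy (lieAct _ _) (fun n => R.term n γ) μ n = 0) ∧
      ∀ N, HasTaylorUpTo N (fun t m => (ϑ (t • γ) m - mvfderiv 𝓘(ℝ, E) (g (t • γ)) m)
        (lineSum (fun n => R.term n γ) N t m)) μ := by
  have hf : ∀ n, JointlySmooth E (fun γ m => ϑ γ m (R.partialSum n γ m)) := fun n => by
    have h1 : JointlySmooth E (fun γ m => ∑ k ∈ range (n + 1), ϑ γ m (R.term k γ m)) :=
      JointlySmooth.sum fun k _ => hϑ.apply (R.smoothVFFamily_term k)
    refine ContMDiff.congr h1 fun p => ?_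
    have h2 : R.partialSum n p.2 p.1 = ∑ k ∈ range (n + 1), R.term k p.2 p.1 := SmoothVF.coe_sum _ _ _
    beta_reduce
    rw [h2, map_sum]
  choose c hc hchom hcT using fun n => (hf n).exists_hasTaylor_lines
  have hb := fun γ => exists_taylorForm (β := fun t : ℝ => ϑ (t • γ))
    fun Y => (hϑ.comp_line γ).apply (smoothVFFamily_const Y)
  choose b hbT _ using hb
  have hcc : ∀ N γ n, n ≤ N → c N n γ = cauchy LinearMap.id (b γ) (fun n => R.term n γ) n := by
    intro N γ n hn
    have h1 := hasTaylorUpTo_apply_lineSum (hbT γ) (fun n => R.term n γ) N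
    have h2 := (hcT N γ).upTo N
    simp only [FormalSeries.partialSum_line] at h2
    exact h2.coeff_eq h1 n hn
  -- The coefficients of `g` solve the homological equation `ϑ(R) = μ + L_R g`.
  obtain ⟨g, hg, hgT⟩ := exists_borel_family
    (g := fun n γ => (homologicalPair (fun n => c n n γ) (fun n => R.term n γ) n).1)
    (fun n => (jointlySmooth_homologicalPair (h := fun n γ => c n n γ) (fun n => hc n n) R n).1)
    (fun n s γ => by
      rw [homologicalPair_smul (fun n => hchom n n s γ) (fun n => R.term_smul n s γ)]
      rfl)
  refine ⟨g, hg, fun γ => ⟨fun n =>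
    (homologicalPair (fun n => c n n γ) (fun n => R.term n γ) n).2, fun n => ?_, fun N => ?_⟩⟩
  · obtain ⟨W, hW, hRW⟩ := hR γ
    exact cauchy_homologicalPair_snd (hR₀ γ) hW hRW _ n
  · have h1 := (hasTaylorUpTo_apply_lineSum (hbT γ) (fun n => R.term n γ) N).sub
      (((hgT γ).upTo N).lie_lineSum (fun n => R.term n γ))
    refine (h1.congr_coeff fun n hn => ?_).congr fun t m => rfl
    rw [← hcc n γ n le_rfl, homologicalPair_eq (R := fun n => R.term n γ) (hR₀ γ) (fun n => c n n γ) n]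
    abel

end Homological
end NearlyPeriodic

/-! ### Rotation-invariant forms -/

namespace NearlyPeriodic
open MeasureTheory Set

variable {E : Type*} [NormedAddCommGroup E] [NormedSpace ℝ E] [FiniteDimensional ℝ E]
  {M : Type*} [TopologicalSpace M] [ChartedSpace E M] [IsManifold 𝓘(ℝ, E) ∞ M] [T2Space M]

section Tensorial

/-- A linear map from vector fields to functions is a `1`-form if it is linear over the functions. -/
def Tensorial (β : SmoothVF E M →ₗ[ℝ] SmoothFn E M) : Prop :=
  ∀ f Y, β (fmul f Y) = f * β Y

/-- The components of a `1`-form with respect to a local frame. -/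
theorem Tensorial.eventually_eq_sum {ι : Type*} [Fintype ι] {p : M} {x : ι → SmoothFn E M}
    {e : ι → SmoothVF E M} (he : ∀ᶠ m in 𝓝 p, ∀ v : TangentSpace 𝓘(ℝ, E) m,
      v = ∑ i, mvfderiv 𝓘(ℝ, E) (x i) m v • e i m) :
    ∀ᶠ q in 𝓝 p, ∀ β : SmoothVF E M →ₗ[ℝ] SmoothFn E M, Tensorial β → ∀ Z : SmoothVF E M,
      β Z q = ∑ i, ⁅Z, x i⁆ q * β (e i) q := by
  filter_upwards [he.eventually_nhds] with q hq β hβ Z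
  obtain ⟨ψ, hψ, -⟩ := (SmoothBumpFunction.nhds_basis_support (I := 𝓘(ℝ, E)) hq).mem_iff.1
    Filter.univ_mem
  let ψ' : SmoothFn E M := ⟨ψ, ψ.contMDiff⟩
  -- A bump function turns the local decomposition of `Z` into a global one.
  have h1 : fmul ψ' Z = ∑ i, fmul (ψ' * ⁅Z, x i⁆) (e i) := by
    ext m
    rw [SmoothVF.coe_sum]
    by_cases hm : m ∈ tsupport ψ
    · have h2 : Z m = ∑ i, ⁅Z, x i⁆ m • e i m := hψ hm (Z m)
      rw [fmul_apply, h2, Finset.smul_sum]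
      refine Finset.sum_congr rfl fun i _ => ?_
      rw [fmul_apply, smul_smul]
      rfl
    · have h2 : ψ' m = 0 := image_eq_zero_of_notMem_tsupport hm
      rw [fmul_apply, h2, zero_smul, Finset.sum_eq_zero]
      intro i _
      rw [fmul_apply]
      change (ψ' m * _) • _ = _
      rw [h2, zero_mul, zero_smul]
  have h3 := congrArg (fun f : SmoothFn E M => f q) (congrArg β h1)
  simp only [map_sum, hβ _ _, SmoothFn.coe_sum] at h3
  have h4 : ψ' q = 1 := ψ.eq_one
  have h5 : ∀ f g : SmoothFn E M, (f * g) q = f q * g q := fun _ _ => rfl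
  simp only [h5, h4, one_mul] at h3
  exact h3

/-- The value of a `1`-form at a point depends on the vector at that point only. -/
theorem Tensorial.apply_eq_zero {β : SmoothVF E M →ₗ[ℝ] SmoothFn E M} (hβ : Tensorial β)
    {Z : SmoothVF E M} {m : M} (hZ : Z m = 0) : β Z m = 0 := by
  obtain ⟨x, e, he⟩ := exists_local_frame (E := E) m
  rw [(Tensorial.eventually_eq_sum he).self_of_nhds β hβ Z]
  refine Finset.sum_eq_zero fun i _ => ?_
  rw [lie_fn_apply, lieFun, hZ, map_zero, zero_mul]

variable (E M) in
/-- The `1`-forms, as a submodule of the linear maps from vector fields to functions. -/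
def tensorialForms : LieSubmodule ℝ (SmoothVF E M) (SmoothVF E M →ₗ[ℝ] SmoothFn E M) where
  carrier := {β | Tensorial β}
  add_mem' h h' f Y := by
    simp only [LinearMap.add_apply, h f Y, h' f Y, mul_add]
  zero_mem' f Y := by simp
  smul_mem' c β h f Y := by
    simp only [LinearMap.smul_apply, h f Y, mul_smul_comm]
  lie_mem {X β} h f Y := by
    simp only [LieHom.lie_apply]
    rw [h f Y, bracket_fmul, map_add, h, h]
    have h1 : ⁅X, f * β Y⁆ = ⁅X, f⁆ * β Y + f * ⁅X, β Y⁆ := lieD_mul X f (β Y)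
    rw [h1, mul_sub]
    rw [lie_eq_lieD]
    abel

/-- A bound for the values of a smooth path of `1`-forms on a small path of tangent vectors. -/
theorem isBigO_oneForm_apply {β : ℝ → OneForm E M}
    (hβ : ∀ Y : SmoothVF E M, JointlySmooth E (fun t m => β t m (Y m))) {m : M}
    {w : ℝ → TangentSpace 𝓘(ℝ, E) m} {N : ℕ}
    (hw : (fun t => tangentCoord (w t)) =O[𝓝 0] fun t => t ^ N) :
    (fun t => β t m (w t)) =O[𝓝 0] fun t => t ^ N := by
  obtain ⟨x, e, he⟩ := exists_local_frame (E := E) m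
  have h1 : ∀ t, β t m (w t) = ∑ i, mvfderiv 𝓘(ℝ, E) (x i) m (w t) * β t m (e i m) := fun t => by
    conv_lhs => rw [he.self_of_nhds (w t)]
    rw [map_sum]
    exact Finset.sum_congr rfl fun i _ => map_smul (β t m) _ _
  refine (Asymptotics.IsBigO.fun_sum (s := Finset.univ) fun i _ => ?_).congr_left fun t => (h1 t).symm
  have h2 : (fun t => mvfderiv 𝓘(ℝ, E) (x i) m (w t)) =O[𝓝 0] fun t => t ^ N := by
    let L : E →L[ℝ] ℝ := mvfderiv 𝓘(ℝ, E) (x i) m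
    exact (L.isBigO_comp (fun t => tangentCoord (w t)) (𝓝 0)).trans hw
  have h3 : (fun t => β t m (e i m)) =O[𝓝 0] fun _ => (1 : ℝ) :=
    ((hβ (e i)).param m).continuous.continuousAt.isBigO_one ℝ
  simpa using h2.mul h3

end Tensorial

section RotationInvariance

/-- A continuous function with two incommensurable periods is constant. -/
theorem eq_of_periodic_of_irrational {j : ℝ → ℝ} (hj : Continuous j) {a b : ℝ}
    (ha : Function.Periodic j a) (hb : Function.Periodic j b) (hab : Irrational (a / b)) (s : ℝ) :
    j s = j 0 := by
  have h1 : ∀ p ∈ AddSubgroup.closure {a, b}, Function.Periodic j p := fun p hp => by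
    induction hp using AddSubgroup.closure_induction with
    | mem x hx =>
      rcases hx with rfl | hx
      · exact ha
      · rw [Set.mem_singleton_iff.1 hx]; exact hb
    | zero => intro x; simp
    | add x y _ _ hx hy => exact hx.add_period hy
    | neg x _ hx => exact hx.neg
  have h2 : IsClosed {s | j s = j 0} := isClosed_eq hj continuous_const
  have h3 := (dense_addSubgroupClosure_pair_iff.2 hab).closure_eq
  have h4 : closure (AddSubgroup.closure {a, b} : Set ℝ) ⊆ {s | j s = j 0} :=
    h2.closure_subset_iff.2 fun p hp => by simpa using h1 p hp 0
  rw [h3] at h4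
  exact h4 (mem_univ s)

/-- If the increments of a periodic function over a fixed step are constant, then they vanish. -/
theorem eq_zero_of_periodic_sub {j : ℝ → ℝ} (hj : Continuous j)
    (hp : Function.Periodic j (2 * Real.pi)) {a c : ℝ} (h : ∀ s, j (s - a) - j s = c) : c = 0 := by
  have h1 : ∫ s in (0 : ℝ)..(2 * Real.pi), (j (s - a) - j s) = 2 * Real.pi * c := by
    simp [h]
  have hj' : Continuous fun s => j (s - a) := hj.comp (continuous_sub_right a)
  rw [intervalIntegral.integral_sub (hj'.intervalIntegrable _ _)
    (hj.intervalIntegrable _ _), intervalIntegral.integral_comp_sub_right j a, zero_sub] at h1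
  have h2 := hp.intervalIntegral_add_eq (-a) 0
  rw [zero_add, show -a + 2 * Real.pi = 2 * Real.pi - a by ring] at h2
  rw [h2, sub_self] at h1
  have := Real.pi_pos
  have h3 : 2 * Real.pi * c = 0 := h1.symm
  simpa [this.ne'] using h3

theorem NonResonant.irrational {θ₀ : ℝ} (h : NonResonant θ₀) : Irrational (θ₀ / (2 * Real.pi)) := by
  rintro ⟨q, hq⟩
  refine h q ?_
  rw [hq, div_mul_cancel₀]
  have := Real.pi_pos
  positivity

variable [MulAction Circle M] [ContMDiffSMul (𝓡 1) 𝓘(ℝ, E) ∞ Circle M]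

theorem Tensorial.jointlySmooth_pullVF {β : SmoothVF E M →ₗ[ℝ] SmoothFn E M} (hβ : Tensorial β)
    (Y : SmoothVF E M) : JointlySmooth E (fun s => β (pullVF s Y)) := by
  intro p
  obtain ⟨x, e, he⟩ := exists_local_frame (E := E) p.1
  have h1 : JointlySmooth E (fun s m => ∑ i, lieFun (pull s Y) (x i) m * β (e i) m) :=
    JointlySmooth.sum fun i _ => (jointlySmooth_lieFun_pull Y (x i)).mul (JointlySmooth.const _)
  refine (h1 p).congr_of_eventuallyEq ?_
  filter_upwards [continuousAt_fst.eventually (Tensorial.eventually_eq_sum he)] with q hq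
  exact hq β hβ (pullVF q.2 Y)

theorem Tensorial.continuous_pullVF_rot {β : SmoothVF E M →ₗ[ℝ] SmoothFn E M} (hβ : Tensorial β)
    (Y : SmoothVF E M) (m : M) : Continuous fun s => β (pullVF s Y) (rot (-s) m) := by
  refine (hβ.jointlySmooth_pullVF Y).continuous.comp (f := fun s : ℝ => (rot (-s) m, s)) ?_
  refine Continuous.prodMk ?_ continuous_id
  exact (contMDiff_rot E).continuous.comp (f := fun s : ℝ => (m, -s)) (by fun_prop)

theorem pullVF_add_two_pi (s : ℝ) (Y : SmoothVF E M) :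
    pullVF (s + 2 * Real.pi) Y = pullVF s Y := by
  rw [← pullVF_pullVF, pullVF_two_pi]

/-- For a rotation-invariant `1`-form, averaging commutes with evaluation. -/
theorem avg_apply_eq {β : SmoothVF E M →ₗ[ℝ] SmoothFn E M} (hβ : Tensorial β)
    (hinv : ∀ (Y : SmoothVF E M) s m, β (pullVF s Y) (rot (-s) m) = β Y m) (Y : SmoothVF E M) :
    avg E M (β Y) = β (avgVF Y) := by
  ext m
  obtain ⟨x, e, he⟩ := exists_local_frame (E := E) m
  have h1 := fun Z => (Tensorial.eventually_eq_sum he).self_of_nhds β hβ Z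
  have h2 : ∀ s, β Y (rot s m) = ∑ i, ⁅pullVF s Y, x i⁆ m * β (e i) m := fun s => by
    rw [← h1, ← hinv Y s (rot s m), rot_neg_rot]
  rw [avg_apply, h1, avgVF]
  simp only [h2, lie_orbitIntVF, Finset.mul_sum, ← mul_assoc]
  have hc : ∀ i, Continuous fun s => weight₀ s * ⁅pullVF s Y, x i⁆ m * β (e i) m := fun i =>
    (contDiff_weight₀.continuous.mul
      ((jointlySmooth_lieFun_pull Y (x i)).param m).continuous).mul continuous_const
  rw [intervalIntegral.integral_finsetSum
    (fun i _ => (hc i).intervalIntegrable _ _)]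
  exact Finset.sum_congr rfl fun i _ => intervalIntegral.integral_mul_const _ _

/-- The average of a square vanishes only if the function does. -/
theorem eq_zero_of_avg_mul_self {f : SmoothFn E M} (h : avg E M (f * f) = 0) : f = 0 := by
  ext m
  by_contra hm
  have h1 : avg E M (f * f) m = 0 := by rw [h]; rfl
  rw [avg_apply] at h1
  have hpi := Real.pi_pos
  have h2 : 0 < ∫ s in (0 : ℝ)..(2 * Real.pi), weight₀ s * (f * f) (rot s m) := by
    refine intervalIntegral.integral_pos (by positivity)
      (contDiff_weight₀.continuous.mul (continuous_rotFn (f * f) m)).continuousOn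
      (fun s _ => mul_nonneg (by simp only [weight₀]; positivity) (mul_self_nonneg (f (rot s m))))
      ⟨0, by constructor <;> positivity, ?_⟩
    have h3 : 0 < f m * f m := mul_self_pos.2 hm
    refine mul_pos (by simp only [weight₀]; positivity) ?_
    rw [rot_zero]
    exact h3
  exact h2.ne' h1

/-- A rotation-invariant `1`-form in the image of `L_{R₀}` vanishes. -/
theorem eq_zero_of_rot_invariant {R₀ : SmoothVF E M} (hR₀ : ∀ m, R₀ m = generator E m)
    {β : SmoothVF E M →ₗ[ℝ] SmoothFn E M} (hβ : Tensorial β)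
    (hinv : ∀ (Y : SmoothVF E M) s m, β (pullVF s Y) (rot (-s) m) = β Y m)
    {η : SmoothVF E M →ₗ[ℝ] SmoothFn E M} (hη : β = ⁅R₀, η⁆) : β = 0 := by
  have h1 : ∀ Y, β (avgVF Y) = 0 := fun Y => by
    have h2 : β (avgVF Y) = ⁅R₀, η (avgVF Y)⁆ := by
      rw [hη, LieHom.lie_apply, lie_avgVF hR₀, map_zero, sub_zero]
    have h3 : avg E M (β (avgVF Y)) = β (avgVF Y) := by
      ext m
      refine avg_of_rot_eq fun s => ?_
      have h4 := hinv (avgVF Y) (-s) m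
      rw [pullVF_avgVF, neg_neg] at h4
      exact h4
    rw [← h3, h2, avg_lie hR₀]
  -- `avg ((β Y)²) = avg (β (β(Y) Y)) = β (avgVF (β(Y) Y)) = 0`
  ext1 Y
  refine eq_zero_of_avg_mul_self ?_
  rw [← hβ (β Y) Y, avg_apply_eq hβ hinv, h1]

end RotationInvariance
end NearlyPeriodic

/-! ### A normalized primitive along a line -/

namespace NearlyPeriodic
open MeasureTheory Set

variable {E : Type*} [NormedAddCommGroup E] [NormedSpace ℝ E] [FiniteDimensional ℝ E]
  {M : Type*} [TopologicalSpace M] [ChartedSpace E M] [IsManifold 𝓘(ℝ, E) ∞ M] [T2Space M]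

section PullbackForm
variable {P : Type*} [NormedAddCommGroup P] [NormedSpace ℝ P]

/-- The pullback `F_t^*θ_t` of a family of `1`-forms. -/
def pullForm (F : P → M → M) (θ : P → OneForm E M) (t : P) : OneForm E M := fun m =>
  (θ t (F t m)).comp (mfderiv 𝓘(ℝ, E) 𝓘(ℝ, E) (F t) m)

theorem pullForm_apply (F : P → M → M) (θ : P → OneForm E M) (t : P) (m : M)
    (v : TangentSpace 𝓘(ℝ, E) m) :
    pullForm F θ t m v = θ t (F t m) (mfderiv 𝓘(ℝ, E) 𝓘(ℝ, E) (F t) m v) := rfl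

variable {F : P → M → M}
  (hF : ContMDiff (𝓘(ℝ, E).prod 𝓘(ℝ, P)) 𝓘(ℝ, E) ∞ (fun p : M × P => F p.2 p.1))
include hF

theorem JointlySmooth.comp_map {f : P → M → ℝ} (hf : JointlySmooth E f) :
    JointlySmooth E (fun t m => f t (F t m)) :=
  ContMDiff.comp (g := fun p : M × P => f p.2 p.1) (f := fun p : M × P => (F p.2 p.1, p.2)) hf
    (hF.prodMk contMDiff_snd)

/-- The image of a smooth family of vector fields under the tangent maps of a smooth family of maps. -/
theorem contMDiff_mfderiv_apply {X : P → VF E M} (hX : SmoothVFFamily X) :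
    ContMDiff (𝓘(ℝ, E).prod 𝓘(ℝ, P)) (𝓘(ℝ, E).prod 𝓘(ℝ, E)) ∞
    (fun p : M × P => Bundle.TotalSpace.mk' E (E := (TangentSpace 𝓘(ℝ, E) : M → Type _))
      (F p.2 p.1) (mfderiv 𝓘(ℝ, E) 𝓘(ℝ, E) (F p.2) p.1 (X p.2 p.1))) := by
  have h1 := hF.contMDiff_tangentMap (m := ∞) (by simp)
  have h0 : ContMDiff (𝓘(ℝ, E).prod 𝓘(ℝ, P)) (𝓘(ℝ, P).prod 𝓘(ℝ, P)) ∞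
      (fun p : M × P => (Bundle.TotalSpace.mk' P (E := (TangentSpace 𝓘(ℝ, P) : P → Type _)) p.2 0)) :=
    (Bundle.contMDiff_zeroSection ℝ (TangentSpace 𝓘(ℝ, P) : P → Type _)).comp contMDiff_snd
  have h2 := (contMDiff_equivTangentBundleProd_symm (I := 𝓘(ℝ, E)) (M := M) (I' := 𝓘(ℝ, P))
    (M' := P) (n := ∞)).comp (hX.prodMk h0)
  refine (h1.comp h2).congr fun p => ?_
  have hd : MDifferentiableAt (𝓘(ℝ, E).prod 𝓘(ℝ, P)) 𝓘(ℝ, E) (fun p : M × P => F p.2 p.1)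
      (p.1, p.2) := (hF (p.1, p.2)).mdifferentiableAt (by simp)
  have h4 : HasMFDerivAt 𝓘(ℝ, E) (𝓘(ℝ, E).prod 𝓘(ℝ, P)) (fun m : M => (m, p.2)) p.1
      ((ContinuousLinearMap.id ℝ (TangentSpace 𝓘(ℝ, E) p.1)).prod 0) :=
    (hasMFDerivAt_id p.1).prodMk (hasMFDerivAt_const p.2 p.1)
  have h5 := (hd.hasMFDerivAt.comp p.1 h4).mfderiv
  exact congrArg (fun L : E →L[ℝ] E => Bundle.TotalSpace.mk' E
    (E := (TangentSpace 𝓘(ℝ, E) : M → Type _)) (F p.2 p.1) (L (X p.2 p.1))) h5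

theorem SmoothOneFormFamily.pullForm_apply {θ : P → OneForm E M} (hθ : SmoothOneFormFamily θ)
    {X : P → VF E M} (hX : SmoothVFFamily X) :
    JointlySmooth E (fun t m => pullForm F θ t m (X t m)) := by
  have hθ' : ContMDiff (𝓘(ℝ, E).prod 𝓘(ℝ, P)) (𝓘(ℝ, E).prod 𝓘(ℝ, E →L[ℝ] ℝ)) ∞
      (fun p : M × P => Bundle.TotalSpace.mk' (E →L[ℝ] ℝ)
        (E := fun m : M => TangentSpace 𝓘(ℝ, E) m →L[ℝ] ℝ) (F p.2 p.1) (θ p.2 (F p.2 p.1))) :=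
    ContMDiff.comp (g := fun p : M × P => Bundle.TotalSpace.mk' (E →L[ℝ] ℝ)
        (E := fun m : M => TangentSpace 𝓘(ℝ, E) m →L[ℝ] ℝ) p.1 (θ p.2 p.1))
      (f := fun p : M × P => (F p.2 p.1, p.2)) hθ (hF.prodMk contMDiff_snd)
  have h := ContMDiff.clm_bundle_apply (IM := 𝓘(ℝ, E).prod 𝓘(ℝ, P)) (IB := 𝓘(ℝ, E)) (n := ∞)
    (F₁ := E) (F₂ := ℝ) (E₁ := (TangentSpace 𝓘(ℝ, E) : M → Type _)) (E₂ := Bundle.Trivial M ℝ)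
    (b := fun p : M × P => F p.2 p.1) (ϕ := fun p => θ p.2 (F p.2 p.1))
    (v := fun p => mfderiv 𝓘(ℝ, E) 𝓘(ℝ, E) (F p.2) p.1 (X p.2 p.1)) hθ'
    (contMDiff_mfderiv_apply hF hX)
  intro p
  exact ((Bundle.contMDiffAt_totalSpace).1 (h p)).2

end PullbackForm

theorem IsNearlyPeriodicMap.coe_diffeo [MulAction Circle M] {P : Type*} [NormedAddCommGroup P]
    [NormedSpace ℝ P] {F : P → M → M} {θ₀ : ℝ} (hF : IsNearlyPeriodicMap (E := E) F θ₀) (t : P) :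
    ∃ e : M ≃ₘ^∞⟮𝓘(ℝ, E), 𝓘(ℝ, E)⟯ M, (e : M → M) = F t := by
  obtain ⟨e, he⟩ := hF.diffeo t
  exact ⟨e, funext he⟩

variable [MulAction Circle M] [ContMDiffSMul (𝓡 1) 𝓘(ℝ, E) ∞ Circle M]

section Line
open Asymptotics Filter

/-- A family with vanishing Taylor coefficients up to degree `N` is divisible by `tᴺ⁺¹`, with a smooth
quotient. -/
theorem HasTaylorUpTo.exists_factor {N : ℕ} {f : ℝ → M → ℝ} {c : ℕ → SmoothFn E M}
    (h : HasTaylorUpTo N f c) (hc : ∀ n ≤ N, c n = 0) :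
    ∃ r : ℝ → M → ℝ, JointlySmooth E r ∧ ∀ t m, f t m = t ^ (N + 1) * r t m := by
  obtain ⟨c', hc', hcc⟩ := h.exists_hasTaylor
  obtain ⟨r, hr, hT⟩ := hc' (N + 1)
  refine ⟨r, hr, fun t m => ?_⟩
  rw [hT, Finset.sum_eq_zero, zero_add]
  intro i hi
  have hi := Finset.mem_range.1 hi
  rw [hcc i (by omega), hc i (by omega)]
  exact mul_zero _

/-- A family of order `N` is divisible by `tᴺ`; the smooth quotient restricts to the leading coefficient
at `t = 0`. -/
theorem HasTaylorUpTo.exists_factor_leading {N : ℕ} {f : ℝ → M → ℝ} {c : ℕ → SmoothFn E M}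
    (h : HasTaylorUpTo N f c) (hc : ∀ n < N, c n = 0) :
    ∃ r : ℝ → M → ℝ, JointlySmooth E r ∧ (∀ t m, f t m = t ^ N * r t m) ∧ ∀ m, r 0 m = c N m := by
  obtain ⟨c', hc', hcc⟩ := h.exists_hasTaylor
  obtain ⟨r, hr, hT⟩ := hc' (N + 1)
  refine ⟨fun t m => c N m + t * r t m, (JointlySmooth.const (c N)).add
    ((JointlySmooth.of_param contDiff_id).mul hr), fun t m => ?_, fun m => by simp⟩
  rw [hT, Finset.sum_range_succ, Finset.sum_eq_zero, hcc N le_rfl]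
  · ring
  intro i hi
  have hi := Finset.mem_range.1 hi
  rw [hcc i (by omega), hc i (by omega)]
  exact mul_zero _

theorem eq_zero_of_pow_mul_isBigO {S : ℝ → ℝ} (hS : ContinuousAt S 0) {n : ℕ}
    (h : (fun t : ℝ => t ^ n * S t) =O[𝓝 0] fun t => t ^ (n + 1)) : S 0 = 0 := by
  have h1 : S =O[𝓝[≠] 0] fun t => t := by
    have h2 := (isBigO_refl (fun t : ℝ => (t ^ n)⁻¹) (𝓝[≠] 0)).mul (h.mono nhdsWithin_le_nhds)
    refine h2.congr' ?_ ?_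
    · filter_upwards [self_mem_nhdsWithin] with t ht
      have ht : t ≠ 0 := ht
      field_simp
    · filter_upwards [self_mem_nhdsWithin] with t ht
      have ht : t ≠ 0 := ht
      rw [pow_succ, ← mul_assoc, inv_mul_cancel₀ (pow_ne_zero _ ht), one_mul]
  have h3 : Tendsto S (𝓝[≠] 0) (𝓝 (S 0)) := hS.mono_left nhdsWithin_le_nhds
  have h4 : Tendsto (fun t : ℝ => t) (𝓝[≠] 0) (𝓝 0) :=
    (continuous_id.tendsto (0 : ℝ)).mono_left nhdsWithin_le_nhds
  exact tendsto_nhds_unique h3 (h1.trans_tendsto h4)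

/-- A nearly periodic map along a line in the parameter space, together with a primitive `θ` of the
presymplectic form whose contraction with `R` is invariant under `L_R`. -/
structure IsNormalizedLine (F : ℝ → M → M) (θ₀ : ℝ) (θ : ℝ → OneForm E M) (Ω : ℝ → BilinForm E M)
    (R : ℕ → SmoothVF E M) : Prop where
  map : IsNearlyPeriodicMap (E := E) F θ₀
  smooth : SmoothOneFormFamily θ
  smooth₂ : SmoothBilinFormFamily Ω
  primitive : ∀ (t : ℝ) (X Y : SmoothVF E M) (m : M), Ω t m (X m) (Y m) = -dOneForm (θ t) X Y m
  preserves : PreservesForm F Ω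
  generator : ∀ m, R 0 m = generator E m
  conj : ∃ W : ℕ → SmoothVF E M, W 0 = 0 ∧ ∀ n, R n = transCoeff W n (R 0)
  invariant : ∀ N m, (fun t =>
    tangentCoord (VectorField.mpullback 𝓘(ℝ, E) 𝓘(ℝ, E) (F t) (lineSum R N t) m)
      - tangentCoord (lineSum R N t m)) =O[𝓝 0] fun t => t ^ (N + 1)
  moment : ∃ μ : ℕ → SmoothFn E M, (∀ n, cauchy (lieAct _ _) R μ n = 0) ∧
    ∀ N, HasTaylorUpTo N (fun t m => θ t m (lineSum R N t m)) μ

/-- The truncated moment `θ_t(R^N_t)`. -/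
def lineMoment (θ : ℝ → OneForm E M) (R : ℕ → SmoothVF E M) (N : ℕ) (t : ℝ) (m : M) : ℝ :=
  θ t m (lineSum R N t m)

/-- The `1`-form `dμ - ι_R Ω`, which equals `L_R θ`. -/
def lineDefect (θ : ℝ → OneForm E M) (Ω : ℝ → BilinForm E M) (R : ℕ → SmoothVF E M) (N : ℕ) (t : ℝ) :
    OneForm E M := fun m =>
  (mvfderiv 𝓘(ℝ, E) (lineMoment θ R N t) m : TangentSpace 𝓘(ℝ, E) m →L[ℝ] ℝ)
    - Ω t m (lineSum R N t m)

theorem lineDefect_apply (θ : ℝ → OneForm E M) (Ω : ℝ → BilinForm E M) (R : ℕ → SmoothVF E M) (N : ℕ)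
    (t : ℝ) (m : M) (v : TangentSpace 𝓘(ℝ, E) m) :
    lineDefect θ Ω R N t m v = mvfderiv 𝓘(ℝ, E) (lineMoment θ R N t) m v
      - Ω t m (lineSum R N t m) v := rfl

namespace IsNormalizedLine
variable {F : ℝ → M → M} {θ₀ : ℝ} {θ : ℝ → OneForm E M} {Ω : ℝ → BilinForm E M}
  {R : ℕ → SmoothVF E M} (h : IsNormalizedLine F θ₀ θ Ω R)
include h

theorem map_zero (m : M) : F 0 m = rot θ₀ m := h.map.zero m

theorem jointlySmooth_apply (Y : SmoothVF E M) : JointlySmooth E (fun t m => θ t m (Y m)) :=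
  h.smooth.apply (smoothVFFamily_const Y)

theorem jointlySmooth_kappa (Y : SmoothVF E M) :
    JointlySmooth E (fun t m => (pullForm F θ t m - θ t m : TangentSpace 𝓘(ℝ, E) m →L[ℝ] ℝ) (Y m)) :=
  (h.smooth.pullForm_apply h.map.smooth (smoothVFFamily_const Y)).sub (h.jointlySmooth_apply Y)

theorem jointlySmooth_lineMoment (N : ℕ) : JointlySmooth E (lineMoment θ R N) := by
  obtain ⟨μ, -, hμ⟩ := h.moment
  exact (hμ N).smooth

theorem mfderiv_mpullback (X : VF E M) (t : ℝ) (m : M) :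
    mfderiv 𝓘(ℝ, E) 𝓘(ℝ, E) (F t) m (VectorField.mpullback 𝓘(ℝ, E) 𝓘(ℝ, E) (F t) X m)
      = X (F t m) := by
  obtain ⟨e, he⟩ := h.map.coe_diffeo t
  have := NearlyPeriodic.mfderiv_mpullback e X m
  rw [he] at this
  exact this

/-- The series `ν = κ(R)`, where `κ = F^*θ - θ`, is the Taylor series of `F^*μ - μ`. -/
theorem hasTaylorUpTo_nu {k : ℕ → SmoothVF E M →ₗ[ℝ] SmoothFn E M}
    (hk : ∀ Y : SmoothVF E M, HasTaylor (fun t m =>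
      (pullForm F θ t m - θ t m : TangentSpace 𝓘(ℝ, E) m →L[ℝ] ℝ) (Y m)) (fun n => k n Y)) (N : ℕ) :
    HasTaylorUpTo N (fun t m => lineMoment θ R N t (F t m) - lineMoment θ R N t m)
      (cauchy LinearMap.id k R) := by
  refine (hasTaylorUpTo_apply_lineSum (β := fun t m => pullForm F θ t m - θ t m) hk R N).congr_isBigO
    (((h.jointlySmooth_lineMoment N).comp_map h.map.smooth).sub (h.jointlySmooth_lineMoment N))
    fun m => ?_
  refine (isBigO_oneForm_apply (β := pullForm F θ) (fun Y =>
    h.smooth.pullForm_apply h.map.smooth (smoothVFFamily_const Y))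
    (w := fun t => VectorField.mpullback 𝓘(ℝ, E) 𝓘(ℝ, E) (F t) (lineSum R N t) m
      - lineSum R N t m) (h.invariant N m)).congr_left fun t => ?_
  rw [map_sub, pullForm_apply, h.mfderiv_mpullback]
  simp only [lineMoment, sub_apply]
  ring

/-- The series `ν` satisfies `L_R ν = 0`, since both `L_R μ = 0` and `F^*R = R`. -/
theorem cauchy_lie_nu {k : ℕ → SmoothVF E M →ₗ[ℝ] SmoothFn E M}
    (hk : ∀ Y : SmoothVF E M, HasTaylor (fun t m =>
      (pullForm F θ t m - θ t m : TangentSpace 𝓘(ℝ, E) m →L[ℝ] ℝ) (Y m)) (fun n => k n Y)) (n : ℕ) :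
    cauchy (lieAct _ _) R (cauchy LinearMap.id k R) n = (0 : SmoothFn E M) := by
  obtain ⟨μ, hμ0, hμ⟩ := h.moment
  ext m
  have hT := (h.hasTaylorUpTo_nu hk n).lie_lineSum R
  refine (hT.isBigO_iff m).1 ?_ n le_rfl
  have h1 := (hμ n).lie_lineSum R
  obtain ⟨r, hr, hfac⟩ := h1.exists_factor (fun n _ => hμ0 n)
  have hcomp := (h.jointlySmooth_lineMoment n).comp_map h.map.smooth
  have h2 : (fun t => lieFun (lineSum R n t) (lineMoment θ R n t) (F t m))
      =O[𝓝 0] fun t => t ^ (n + 1) := by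
    refine (isBigO_pow_mul (N := n + 1) ((hr.comp_map h.map.smooth).param m).continuous).congr_left
      fun t => (hfac t (F t m)).symm
  have h3 : (fun t => lieFun (lineSum R n t) (lineMoment θ R n t) m)
      =O[𝓝 0] fun t => t ^ (n + 1) := by
    refine (isBigO_pow_mul (N := n + 1) (hr.param m).continuous).congr_left
      fun t => (hfac t m).symm
  have h4 := isBigO_oneForm_apply (β := fun t m => (mvfderiv 𝓘(ℝ, E)
      (fun m => lineMoment θ R n t (F t m)) m : TangentSpace 𝓘(ℝ, E) m →L[ℝ] ℝ))
    (fun Y => hcomp.lie Y)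
    (w := fun t => VectorField.mpullback 𝓘(ℝ, E) 𝓘(ℝ, E) (F t) (lineSum R n t) m
      - lineSum R n t m) (h.invariant n m)
  refine ((h2.sub h4).sub h3).congr_left fun t => ?_
  have h7 : lieFun (lineSum R n t) (fun m => lineMoment θ R n t (F t m) - lineMoment θ R n t m) m
      = lieFun (lineSum R n t) (fun m => lineMoment θ R n t (F t m)) m
        - lieFun (lineSum R n t) (lineMoment θ R n t) m :=
    lieFun_sub (f := fun m => lineMoment θ R n t (F t m)) (g := lineMoment θ R n t) _
      (hcomp.mdiff t m) ((h.jointlySmooth_lineMoment n).mdiff t m)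
  rw [h7, map_sub]
  obtain ⟨e, he⟩ := h.map.coe_diffeo t
  have h5 := mvfderiv_comp_mpullback e (lineSum R n t) (m := m)
    ((h.jointlySmooth_lineMoment n).mdiff t (e m))
  rw [he] at h5
  have h6 : mvfderiv 𝓘(ℝ, E) (fun m => lineMoment θ R n t (F t m)) m
      (VectorField.mpullback 𝓘(ℝ, E) 𝓘(ℝ, E) (F t) (lineSum R n t) m)
      = lieFun (lineSum R n t) (lineMoment θ R n t) (F t m) := h5
  rw [h6]
  simp only [lieFun]
  ring

/-- The coefficients of `dμ - ι_R Ω` are those of `L_R θ`, where `Ω = -dθ`. -/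
theorem hasTaylorUpTo_lineDefect {b : ℕ → SmoothVF E M →ₗ[ℝ] SmoothFn E M}
    (hb : ∀ Y : SmoothVF E M, HasTaylor (fun t m => θ t m (Y m)) (fun n => b n Y)) (N : ℕ)
    (Y : SmoothVF E M) : HasTaylorUpTo N (fun t m => lineDefect θ Ω R N t m (Y m))
      (fun n => cauchy (lieAct _ _) R b n Y) := by
  refine (hasTaylorUpTo_lieOneForm hb R N Y).congr fun t m => ?_
  rw [lineDefect_apply, h.primitive t (lineSum R N t) Y m, dOneForm, lieOneForm]
  change lieFun Y (lineMoment θ R N t) m - -(_ - lieFun Y (lineMoment θ R N t) m - _) = _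
  ring

/-- The identity `d(F^*μ - μ) = F^*δ - δ`, where `δ = dμ - ι_R Ω`, up to terms of higher order. It holds
because `F` preserves both `Ω` and `R`. -/
theorem lie_nu_isBigO (N : ℕ) (Y : SmoothVF E M) (m : M) :
    (fun t => lieFun Y (fun m => lineMoment θ R N t (F t m) - lineMoment θ R N t m) m
      - (lineDefect θ Ω R N t (F t m) (mfderiv 𝓘(ℝ, E) 𝓘(ℝ, E) (F t) m (Y m))
        - lineDefect θ Ω R N t m (Y m))) =O[𝓝 0] fun t => t ^ (N + 1) := by
  have hμ := h.jointlySmooth_lineMoment N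
  have hcomp := hμ.comp_map h.map.smooth
  -- The transposed form `v ↦ Ω(v, Y)`, to be evaluated on `F^*R - R`.
  let flip (B : E →L[ℝ] E →L[ℝ] ℝ) (v : E) : E →L[ℝ] ℝ := B.flip v
  have h1 := isBigO_oneForm_apply (β := fun t m => flip (Ω t m) (Y m))
    (fun Z => h.smooth₂.apply (smoothVFFamily_const Z) (smoothVFFamily_const Y))
    (w := fun t => VectorField.mpullback 𝓘(ℝ, E) 𝓘(ℝ, E) (F t) (lineSum R N t) m
      - lineSum R N t m) (h.invariant N m)
  refine h1.congr_left fun t => ?_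
  have h7 : lieFun Y (fun m => lineMoment θ R N t (F t m) - lineMoment θ R N t m) m
      = lieFun Y (fun m => lineMoment θ R N t (F t m)) m - lieFun Y (lineMoment θ R N t) m :=
    lieFun_sub (f := fun m => lineMoment θ R N t (F t m)) (g := lineMoment θ R N t) _
      (hcomp.mdiff t m) (hμ.mdiff t m)
  refine (map_sub (flip (Ω t m) (Y m)) _ _).trans ?_
  rw [h7, lineDefect_apply, lineDefect_apply]
  have h2 := h.preserves t m
    (VectorField.mpullback 𝓘(ℝ, E) 𝓘(ℝ, E) (F t) (lineSum R N t) m) (Y m)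
  rw [h.mfderiv_mpullback] at h2
  have hFd : MDifferentiableAt 𝓘(ℝ, E) 𝓘(ℝ, E) (F t) m := by
    obtain ⟨e, he⟩ := h.map.coe_diffeo t
    rw [← he]
    exact e.contMDiff.mdifferentiableAt (by simp)
  have h3 : lieFun Y (fun m => lineMoment θ R N t (F t m)) m
      = mvfderiv 𝓘(ℝ, E) (lineMoment θ R N t) (F t m) (mfderiv 𝓘(ℝ, E) 𝓘(ℝ, E) (F t) m (Y m)) :=
    mvfderiv_comp_apply m (hμ.mdiff t (F t m)) hFd (Y m)
  rw [h3, h2]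
  change Ω t m (VectorField.mpullback 𝓘(ℝ, E) 𝓘(ℝ, E) (F t) (lineSum R N t) m) (Y m)
    - Ω t m (lineSum R N t m) (Y m) = _
  simp only [lieFun]
  ring

end IsNormalizedLine
end Line
end NearlyPeriodic

/-! ### Invariance of the normalized primitive -/

namespace NearlyPeriodic
open MeasureTheory Set

variable {E : Type*} [NormedAddCommGroup E] [NormedSpace ℝ E] [FiniteDimensional ℝ E]
  {M : Type*} [TopologicalSpace M] [ChartedSpace E M] [IsManifold 𝓘(ℝ, E) ∞ M] [T2Space M]
  [MulAction Circle M] [ContMDiffSMul (𝓡 1) 𝓘(ℝ, E) ∞ Circle M]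

namespace IsNormalizedLine
open Asymptotics Filter
variable {F : ℝ → M → M} {θ₀ : ℝ} {θ : ℝ → OneForm E M} {Ω : ℝ → BilinForm E M}
  {R : ℕ → SmoothVF E M} (h : IsNormalizedLine F θ₀ θ Ω R)
  {k : ℕ → SmoothVF E M →ₗ[ℝ] SmoothFn E M}
  (hk : ∀ Y : SmoothVF E M, HasTaylor (fun t m =>
    (pullForm F θ t m - θ t m : TangentSpace 𝓘(ℝ, E) m →L[ℝ] ℝ) (Y m)) (fun n => k n Y))
  {b : ℕ → SmoothVF E M →ₗ[ℝ] SmoothFn E M}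
  (hb : ∀ Y : SmoothVF E M, HasTaylor (fun t m => θ t m (Y m)) (fun n => b n Y))
  (hbt : ∀ n, Tensorial (b n))
include h hk hb hbt

theorem tensorial_defect (n : ℕ) : Tensorial (cauchy (lieAct _ _) R b n) := by
  have h1 : cauchy (lieAct _ _) R b n ∈ tensorialForms E M :=
    sum_mem fun p _ => (tensorialForms E M).lie_mem (hbt p.2)
  exact h1

/-- The leading coefficient of `d(F^*μ - μ) = F^*δ - δ`, where `δ = L_R θ`. -/
theorem lie_nu_eq {n : ℕ} (hδ : ∀ i < n, cauchy (lieAct _ _) R b i = 0)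
    (hν : ∀ i < n, ∀ Y : SmoothVF E M, ⁅Y, cauchy LinearMap.id k R i⁆ = 0)
    (Y : SmoothVF E M) (m : M) :
    ⁅Y, cauchy LinearMap.id k R n⁆ m
      = cauchy (lieAct _ _) R b n (pullVF (-θ₀) Y) (rot θ₀ m)
        - cauchy (lieAct _ _) R b n Y m := by
  have hF0 : F 0 = rot θ₀ := funext h.map_zero
  obtain ⟨x, e, he⟩ := exists_local_frame (E := E) (rot θ₀ m)
  have hzero : ∀ Z : SmoothVF E M, ∀ i < n, cauchy (lieAct _ _) R b i Z = 0 := fun Z i hi => by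
    rw [hδ i hi]; rfl
  choose r hr hfac hr0 using fun Z : SmoothVF E M =>
    (h.hasTaylorUpTo_lineDefect hb n Z).exists_factor_leading (hzero Z)
  obtain ⟨rν, hrν, hfν, hrν0⟩ := ((h.hasTaylorUpTo_nu hk n).lie Y).exists_factor_leading
    (fun i hi => hν i hi Y)
  have hx : ∀ i, JointlySmooth E (fun t m => lieFun Y (fun m => x i (F t m)) m) := fun i =>
    ((JointlySmooth.const (x i)).comp_map h.map.smooth).lie Y
  -- `S t` is the quotient by `tⁿ` of `d(F^*μ - μ) - (F^*δ - δ)`, with `F^*δ` expanded in a frame.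
  let S : ℝ → ℝ := fun t => rν t m
    - (∑ i, lieFun Y (fun m => x i (F t m)) m * r (e i) t (F t m) - r Y t m)
  have hS : Continuous S := by
    refine (hrν.param m).continuous.sub ((continuous_finsetSum _ fun i _ => ?_).sub
      ((hr Y).param m).continuous)
    exact ((hx i).param m).continuous.mul (((hr (e i)).comp_map h.map.smooth).param m).continuous
  have hFc : Continuous fun t => F t m :=
    h.map.smooth.continuous.comp (f := fun t : ℝ => (m, t)) (by fun_prop)
  have h0 : S 0 = 0 := by
    refine eq_zero_of_pow_mul_isBigO hS.continuousAt (n := n) ?_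
    refine (h.lie_nu_isBigO n Y m).congr' ?_ EventuallyEq.rfl
    have h1 := hFc.tendsto 0
    rw [h.map_zero] at h1
    filter_upwards [h1.eventually he] with t ht
    have hFd : MDifferentiableAt 𝓘(ℝ, E) 𝓘(ℝ, E) (F t) m := by
      obtain ⟨d, hd⟩ := h.map.coe_diffeo t
      rw [← hd]
      exact d.contMDiff.mdifferentiableAt (by simp)
    have h2 : lineDefect θ Ω R n t (F t m) (mfderiv 𝓘(ℝ, E) 𝓘(ℝ, E) (F t) m (Y m))
        = ∑ i, lieFun Y (fun m => x i (F t m)) m * (t ^ n * r (e i) t (F t m)) := by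
      conv_lhs => rw [ht (mfderiv 𝓘(ℝ, E) 𝓘(ℝ, E) (F t) m (Y m))]
      rw [map_sum]
      refine Finset.sum_congr rfl fun i _ => ?_
      rw [← hfac]
      refine (map_smul (lineDefect θ Ω R n t (F t m)) _ _).trans ?_
      have h3 : lieFun Y (fun m => x i (F t m)) m = mvfderiv 𝓘(ℝ, E) (x i) (F t m)
          (mfderiv 𝓘(ℝ, E) 𝓘(ℝ, E) (F t) m (Y m)) :=
        mvfderiv_comp_apply m ((x i).mdiff (F t m)) hFd (Y m)
      rw [h3]
      rfl
    have h4 := hfν t m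
    rw [h2, h4, hfac Y t m]
    simp only [S, mul_sub, Finset.mul_sum]
    congr 2
    exact Finset.sum_congr rfl fun i _ => by ring
  have h5 := (Tensorial.eventually_eq_sum he).self_of_nhds _
    (tensorial_defect h hk hb hbt n) (pullVF (-θ₀) Y)
  rw [h5]
  simp only [S, hrν0, hr0, hF0] at h0
  have h6 : ∀ i, ⁅pullVF (-θ₀) Y, x i⁆ (rot θ₀ m) = lieFun Y (fun m => x i (rot θ₀ m)) m :=
    fun i => by
      rw [lie_pullVF, rotFn_apply, rot_neg_rot, neg_neg]
      rfl
  simp only [h6]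
  linarith

/-- The coefficients of `L_R θ` vanish, and those of `F^*μ - μ` are locally constant. -/
theorem defect_eq_zero (hnr : NonResonant θ₀) (n : ℕ) :
    cauchy (lieAct _ _) R b n = 0 ∧
      ∀ Y : SmoothVF E M, ⁅Y, cauchy LinearMap.id k R n⁆ = 0 := by
  induction n using Nat.strong_induction_on with
  | _ n ih =>
  have hR₀ := h.generator
  obtain ⟨W, hW, hRW⟩ := h.conj
  have hmain := lie_nu_eq h hk hb hbt (fun i hi => (ih i hi).1) (fun i hi => (ih i hi).2)
  have htens := tensorial_defect h hk hb hbt n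
  set δ := cauchy (lieAct _ _) R b n with hδ
  set ν := cauchy LinearMap.id k R n with hν
  -- The coefficients of `ν` of lower degree are locally constant, so `L_R ν = 0` gives `L_{R₀} νₙ = 0`.
  have hνinv : ⁅R 0, ν⁆ = 0 := by
    have h1 := h.cauchy_lie_nu hk n
    rw [cauchy, Finset.sum_eq_single (0, n)] at h1
    · exact h1
    · rintro ⟨i, j⟩ hij hne
      have hij := Finset.HasAntidiagonal.mem_antidiagonal.1 hij
      have hj : j < n := by
        rcases Nat.eq_zero_or_pos i with rfl | hi
        · exact absurd (by simpa using hij) (fun hj : j = n => hne (by rw [hj]))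
        · simp only at hij; omega
      exact (ih j hj).2 _
    · simp
  -- Along an orbit, the rotated values of `δₙ` have increments over the step `θ₀` which are constant.
  have hinc : ∀ (Y : SmoothVF E M) (m : M) (s : ℝ),
      δ (pullVF (s - θ₀) Y) (rot (-(s - θ₀)) m) - δ (pullVF s Y) (rot (-s) m) = ⁅Y, ν⁆ m := by
    intro Y m s
    have h1 := hmain (pullVF s Y) (rot (-s) m)
    have h2 : rotFn (-s) ν = ν := by
      ext q; exact rot_eq_of_lie_eq_zero hR₀ hνinv (-s) q
    rw [lie_pullVF, h2, rotFn_apply, rot_rot_neg, pullVF_pullVF, ← rot_add] at h1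
    rw [h1, show -(s - θ₀) = θ₀ + -s by ring, show s - θ₀ = -θ₀ + s by ring]
  have hcont := fun Y m => htens.continuous_pullVF_rot Y m
  have hper : ∀ (Y : SmoothVF E M) (m : M),
      Function.Periodic (fun s => δ (pullVF s Y) (rot (-s) m)) (2 * Real.pi) := fun Y m s => by
    beta_reduce
    rw [pullVF_add_two_pi, neg_add, rot_add]
    congr 2
    have h3 := rot_two_pi (rot (-(2 * Real.pi)) m)
    rw [rot_rot_neg] at h3
    exact h3.symm
  have hνz : ∀ Y : SmoothVF E M, ⁅Y, ν⁆ = 0 := fun Y => by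
    ext m
    exact eq_zero_of_periodic_sub (hcont Y m) (hper Y m) (hinc Y m)
  refine ⟨?_, hνz⟩
  -- These values have the periods `θ₀` and `2π`, so `δₙ` is invariant under all rotations.
  have hinv : ∀ (Y : SmoothVF E M) s m, δ (pullVF s Y) (rot (-s) m) = δ Y m := fun Y s m => by
    have hθ : Function.Periodic (fun s => δ (pullVF s Y) (rot (-s) m)) θ₀ := fun s => by
      have h3 := hinc Y m (s + θ₀)
      rw [hνz Y, add_sub_cancel_right] at h3
      have h4 : (0 : SmoothFn E M) m = 0 := rfl
      rw [h4] at h3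
      exact (sub_eq_zero.1 h3).symm
    have h5 := eq_of_periodic_of_irrational (hcont Y m) hθ (hper Y m) hnr.irrational s
    beta_reduce at h5
    rw [h5, pullVF_zero, neg_zero, rot_zero]
  -- As the leading coefficient of `L_R θ`, the form `δₙ` lies in the image of `L_{R₀}`.
  obtain ⟨η, hη⟩ := exists_lie_eq_of_leading hW hRW b n (fun i hi => (ih i hi).1)
  exact eq_zero_of_rot_invariant hR₀ htens hinv hη

end IsNormalizedLine
end NearlyPeriodic

/-! ### Uniform Taylor estimates in a chart -/

namespace NearlyPeriodic
open MeasureTheory Set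

variable {E : Type*} [NormedAddCommGroup E] [NormedSpace ℝ E] [FiniteDimensional ℝ E]
  {M : Type*} [TopologicalSpace M] [ChartedSpace E M] [IsManifold 𝓘(ℝ, E) ∞ M] [T2Space M]

section UniformTaylor

theorem _root_.ContDiffOn.exists_bound_fderiv {V W : Type*} [NormedAddCommGroup V] [NormedSpace ℝ V]
    [NormedAddCommGroup W] [NormedSpace ℝ W] {f : V → W} {O K : Set V} (hf : ContDiffOn ℝ ∞ f O)
    (hO : IsOpen O) (hK : IsCompact K) (hKO : K ⊆ O) : ∃ C, ∀ z ∈ K, ‖fderiv ℝ f z‖ ≤ C :=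
  hK.exists_bound_of_continuousOn
    ((hf.fderiv_of_isOpen (m := ∞) hO (by simp)).continuousOn.mono hKO)

/-- First order Taylor expansion near a point, in the coordinates of a frame, with bounds that are
uniform for parameters in a compact interval. -/
theorem exists_uniform_taylor (p₀ : M) :
    ∃ (x : Fin (Module.finrank ℝ E) → SmoothFn E M) (e : Fin (Module.finrank ℝ E) → SmoothVF E M)
      (U : Set M), IsOpen U ∧ p₀ ∈ U ∧
      (∀ m ∈ U, (∀ v : TangentSpace 𝓘(ℝ, E) m, v = ∑ i, mvfderiv 𝓘(ℝ, E) (x i) m v • e i m) ∧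
        ∀ i j, mvfderiv 𝓘(ℝ, E) (x i) m (e j m) = if j = i then 1 else 0) ∧
      ∀ f : ℝ → M → ℝ, JointlySmooth E f → ∀ a b : ℝ, ∃ C, 0 ≤ C ∧
        ∀ t ∈ Icc a b, ∀ q ∈ U, ∀ q' ∈ U,
          |f t q' - f t q| ≤ C * ‖fun i => x i q' - x i q‖ ∧
          |f t q' - f t q - ∑ i, (x i q' - x i q) * lieFun (e i) (f t) q|
            ≤ C * ‖fun i => x i q' - x i q‖ ^ 2 := by
  obtain ⟨x, e, he⟩ := exists_chart_frame (E := E) p₀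
  let φ := extChartAt 𝓘(ℝ, E) p₀
  let bas := Module.finBasis ℝ E
  have h1 : Filter.Tendsto φ.symm (𝓝 (φ p₀)) (𝓝 p₀) := by
    have := (continuousAt_extChartAt_symm (I := 𝓘(ℝ, E)) p₀).tendsto
    rwa [extChartAt_to_inv] at this
  obtain ⟨ρ, hρ, hball⟩ := Metric.nhds_basis_closedBall.mem_iff.1
    (Filter.inter_mem (h1.eventually he) (extChartAt_target_mem_nhds (I := 𝓘(ℝ, E)) p₀))
  have hgood : ∀ q ∈ φ.source ∩ φ ⁻¹' Metric.ball (φ p₀) ρ, _ := fun q hq => by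
    have := (hball (Metric.ball_subset_closedBall hq.2)).1
    simp only [mem_ofPred_eq] at this
    rw [φ.left_inv hq.1] at this
    exact this
  refine ⟨x, e, φ.source ∩ φ ⁻¹' Metric.ball (φ p₀) ρ,
    isOpen_extChartAt_preimage' p₀ Metric.isOpen_ball,
    ⟨mem_extChartAt_source p₀, Metric.mem_ball_self hρ⟩,
    fun q hq => ⟨(hgood q hq).1, (hgood q hq).2.2.1⟩, fun f hf a b => ?_⟩
  let G : E × ℝ → ℝ := fun p => f p.2 (φ.symm p.1)
  have hO : IsOpen (φ.target ×ˢ (univ : Set ℝ)) := (isOpen_extChartAt_target p₀).prod isOpen_univ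
  have hG : ContDiffOn ℝ ∞ G (φ.target ×ˢ univ) := contDiffAt_chart (h := fun m t => f t m) hf p₀
  have hG1 : ContDiffOn ℝ ∞ (fderiv ℝ G) (φ.target ×ˢ univ) :=
    hG.fderiv_of_isOpen hO (by simp)
  have : ProperSpace E := FiniteDimensional.proper_real E
  let K := Metric.closedBall (φ p₀) ρ ×ˢ Icc a b
  have hK : IsCompact K := (isCompact_closedBall _ _).prod isCompact_Icc
  have hKO : K ⊆ φ.target ×ˢ univ := fun p hp => ⟨(hball hp.1).2, mem_univ _⟩
  have hKc : Convex ℝ K := (convex_closedBall _ _).prod (convex_Icc _ _)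
  obtain ⟨C₁, hC₁⟩ := hG.exists_bound_fderiv hO hK hKO
  obtain ⟨C₂, hC₂⟩ := hG1.exists_bound_fderiv hO hK hKO
  let B := ∑ i, ‖bas i‖
  have hB : 0 ≤ B := Finset.sum_nonneg fun i _ => norm_nonneg _
  refine ⟨|C₁| * B + |C₂| * B ^ 2, by positivity, fun t ht q hq q' hq' => ?_⟩
  have hz : (φ q, t) ∈ K := ⟨Metric.ball_subset_closedBall hq.2, ht⟩
  have hz' : (φ q', t) ∈ K := ⟨Metric.ball_subset_closedBall hq'.2, ht⟩
  have hdiff : φ q' - φ q = ∑ i, (x i q' - x i q) • bas i := by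
    rw [← bas.sum_repr (φ q' - φ q)]
    refine Finset.sum_congr rfl fun i _ => ?_
    rw [map_sub, (hgood q hq).2.1, (hgood q' hq').2.1]
    rfl
  set d := ‖fun i => x i q' - x i q‖ with hd
  have hnorm : ‖((φ q', t) - (φ q, t) : E × ℝ)‖ ≤ B * d := by
    rw [Prod.mk_sub_mk, sub_self, Prod.norm_mk, norm_zero, max_eq_left (norm_nonneg _), hdiff]
    refine (norm_sum_le _ _).trans ?_
    rw [Finset.sum_mul]
    refine Finset.sum_le_sum fun i _ => ?_
    rw [norm_smul, mul_comm]
    exact mul_le_mul_of_nonneg_left (norm_le_pi_norm (fun i => x i q' - x i q) i) (norm_nonneg _)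
  have hGd : ∀ z ∈ K, DifferentiableAt ℝ G z := fun z hz =>
    (hG.contDiffAt (hO.mem_nhds (hKO hz))).differentiableAt (by simp)
  have hGd1 : ∀ z ∈ K, DifferentiableAt ℝ (fderiv ℝ G) z := fun z hz =>
    (hG1.contDiffAt (hO.mem_nhds (hKO hz))).differentiableAt (by simp)
  have hGq : ∀ q ∈ φ.source ∩ φ ⁻¹' Metric.ball (φ p₀) ρ, G (φ q, t) = f t q := fun q hq => by
    change f t (φ.symm (φ q)) = _
    rw [φ.left_inv hq.1]
  have hd0 : 0 ≤ d := norm_nonneg _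
  constructor
  · have h2 := hKc.norm_image_sub_le_of_norm_fderiv_le hGd
      (fun z hz => (hC₁ z hz).trans (le_abs_self C₁)) hz hz'
    rw [hGq q hq, hGq q' hq', Real.norm_eq_abs] at h2
    refine h2.trans ((mul_le_mul_of_nonneg_left hnorm (abs_nonneg _)).trans ?_)
    have : 0 ≤ |C₂| * B ^ 2 * d := by positivity
    nlinarith
  · have h3 : ∀ w ∈ K ∩ Metric.closedBall (φ q, t) ‖((φ q', t) - (φ q, t) : E × ℝ)‖,
        ‖fderiv ℝ G w - fderiv ℝ G (φ q, t)‖ ≤ |C₂| * (B * d) := fun w hw => by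
      refine (hKc.norm_image_sub_le_of_norm_fderiv_le hGd1
        (fun z hz => (hC₂ z hz).trans (le_abs_self C₂)) hz hw.1).trans ?_
      refine mul_le_mul_of_nonneg_left (le_trans ?_ hnorm) (abs_nonneg _)
      have := hw.2
      rwa [Metric.mem_closedBall, dist_eq_norm] at this
    have h4 := Convex.norm_image_sub_le_of_norm_fderiv_le' (fun w hw => hGd w hw.1) h3
      (hKc.inter (convex_closedBall _ _)) ⟨hz, Metric.mem_closedBall_self (norm_nonneg _)⟩
      ⟨hz', by rw [Metric.mem_closedBall, dist_eq_norm]⟩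
    rw [hGq q hq, hGq q' hq', Real.norm_eq_abs] at h4
    have h5 : fderiv ℝ G (φ q, t) ((φ q', t) - (φ q, t))
        = ∑ i, (x i q' - x i q) * lieFun (e i) (f t) q := by
      have h6 : ((φ q', t) - (φ q, t) : E × ℝ)
          = ∑ i, (x i q' - x i q) • ((bas i, 0) : E × ℝ) := by
        rw [Prod.mk_sub_mk, sub_self, hdiff]
        refine Prod.ext ?_ ?_
        · simp [Prod.fst_sum]
        · simp [Prod.snd_sum]
      rw [h6, map_sum]
      refine Finset.sum_congr rfl fun i _ => ?_
      rw [map_smul, smul_eq_mul]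
      congr 1
      have h7 : HasFDerivAt (fun y => G (y, t))
          ((fderiv ℝ G (φ q, t)).comp (ContinuousLinearMap.inl ℝ E ℝ)) (φ q) :=
        HasFDerivAt.comp (g := G) (φ q) (hGd _ hz).hasFDerivAt (hasFDerivAt_prodMk_left _ _)
      have hms : q ∈ (chartAt E p₀).source := by
        have := hq.1
        rwa [extChartAt_source] at this
      have h8 := h7.hasMFDerivAt.comp q
        (mdifferentiableAt_extChartAt (I := 𝓘(ℝ, E)) hms).hasMFDerivAt
      have h9 : f t =ᶠ[𝓝 q] (fun y => G (y, t)) ∘ φ := by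
        filter_upwards [(isOpen_extChartAt_source p₀).mem_nhds hq.1] with r hr
        change _ = f t (φ.symm (φ r))
        rw [φ.left_inv hr]
      have h10 := (h8.congr_of_eventuallyEq h9).mfderiv
      have h11 := congrArg (fun L : E →L[ℝ] ℝ => L (e i q)) h10
      have h12 : lieFun (e i) (f t) q = fderiv ℝ G (φ q, t)
          ((mfderiv 𝓘(ℝ, E) 𝓘(ℝ, E) φ q (e i q) : E), (0 : ℝ)) := h11
      rw [h12]
      congr 2
      exact ((hgood q hq).2.2.2 i).symm
    rw [h5] at h4
    refine h4.trans ((mul_le_mul_of_nonneg_left hnorm (by positivity)).trans ?_)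
    have : 0 ≤ |C₁| * B * d ^ 2 := by positivity
    nlinarith

end UniformTaylor
end NearlyPeriodic

/-! ### Comparison of integral curves -/

namespace NearlyPeriodic
open MeasureTheory Set

variable {E : Type*} [NormedAddCommGroup E] [NormedSpace ℝ E] [FiniteDimensional ℝ E]
  {M : Type*} [TopologicalSpace M] [ChartedSpace E M] [IsManifold 𝓘(ℝ, E) ∞ M] [T2Space M]

section Action

/-- Integral curves on `[0, 1]` of a time-dependent vector field, continuously extended to `ℝ`. -/
structure IsIntegralCurve (Y : ℝ → VF E M) (c : ℝ → M) : Prop where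
  continuous : Continuous c
  deriv : ∀ t ∈ Icc (0 : ℝ) 1, HasMFDerivWithinAt 𝓘(ℝ, ℝ) 𝓘(ℝ, E) c (Icc 0 1) t
    ((1 : ℝ →L[ℝ] ℝ).smulRight (Y t (c t)))

theorem IsIntegralCurve.hasDerivWithinAt {Y : ℝ → VF E M} {c : ℝ → M} (hc : IsIntegralCurve Y c)
    (f : SmoothFn E M) {t : ℝ} (ht : t ∈ Icc (0 : ℝ) 1) :
    HasDerivWithinAt (fun t => f (c t)) (lieFun (Y t) f (c t)) (Icc 0 1) t := by
  have h1 := (f.mdiff (c t)).hasMFDerivAt.comp_hasMFDerivWithinAt t (hc.deriv t ht)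
  let D (A : E →L[ℝ] ℝ) (v : E) : ℝ →L[ℝ] ℝ := A.comp ((1 : ℝ →L[ℝ] ℝ).smulRight v)
  have h2 : HasFDerivWithinAt (fun t => f (c t)) (D (mvfderiv 𝓘(ℝ, E) f (c t)) (Y t (c t)))
      (Icc 0 1) t := hasMFDerivWithinAt_iff_hasFDerivWithinAt.1 h1
  refine h2.hasDerivWithinAt.congr_deriv ?_
  exact congrArg (mvfderiv 𝓘(ℝ, E) f (c t)) (one_smul ℝ (Y t (c t)))

/-- Every point of a time-one flow lies on an integral curve defined on `ℝ`. -/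
theorem IsTimeOneFlow.exists_isIntegralCurve {Y : ℝ → VF E M} {F : M → M} (h : IsTimeOneFlow Y F)
    (m : M) : ∃ c, IsIntegralCurve Y c ∧ c 0 = m ∧ c 1 = F m := by
  obtain ⟨c, h0, h1, hc⟩ := h m
  have hcc : ContinuousOn c (Icc 0 1) := fun t ht => (hc t ht).continuousWithinAt
  have heq : ∀ t ∈ Icc (0 : ℝ) 1, IccExtend zero_le_one ((Icc (0 : ℝ) 1).domRestrict c) t = c t :=
    fun t ht => IccExtend_of_mem _ _ ht
  refine ⟨IccExtend zero_le_one ((Icc (0 : ℝ) 1).domRestrict c), ⟨?_, fun t ht => ?_⟩, ?_, ?_⟩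
  · exact (continuousOn_iff_continuous_domRestrict.1 hcc).Icc_extend'
  · have h2 := (hc t ht).congr_of_eventuallyEq (f₁ := IccExtend zero_le_one
      ((Icc (0 : ℝ) 1).domRestrict c)) (by filter_upwards [self_mem_nhdsWithin] using heq) (heq t ht)
    rw [heq t ht]
    exact h2
  · rw [heq 0 (by simp), h0]
  · rw [heq 1 (by simp), h1]

/-- A point stays in a given neighbourhood for a short time, uniformly for all integral curves: a
bump function changes along them at a bounded rate. -/
theorem exists_stay {Y : ℝ → VF E M} (hY : SmoothVFFamily Y) {U : Set M} {p₀ : M}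
    (hU : U ∈ 𝓝 p₀) :
    ∃ χ : SmoothFn E M, χ p₀ = 1 ∧ (∀ m, χ m ≠ 0 → m ∈ U) ∧ ∃ ε > 0, ∀ c, IsIntegralCurve Y c →
      ∀ t ∈ Icc (0 : ℝ) 1, ∀ t' ∈ Icc (0 : ℝ) 1, |t' - t| ≤ 2 * ε →
        |χ (c t') - χ (c t)| ≤ 1 / 4 := by
  obtain ⟨ψ, -, hψ⟩ := (SmoothBumpFunction.nhds_basis_support (I := 𝓘(ℝ, E)) hU).mem_iff.1 hU
  let χ : SmoothFn E M := ⟨ψ, ψ.contMDiff⟩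
  have hV : JointlySmooth E (fun t => lieFun (Y t) χ) := (JointlySmooth.const χ).mvfderiv hY
  have hK : IsCompact (tsupport ψ ×ˢ Icc (0 : ℝ) 1) := ψ.hasCompactSupport.isCompact.prod isCompact_Icc
  obtain ⟨L, hL⟩ := hK.exists_bound_of_continuousOn (f := fun p : M × ℝ => lieFun (Y p.2) χ p.1)
    hV.continuous.continuousOn
  have hL' : ∀ t ∈ Icc (0 : ℝ) 1, ∀ m, ‖lieFun (Y t) χ m‖ ≤ |L| := fun t ht m => by
    by_cases hm : m ∈ tsupport ψ
    · exact (hL (m, t) ⟨hm, ht⟩).trans (le_abs_self L)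
    · have h1 : (χ : M → ℝ) =ᶠ[𝓝 m] fun _ => 0 := notMem_tsupport_iff_eventuallyEq.1 hm
      rw [lieFun_congr (Y t) h1, lieFun_const, norm_zero]
      exact abs_nonneg L
  refine ⟨χ, ψ.eq_one, fun m hm => hψ hm, 1 / (8 * (|L| + 1)), by positivity,
    fun c hc t ht t' ht' htt => ?_⟩
  have h2 := (convex_Icc (0 : ℝ) 1).norm_image_sub_le_of_norm_hasDerivWithin_le
    (fun t ht => hc.hasDerivWithinAt χ ht) (fun t ht => hL' t ht (c t)) ht ht'
  simp only [Real.norm_eq_abs] at h2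
  refine h2.trans ((mul_le_mul_of_nonneg_left htt (abs_nonneg L)).trans ?_)
  have : 0 ≤ |L| := abs_nonneg L
  rw [show |L| * (2 * (1 / (8 * (|L| + 1)))) = |L| / (4 * (|L| + 1)) by field_simp; ring]
  rw [div_le_div_iff₀ (by positivity) (by norm_num)]
  linarith

variable {θ : OneForm E M} (hθ : SmoothOneFormFamily (fun _ : ℝ => θ)) {Y : ℝ → VF E M}
  (hY : SmoothVFFamily Y) {H : ℝ → M → ℝ} (hH : JointlySmooth E H)
  (hrel : ∀ (t : ℝ) (Z : SmoothVF E M) (m : M),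
    dOneForm θ (Y t) Z m = -mvfderiv 𝓘(ℝ, E) (H t) m (Z m))

include hθ hY hH in
/-- The integrand of the action depends smoothly on the point and on time. -/
theorem jointlySmooth_lagrangian : JointlySmooth E (fun t m => θ m (Y t m) - H t m) :=
  (hθ.apply hY).sub hH

theorem SmoothVFFamily.exists_eq (hY : SmoothVFFamily Y) (t : ℝ) :
    ∃ Z : SmoothVF E M, (Z : VF E M) = Y t :=
  ⟨⟨Y t, fun m => ContMDiff.comp (g := fun p : M × ℝ => Bundle.TotalSpace.mk' E
      (E := (TangentSpace 𝓘(ℝ, E) : M → Type _)) p.1 (Y p.2 p.1)) (f := fun m => (m, t)) hY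
      (contMDiff_id.prodMk contMDiff_const) m⟩, rfl⟩

include hθ hY hH hrel in
/-- The equation `ι_Y dθ = -dH`, written as `L_Y θ = d(θ(Y) - H)` in a frame. -/
theorem lie_components {ι : Type*} [Fintype ι] [DecidableEq ι] {x : ι → SmoothFn E M}
    {e : ι → SmoothVF E M} {m : M}
    (he : ∀ᶠ q in 𝓝 m, (∀ v : TangentSpace 𝓘(ℝ, E) q, v = ∑ i, mvfderiv 𝓘(ℝ, E) (x i) q v • e i q) ∧
        ∀ i j, mvfderiv 𝓘(ℝ, E) (x i) q (e j q) = if j = i then 1 else 0) (t : ℝ) (j : ι) :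
    lieFun (Y t) (fun m => θ m (e j m)) m
      + ∑ i, θ m (e i m) * lieFun (e j) (fun m => lieFun (Y t) (x i) m) m
      = lieFun (e j) (fun m => θ m (Y t m) - H t m) m := by
  obtain ⟨Z, hZ⟩ := hY.exists_eq t
  have h1 := hrel t (e j) m
  rw [dOneForm] at h1
  have h2 : θ m (VectorField.mlieBracket 𝓘(ℝ, E) (Y t) (e j) m)
      = -∑ i, θ m (e i m) * lieFun (e j) (fun m => lieFun (Y t) (x i) m) m := by
    rw [← hZ]
    change θ m (⁅Z, e j⁆ m) = _
    rw [he.self_of_nhds.1 (⁅Z, e j⁆ m), map_sum, ← Finset.sum_neg_distrib]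
    refine Finset.sum_congr rfl fun i _ => (map_smul (θ m) _ _).trans ?_
    have h3 : mvfderiv 𝓘(ℝ, E) (x i) m (⁅Z, e j⁆ m)
        = lieFun Z (lieFun (e j) (x i)) m - lieFun (e j) (lieFun Z (x i)) m :=
      congrArg (fun f : SmoothFn E M => f m) (lieD_bracket Z (e j) (x i))
    have h4 : lieFun (e j) (x i) =ᶠ[𝓝 m] fun _ => if j = i then 1 else 0 :=
      he.mono fun q hq => hq.2 i j
    rw [h3, lieFun_congr _ h4, lieFun_const, zero_sub, smul_eq_mul, neg_mul, mul_comm]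
  have h5 : lieFun (e j) (fun m => θ m (Y t m) - H t m) m
      = lieFun (e j) (fun m => θ m (Y t m)) m - lieFun (e j) (H t) m :=
    lieFun_sub (f := fun m => θ m (Y t m)) (g := H t) _ ((hθ.apply hY).mdiff t m) (hH.mdiff t m)
  rw [h5]
  have h6 : lieFun (e j) (H t) m = mvfderiv 𝓘(ℝ, E) (H t) m (e j m) := rfl
  linarith

include hθ hY hH hrel in
/-- Comparison of nearby integral curves. To first order in the distance `Δ` of the curves, the
difference of their actions is the difference of the values of `θ(Δ)` at the end points. -/
theorem exists_two_curve_bound {ι : Type*} [Fintype ι] [DecidableEq ι] {x : ι → SmoothFn E M}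
    {e : ι → SmoothVF E M} {U : Set M} (hU : IsOpen U)
    (he : ∀ q ∈ U, (∀ v : TangentSpace 𝓘(ℝ, E) q, v = ∑ i, mvfderiv 𝓘(ℝ, E) (x i) q v • e i q) ∧
        ∀ i j, mvfderiv 𝓘(ℝ, E) (x i) q (e j q) = if j = i then 1 else 0)
    (hT : ∀ f : ℝ → M → ℝ, JointlySmooth E f → ∀ a b : ℝ, ∃ C, 0 ≤ C ∧
        ∀ t ∈ Icc a b, ∀ q ∈ U, ∀ q' ∈ U,
          |f t q' - f t q| ≤ C * ‖fun i => x i q' - x i q‖ ∧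
          |f t q' - f t q - ∑ i, (x i q' - x i q) * lieFun (e i) (f t) q|
            ≤ C * ‖fun i => x i q' - x i q‖ ^ 2)
    {γ : ℝ → M} (hγ : IsIntegralCurve Y γ) :
    ∃ C, 0 ≤ C ∧ ∀ c, IsIntegralCurve Y c → ∀ t₁ ∈ Icc (0 : ℝ) 1, ∀ t₂ ∈ Icc (0 : ℝ) 1, t₁ ≤ t₂ →
      (∀ t ∈ Icc t₁ t₂, γ t ∈ U ∧ c t ∈ U) →
      ‖fun i => x i (c t₂) - x i (γ t₂)‖ ≤ C * ‖fun i => x i (c t₁) - x i (γ t₁)‖ ∧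
      |(∑ i, θ (γ t₂) (e i (γ t₂)) * (x i (c t₂) - x i (γ t₂)))
        - (∑ i, θ (γ t₁) (e i (γ t₁)) * (x i (c t₁) - x i (γ t₁)))
        - ∫ t in t₁..t₂, ((θ (c t) (Y t (c t)) - H t (c t)) - (θ (γ t) (Y t (γ t)) - H t (γ t)))|
        ≤ C * ‖fun i => x i (c t₁) - x i (γ t₁)‖ ^ 2 := by
  have hL := jointlySmooth_lagrangian hθ hY hH
  have hV : ∀ i, JointlySmooth E (fun t m => lieFun (Y t) (x i) m) := fun i =>
    (JointlySmooth.const (x i)).mvfderiv hY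
  have hθe : ∀ i, ContMDiff 𝓘(ℝ, E) 𝓘(ℝ, ℝ) ∞ (fun m => θ m (e i m)) := fun i =>
    (hθ.apply (smoothVFFamily_const (e i))).slice 0
  choose CV hCV0 hCV using fun i => hT _ (hV i) 0 1
  obtain ⟨CL, hCL0, hCL⟩ := hT _ hL 0 1
  choose B hB using fun i => isCompact_Icc.exists_bound_of_continuousOn (s := Icc (0 : ℝ) 1)
    (((hθe i).continuous.comp hγ.continuous).continuousOn)
  let K := ∑ i, CV i
  have hK : 0 ≤ K := Finset.sum_nonneg fun i _ => hCV0 i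
  let C' := (∑ i, |B i| * CV i) + CL
  have hC' : 0 ≤ C' := add_nonneg
    (Finset.sum_nonneg fun i _ => mul_nonneg (abs_nonneg _) (hCV0 i)) hCL0
  refine ⟨Real.exp K + C' * Real.exp K ^ 2, by positivity, fun c hc t₁ ht₁ t₂ ht₂ h12 hin => ?_⟩
  let Δ : ℝ → ι → ℝ := fun t i => x i (c t) - x i (γ t)
  have hsub : Icc t₁ t₂ ⊆ Icc 0 1 := Icc_subset_Icc ht₁.1 ht₂.2
  let V : ℝ → ι → ℝ := fun t i => lieFun (Y t) (x i) (c t) - lieFun (Y t) (x i) (γ t)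
  have hΔ : ∀ t ∈ Icc t₁ t₂, HasDerivWithinAt Δ (V t) (Icc t₁ t₂) t := fun t ht =>
    hasDerivWithinAt_pi.2 fun i => ((hc.hasDerivWithinAt (x i) (hsub ht)).sub
      (hγ.hasDerivWithinAt (x i) (hsub ht))).mono hsub
  have hVb : ∀ t ∈ Icc t₁ t₂, ‖V t‖ ≤ K * ‖Δ t‖ := fun t ht => by
    refine (pi_norm_le_iff_of_nonneg (by positivity)).2 fun i => ?_
    refine ((hCV i t (hsub ht) _ (hin t ht).1 _ (hin t ht).2).1).trans ?_
    exact mul_le_mul_of_nonneg_right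
      (Finset.single_le_sum (fun i _ => hCV0 i) (Finset.mem_univ i)) (norm_nonneg _)
  -- Grönwall's inequality bounds the distance of the curves by their initial distance.
  have hgr : ∀ t ∈ Icc t₁ t₂, ‖Δ t‖ ≤ Real.exp K * ‖Δ t₁‖ := fun t ht => by
    have h1 := norm_le_gronwallBound_of_norm_deriv_right_le (f := Δ) (f' := V) (δ := ‖Δ t₁‖) (K := K)
      (ε := 0) (a := t₁) (b := t₂) (fun t ht => (hΔ t ht).continuousWithinAt)
      (fun t ht => (hΔ t (Ico_subset_Icc_self ht)).mono_of_mem_nhdsWithin (Icc_mem_nhdsGE_of_mem ht))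
      le_rfl (fun t ht => by rw [add_zero]; exact hVb t (Ico_subset_Icc_self ht)) t ht
    rw [gronwallBound_ε0, mul_comm] at h1
    refine h1.trans (mul_le_mul_of_nonneg_right (Real.exp_le_exp.2 ?_) (norm_nonneg _))
    have := (hsub ht).2
    have := ht₁.1
    nlinarith
  have hd0 : 0 ≤ ‖Δ t₁‖ := norm_nonneg _
  refine ⟨(hgr t₂ ⟨h12, le_rfl⟩).trans (mul_le_mul_of_nonneg_right ?_ hd0), ?_⟩
  · have : 0 ≤ C' * Real.exp K ^ 2 := by positivity
    linarith
  let L : ℝ → M → ℝ := fun t m => θ m (Y t m) - H t m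
  let g : ℝ → ℝ := fun t => L t (c t) - L t (γ t)
  have hLc : ∀ {d : ℝ → M}, Continuous d → Continuous fun t => L t (d t) := fun {d} hd =>
    hL.continuous.comp (f := fun t => (d t, t)) (hd.prodMk continuous_id)
  have hg : Continuous g := (hLc hc.continuous).sub (hLc hγ.continuous)
  let ψ : ℝ → ℝ := fun t => (∑ i, θ (γ t) (e i (γ t)) * Δ t i) - ∫ τ in t₁..t, g τ
  let ψ' : ℝ → ℝ := fun t => (∑ i, (lieFun (Y t) (fun m => θ m (e i m)) (γ t) * Δ t i
    + θ (γ t) (e i (γ t)) * V t i)) - g t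
  have hψ : ∀ t ∈ Icc t₁ t₂, HasDerivWithinAt ψ (ψ' t) (Icc t₁ t₂) t := fun t ht => by
    refine HasDerivWithinAt.sub (HasDerivWithinAt.fun_sum fun i _ => ?_)
      (hg.integral_hasStrictDerivAt t₁ t).hasDerivAt.hasDerivWithinAt
    exact ((hγ.hasDerivWithinAt ⟨_, hθe i⟩ (hsub ht)).mono hsub).mul
      ((hasDerivWithinAt_pi.1 (hΔ t ht)) i)
  -- The terms of first order in `Δ` cancel by the equation `L_Y θ = d(θ(Y) - H)`.
  have hψ' : ∀ t ∈ Icc t₁ t₂, ‖ψ' t‖ ≤ C' * (Real.exp K * ‖Δ t₁‖) ^ 2 := fun t ht => by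
    have ht01 := hsub ht
    obtain ⟨hγt, hct⟩ := hin t ht
    have hid := fun j => lie_components hθ hY hH hrel
      (Filter.eventually_of_mem (hU.mem_nhds hγt) he) t j
    have h1 : ψ' t = (∑ i, θ (γ t) (e i (γ t)) * (V t i
          - ∑ j, Δ t j * lieFun (e j) (fun m => lieFun (Y t) (x i) m) (γ t)))
        - (g t - ∑ j, Δ t j * lieFun (e j) (L t) (γ t)) := by
      have h2 : ∑ j, Δ t j * lieFun (e j) (L t) (γ t)
          = (∑ j, lieFun (Y t) (fun m => θ m (e j m)) (γ t) * Δ t j)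
            + ∑ i, θ (γ t) (e i (γ t))
              * ∑ j, Δ t j * lieFun (e j) (fun m => lieFun (Y t) (x i) m) (γ t) := by
        simp only [Finset.mul_sum]
        rw [Finset.sum_comm, ← Finset.sum_add_distrib]
        refine Finset.sum_congr rfl fun j _ => ?_
        rw [← hid j, mul_add, Finset.mul_sum, mul_comm]
        congr 1
        exact Finset.sum_congr rfl fun i _ => by ring
      rw [h2]
      simp only [ψ', mul_sub, Finset.sum_sub_distrib, Finset.sum_add_distrib]
      ring
    have h3 : ∀ i, |θ (γ t) (e i (γ t)) * (V t i
        - ∑ j, Δ t j * lieFun (e j) (fun m => lieFun (Y t) (x i) m) (γ t))|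
        ≤ |B i| * CV i * ‖Δ t‖ ^ 2 := fun i => by
      rw [abs_mul, mul_assoc]
      exact mul_le_mul ((hB i t ht01).trans (le_abs_self _)) (hCV i t ht01 _ hγt _ hct).2
        (abs_nonneg _) (abs_nonneg _)
    have h4 : |g t - ∑ j, Δ t j * lieFun (e j) (L t) (γ t)| ≤ CL * ‖Δ t‖ ^ 2 :=
      (hCL t ht01 _ hγt _ hct).2
    have h5 : ‖ψ' t‖ ≤ C' * ‖Δ t‖ ^ 2 := by
      rw [h1, Real.norm_eq_abs, add_mul, Finset.sum_mul]
      exact (abs_sub _ _).trans (add_le_add ((Finset.abs_sum_le_sum_abs _ _).trans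
        (Finset.sum_le_sum fun i _ => h3 i)) h4)
    refine h5.trans (mul_le_mul_of_nonneg_left ?_ hC')
    exact pow_le_pow_left₀ (norm_nonneg _) (hgr t ht) 2
  have hfin := norm_image_sub_le_of_norm_deriv_le_segment' hψ
    (fun t ht => hψ' t (Ico_subset_Icc_self ht)) t₂ ⟨h12, le_rfl⟩
  have h6 : ψ t₂ - ψ t₁ = (∑ i, θ (γ t₂) (e i (γ t₂)) * (x i (c t₂) - x i (γ t₂)))
        - (∑ i, θ (γ t₁) (e i (γ t₁)) * (x i (c t₁) - x i (γ t₁))) - ∫ t in t₁..t₂, g t := by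
    simp only [ψ, Δ, intervalIntegral.integral_same]
    ring
  rw [h6, Real.norm_eq_abs] at hfin
  refine hfin.trans ?_
  have h7 : t₂ - t₁ ≤ 1 := by linarith [ht₁.1, ht₂.2]
  have h8 : 0 ≤ t₂ - t₁ := by linarith
  have h9 : 0 ≤ C' * (Real.exp K * ‖Δ t₁‖) ^ 2 := by positivity
  refine (mul_le_of_le_one_right h9 h7).trans ?_
  change _ ≤ _ * ‖Δ t₁‖ ^ 2
  have : 0 ≤ Real.exp K * ‖Δ t₁‖ ^ 2 := by positivity
  nlinarith

end Action
end NearlyPeriodic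

/-! ### The flux of a Hamiltonian map -/

namespace NearlyPeriodic
open MeasureTheory Set

variable {E : Type*} [NormedAddCommGroup E] [NormedSpace ℝ E] [FiniteDimensional ℝ E]
  {M : Type*} [TopologicalSpace M] [ChartedSpace E M] [IsManifold 𝓘(ℝ, E) ∞ M] [T2Space M]

section Variation
open Asymptotics Filter

/-- Every covector is the differential of a function, given explicitly in a frame. -/
theorem mvfderiv_sum_smul {ι : Type*} [Fintype ι] {x : ι → SmoothFn E M} {e : ι → SmoothVF E M}
    {m : M} (he : ∀ v : TangentSpace 𝓘(ℝ, E) m, v = ∑ i, mvfderiv 𝓘(ℝ, E) (x i) m v • e i m)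
    (L : TangentSpace 𝓘(ℝ, E) m →L[ℝ] ℝ) (v : TangentSpace 𝓘(ℝ, E) m) :
    mvfderiv 𝓘(ℝ, E) (∑ i, L (e i m) • x i : SmoothFn E M) m v = L v := by
  obtain ⟨Z, rfl⟩ := exists_smoothVF_apply_eq (E := E) m v
  have h := congrArg (fun f : SmoothFn E M => f m)
    (lie_sum (s := Finset.univ) (f := fun i => L (e i m) • x i) (a := Z))
  simp only [lie_smul, SmoothFn.coe_sum] at h
  refine h.trans ?_
  conv_rhs => rw [he (Z m), map_sum]
  exact Finset.sum_congr rfl fun i _ => (mul_comm _ _).trans (map_smul L _ _).symm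

/-- The action `∫₀ᵗ (θ(Y) - H) dτ` along a curve. -/
def action (θ : OneForm E M) (Y : ℝ → VF E M) (H : ℝ → M → ℝ) (c : ℝ → M) (t : ℝ) : ℝ :=
  ∫ τ in (0 : ℝ)..t, (θ (c τ) (Y τ (c τ)) - H τ (c τ))

/-- The first variation formula at time `t` for a family of integral curves `c s` near `s = s₀`:
the derivative of the action is `θ(∂ₛc) - κ`. As `∂ₛc` need not exist, `θ(∂ₛc)` is expressed by
means of functions `g` with `dg = θ` at the end point. -/
def HasVariation (θ : OneForm E M) (Y : ℝ → VF E M) (H : ℝ → M → ℝ) (c : ℝ → ℝ → M) (s₀ κ t : ℝ) :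
    Prop :=
  (∀ f : SmoothFn E M, (fun s => f (c s t) - f (c s₀ t)) =O[𝓝 s₀] fun s => s - s₀) ∧
  ∀ g : SmoothFn E M, (∀ v, mvfderiv 𝓘(ℝ, E) g (c s₀ t) v = θ (c s₀ t) v) →
    (fun s => action θ Y H (c s) t - action θ Y H (c s₀) t - (g (c s t) - g (c s₀ t))
      + κ * (s - s₀)) =o[𝓝 s₀] fun s => s - s₀

variable {θ : OneForm E M} (hθ : SmoothOneFormFamily (fun _ : ℝ => θ)) {Y : ℝ → VF E M}
  (hY : SmoothVFFamily Y) {H : ℝ → M → ℝ} (hH : JointlySmooth E H)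
  (hrel : ∀ (t : ℝ) (Z : SmoothVF E M) (m : M),
    dOneForm θ (Y t) Z m = -mvfderiv 𝓘(ℝ, E) (H t) m (Z m))
  {c : ℝ → ℝ → M} (hc : ∀ s, IsIntegralCurve Y (c s)) {s₀ κ : ℝ}

include hθ hY hH hc in
theorem action_sub (s t₁ t₂ : ℝ) : action θ Y H (c s) t₂ - action θ Y H (c s) t₁
    = ∫ t in t₁..t₂, (θ (c s t) (Y t (c s t)) - H t (c s t)) := by
  have hcont : Continuous fun t => θ (c s t) (Y t (c s t)) - H t (c s t) :=
    (jointlySmooth_lagrangian hθ hY hH).continuous.comp (f := fun t => (c s t, t))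
      ((hc s).continuous.prodMk continuous_id)
  exact intervalIntegral.integral_interval_sub_left (hcont.intervalIntegrable _ _)
    (hcont.intervalIntegrable _ _)

include hθ hY hH hrel hc in
/-- The first variation formula propagates over short time intervals, on which all nearby curves stay in
one chart. -/
theorem HasVariation.exists_step {t₀ : ℝ} (ht₀ : t₀ ∈ Icc (0 : ℝ) 1) :
    ∃ ε > 0, ∀ t₁ ∈ Icc (0 : ℝ) 1, ∀ t₂ ∈ Icc (0 : ℝ) 1, t₁ ≤ t₂ → |t₁ - t₀| < ε → |t₂ - t₀| < ε →
      HasVariation θ Y H c s₀ κ t₁ → HasVariation θ Y H c s₀ κ t₂ := by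
  obtain ⟨x, e, U, hU, hp₀, he, hT⟩ := exists_uniform_taylor (E := E) (c s₀ t₀)
  obtain ⟨χ, hχ1, hχU, ε, hε, hstay⟩ := exists_stay hY (hU.mem_nhds hp₀)
  obtain ⟨C, hC, hbound⟩ := exists_two_curve_bound hθ hY hH hrel hU he hT (hc s₀)
  refine ⟨ε, hε, fun t₁ ht₁ t₂ ht₂ h12 h1 h2 ⟨hP, hQ⟩ => ?_⟩
  have hγχ : ∀ t ∈ Icc t₁ t₂, 3 / 4 ≤ χ (c s₀ t) := fun t ht => by
    have h3 : |t - t₀| ≤ 2 * ε := by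
      rw [abs_lt] at h1 h2
      rw [abs_le]
      constructor <;> linarith [ht.1, ht.2]
    have h4 := hstay _ (hc s₀) t₀ ht₀ t ⟨ht₁.1.trans ht.1, ht.2.trans ht₂.2⟩ h3
    rw [hχ1, abs_le] at h4
    linarith [h4.1]
  have hself : Tendsto (fun s => s - s₀) (𝓝 s₀) (𝓝 0) := by
    have : Continuous fun s : ℝ => s - s₀ := by fun_prop
    simpa using this.tendsto s₀
  -- The cut-off function `χ` varies slowly along all curves, so they remain in `U`.
  have hev : ∀ᶠ s in 𝓝 s₀, ∀ t ∈ Icc t₁ t₂, c s₀ t ∈ U ∧ c s t ∈ U := by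
    have h5 := (hP χ).trans_tendsto hself
    filter_upwards [Metric.tendsto_nhds.1 h5 (1 / 4) (by norm_num)] with s hs t ht
    rw [dist_zero_right, Real.norm_eq_abs, abs_lt] at hs
    refine ⟨hχU _ (by linarith [hγχ t ht] : (0 : ℝ) < _).ne', hχU _ (ne_of_gt ?_)⟩
    have h3 : |t - t₁| ≤ 2 * ε := by
      rw [abs_lt] at h1 h2
      rw [abs_le]
      constructor <;> linarith [ht.1, ht.2]
    have h4 := hstay _ (hc s) t₁ ht₁ t ⟨ht₁.1.trans ht.1, ht.2.trans ht₂.2⟩ h3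
    rw [abs_le] at h4
    linarith [h4.1, hγχ t₁ ⟨le_rfl, h12⟩]
  have hγU : ∀ t ∈ Icc t₁ t₂, c s₀ t ∈ U := fun t ht => (hev.self_of_nhds t ht).1
  have hΔ₁ : (fun s => ‖fun i => x i (c s t₁) - x i (c s₀ t₁)‖) =O[𝓝 s₀] fun s => s - s₀ :=
    (isBigO_pi.2 fun i => hP (x i)).norm_left
  have hsq : (fun s => ‖fun i => x i (c s t₁) - x i (c s₀ t₁)‖ ^ 2) =o[𝓝 s₀] fun s => s - s₀ := by
    have h3 : (fun s => ‖fun i => x i (c s t₁) - x i (c s₀ t₁)‖) =o[𝓝 s₀] fun _ => (1 : ℝ) :=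
      (isLittleO_one_iff ℝ).2 (hΔ₁.trans_tendsto hself)
    simpa [sq] using hΔ₁.mul_isLittleO h3
  have hΔ₂ : ∀ᶠ s in 𝓝 s₀, ‖fun i => x i (c s t₂) - x i (c s₀ t₂)‖
      ≤ C * ‖fun i => x i (c s t₁) - x i (c s₀ t₁)‖ := by
    filter_upwards [hev] with s hs
    exact (hbound _ (hc s) t₁ ht₁ t₂ ht₂ h12 hs).1
  have h12' : t₂ ∈ Icc t₁ t₂ := ⟨h12, le_rfl⟩
  refine ⟨fun f => ?_, fun g hg => ?_⟩
  · obtain ⟨Cf, hCf0, hCf⟩ := hT (fun _ => f) (JointlySmooth.const f) 0 1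
    refine IsBigO.trans (IsBigO.of_bound (Cf * C) ?_) hΔ₁
    filter_upwards [hev, hΔ₂] with s hs hs2
    rw [norm_norm, Real.norm_eq_abs, mul_assoc]
    exact ((hCf t₂ ht₂ _ (hγU t₂ h12') _ (hs t₂ h12').2).1).trans
      (mul_le_mul_of_nonneg_left hs2 hCf0)
  · let a : ℝ → Fin (Module.finrank ℝ E) → ℝ := fun t i => θ (c s₀ t) (e i (c s₀ t))
    let ψ : ℝ → ℝ → ℝ := fun s t => ∑ i, a t i * (x i (c s t) - x i (c s₀ t))
    have hstart : (fun s => action θ Y H (c s) t₁ - action θ Y H (c s₀) t₁ - ψ s t₁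
        + κ * (s - s₀)) =o[𝓝 s₀] fun s => s - s₀ := by
      -- the function `∑ aᵢ xᵢ` has differential `θ` at `c s₀ t₁`
      refine (hQ (∑ i, a t₁ i • x i) fun v => ?_).congr_left fun s => ?_
      · exact mvfderiv_sum_smul (he _ (hγU t₁ ⟨le_rfl, h12⟩)).1 (θ (c s₀ t₁)) v
      · simp only [SmoothFn.coe_sum, ψ]
        rw [← Finset.sum_sub_distrib]
        congr 2
        exact Finset.sum_congr rfl fun i _ => (mul_sub _ _ _).symm
    have hmid : (fun s => (ψ s t₂ - ψ s t₁) - ((action θ Y H (c s) t₂ - action θ Y H (c s) t₁)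
        - (action θ Y H (c s₀) t₂ - action θ Y H (c s₀) t₁))) =o[𝓝 s₀] fun s => s - s₀ := by
      refine IsBigO.trans_isLittleO (IsBigO.of_bound C ?_) hsq
      filter_upwards [hev] with s hs
      rw [action_sub hθ hY hH hc, action_sub hθ hY hH hc, ← intervalIntegral.integral_sub]
      · rw [Real.norm_eq_abs, norm_pow, norm_norm]
        exact (hbound _ (hc s) t₁ ht₁ t₂ ht₂ h12 hs).2
      all_goals
        refine Continuous.intervalIntegrable ?_ _ _
        exact (jointlySmooth_lagrangian hθ hY hH).continuous.comp (f := fun t => (c _ t, t))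
          ((hc _).continuous.prodMk continuous_id)
    have hend : (fun s => g (c s t₂) - g (c s₀ t₂) - ψ s t₂) =o[𝓝 s₀] fun s => s - s₀ := by
      obtain ⟨Cg, hCg0, hCg⟩ := hT (fun _ => g) (JointlySmooth.const g) 0 1
      refine IsBigO.trans_isLittleO (IsBigO.of_bound (Cg * C ^ 2) ?_) hsq
      filter_upwards [hev, hΔ₂] with s hs hs2
      have h7 := (hCg t₂ ht₂ _ (hγU t₂ h12') _ (hs t₂ h12').2).2
      have h8 : ∑ i, (x i (c s t₂) - x i (c s₀ t₂)) * lieFun (e i) g (c s₀ t₂) = ψ s t₂ :=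
        Finset.sum_congr rfl fun i _ => by
          rw [lieFun, hg]
          exact mul_comm _ _
      rw [h8] at h7
      rw [Real.norm_eq_abs, norm_pow, norm_norm, mul_assoc, ← mul_pow]
      exact h7.trans (mul_le_mul_of_nonneg_left (pow_le_pow_left₀ (norm_nonneg _) hs2 2) hCg0)
    refine ((hstart.sub hmid).sub hend).congr_left fun s => ?_
    ring

include hθ hY hH hrel hc in
/-- The first variation formula propagates from the start to the end of the time interval, by the Lebesgue
number lemma. -/
theorem HasVariation.zero_imp_one (h : HasVariation θ Y H c s₀ κ 0) :
    HasVariation θ Y H c s₀ κ 1 := by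
  choose! ε hε hstep using fun t₀ (ht₀ : t₀ ∈ Icc (0 : ℝ) 1) =>
    HasVariation.exists_step (s₀ := s₀) (κ := κ) hθ hY hH hrel hc ht₀
  obtain ⟨δ, hδ, hleb⟩ := lebesgue_number_lemma_of_metric (s := Icc (0 : ℝ) 1)
    (c := fun t₀ : Icc (0 : ℝ) 1 => Metric.ball (t₀ : ℝ) (ε t₀)) isCompact_Icc
    (fun _ => Metric.isOpen_ball)
    (fun t ht => mem_iUnion.2 ⟨⟨t, ht⟩, Metric.mem_ball_self (hε t ht)⟩)
  obtain ⟨N, hN⟩ := exists_nat_one_div_lt hδ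
  have hN0 : (0 : ℝ) < N + 1 := by positivity
  have hind : ∀ i : ℕ, i ≤ N + 1 → HasVariation θ Y H c s₀ κ (i / (N + 1)) := fun i => by
    induction i with
    | zero => intro _; simpa using h
    | succ i ih =>
      intro hi
      have hmem : ∀ k : ℕ, k ≤ N + 1 → (k / (N + 1) : ℝ) ∈ Icc (0 : ℝ) 1 := fun k hk =>
        ⟨by positivity, (div_le_one hN0).2 (by exact_mod_cast hk)⟩
      obtain ⟨⟨t₀, ht₀⟩, hball⟩ := hleb _ (hmem i (by omega))
      have h1 := hball (Metric.mem_ball_self hδ)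
      have h3 : ((i + 1 : ℕ) / (N + 1) : ℝ) - i / (N + 1) = 1 / (N + 1) := by
        push_cast
        field_simp
        ring
      have h4 : (0 : ℝ) < 1 / (N + 1) := by positivity
      have h2 : ((i + 1 : ℕ) / (N + 1) : ℝ) ∈ Metric.ball (i / (N + 1) : ℝ) δ := by
        rw [Metric.mem_ball, Real.dist_eq, h3, abs_of_pos h4]
        exact hN
      have h2 := hball h2
      rw [Metric.mem_ball, Real.dist_eq] at h1 h2
      exact hstep t₀ ht₀ _ (hmem i (by omega)) _ (hmem (i + 1) hi) (by linarith) h1 h2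
        (ih (by omega))
  have := hind (N + 1) le_rfl
  rwa [Nat.cast_succ, div_self hN0.ne'] at this

end Variation

section Flux
variable [MulAction Circle M] [ContMDiffSMul (𝓡 1) 𝓘(ℝ, E) ∞ Circle M]
open Asymptotics Filter

/-- Flux of a Hamiltonian diffeomorphism: the integral of `F^*θ - θ` over a circle orbit vanishes,
since it is the variation of the action over a closed loop of integral curves. -/
theorem integral_orbit_eq_zero {θ : OneForm E M} (hθ : SmoothOneFormFamily (fun _ : ℝ => θ))
    {Y : ℝ → VF E M} (hY : SmoothVFFamily Y) {H : ℝ → M → ℝ} (hH : JointlySmooth E H)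
    (hrel : ∀ (t : ℝ) (Z : SmoothVF E M) (m : M),
      dOneForm θ (Y t) Z m = -mvfderiv 𝓘(ℝ, E) (H t) m (Z m))
    {F : M → M} (hF : ContMDiff 𝓘(ℝ, E) 𝓘(ℝ, E) ∞ F) (hflow : IsTimeOneFlow Y F)
    {R₀ : SmoothVF E M} (hR₀ : ∀ m, R₀ m = generator E m) {k : SmoothFn E M}
    (hk : ∀ m, k m = θ (F m) (mfderiv 𝓘(ℝ, E) 𝓘(ℝ, E) F m (R₀ m)) - θ m (R₀ m)) (m : M) :
    ∫ s in (0 : ℝ)..(2 * Real.pi), k (rot s m) = 0 := by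
  choose C hC hC0 hC1 using hflow.exists_isIntegralCurve
  let c : ℝ → ℝ → M := fun s => C (rot s m)
  have hc : ∀ s, IsIntegralCurve Y (c s) := fun s => hC _
  have hc0 : ∀ s, c s 0 = rot s m := fun s => hC0 _
  have hc1 : ∀ s, c s 1 = F (rot s m) := fun s => hC1 _
  -- The action of the curve from `Φ_s m` to `F (Φ_s m)` has the derivative `(F^*θ - θ)(R₀)` in `s`.
  have hderiv : ∀ s₀, HasDerivAt (fun s => action θ Y H (c s) 1) (k (rot s₀ m)) s₀ := fun s₀ => by
    have h0 : HasVariation θ Y H c s₀ (θ (rot s₀ m) (R₀ (rot s₀ m))) 0 := by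
      refine ⟨fun f => ?_, fun g hg => ?_⟩
      · simp only [hc0]
        exact (hasDerivAt_rot hR₀ f m s₀).isBigO_sub
      · simp only [hc0]
        rw [hc0] at hg
        refine (hasDerivAt_iff_isLittleO.1 (hasDerivAt_rot hR₀ g m s₀)).neg_left.congr_left
          fun s => ?_
        rw [lie_fn_apply, lieFun, hg, smul_eq_mul]
        simp only [action, intervalIntegral.integral_same]
        ring
    obtain ⟨-, h1⟩ := HasVariation.zero_imp_one hθ hY hH hrel hc h0
    obtain ⟨x, e, he⟩ := exists_local_frame (E := E) (F (rot s₀ m))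
    let g : SmoothFn E M := ∑ i, θ (F (rot s₀ m)) (e i (F (rot s₀ m))) • x i
    have hg : ∀ v, mvfderiv 𝓘(ℝ, E) g (F (rot s₀ m)) v = θ (F (rot s₀ m)) v :=
      mvfderiv_sum_smul he.self_of_nhds (θ (F (rot s₀ m)))
    have h2 := h1 g (by rw [hc1]; exact hg)
    simp only [hc1] at h2
    let gF : SmoothFn E M := ⟨g ∘ F, g.contMDiff.comp hF⟩
    have h3 := hasDerivAt_iff_isLittleO.1 (hasDerivAt_rot hR₀ gF m s₀)
    have h4 : ⁅R₀, gF⁆ (rot s₀ m) = k (rot s₀ m) + θ (rot s₀ m) (R₀ (rot s₀ m)) := by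
      rw [hk, sub_add_cancel, ← hg]
      exact mvfderiv_comp_apply _ (g.mdiff _) (hF.mdifferentiableAt (by simp)) _
    rw [h4] at h3
    refine hasDerivAt_iff_isLittleO.2 ((h2.add h3).congr_left fun s => ?_)
    have h5 : ∀ q, gF q = g (F q) := fun _ => rfl
    simp only [h5, smul_eq_mul]
    ring
  rw [intervalIntegral.integral_eq_sub_of_hasDerivAt (fun s _ => hderiv s)
    ((continuous_rotFn k m).intervalIntegrable _ _)]
  simp only [c, rot_two_pi, rot_zero, sub_self]

end Flux
end NearlyPeriodic

/-! ### Vanishing of the increment of the moment -/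

namespace NearlyPeriodic
open MeasureTheory Set

variable {E : Type*} [NormedAddCommGroup E] [NormedSpace ℝ E] [FiniteDimensional ℝ E]
  {M : Type*} [TopologicalSpace M] [ChartedSpace E M] [IsManifold 𝓘(ℝ, E) ∞ M] [T2Space M]

section PushForward

theorem lieFun_mpullback_symm (Φ : M ≃ₘ^∞⟮𝓘(ℝ, E), 𝓘(ℝ, E)⟯ M) (X : VF E M) (f : SmoothFn E M)
    (m : M) : lieFun (VectorField.mpullback 𝓘(ℝ, E) 𝓘(ℝ, E) Φ.symm X) f m
      = lieFun X (f ∘ Φ) (Φ.symm m) := by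
  have h := mvfderiv_comp_mpullback Φ.symm X (g := f ∘ Φ) (m := m)
    ((f.contMDiff.comp Φ.contMDiff).mdifferentiableAt (by simp))
  have h1 : (f ∘ Φ) ∘ Φ.symm = f := by ext q; simp
  rwa [h1] at h

/-- The push-forward of a vector field under a diffeomorphism. -/
theorem exists_pushForward (Φ : M ≃ₘ^∞⟮𝓘(ℝ, E), 𝓘(ℝ, E)⟯ M) (X : SmoothVF E M) :
    ∃ Z : SmoothVF E M, (∀ m, Z (Φ m) = mfderiv 𝓘(ℝ, E) 𝓘(ℝ, E) Φ m (X m)) ∧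
      ∀ (f : SmoothFn E M) m, lieFun Z f (Φ m) = lieFun X (f ∘ Φ) m := by
  obtain ⟨Z, hZ⟩ := exists_smoothVF_of_lie
    (X := VectorField.mpullback 𝓘(ℝ, E) 𝓘(ℝ, E) Φ.symm X) fun f => by
      have h1 : lieFun (VectorField.mpullback 𝓘(ℝ, E) 𝓘(ℝ, E) Φ.symm X) f
          = lieFun X (f ∘ Φ) ∘ Φ.symm := funext fun m => lieFun_mpullback_symm Φ X f m
      rw [h1]
      exact (contMDiff_lieFun X (f.contMDiff.comp Φ.contMDiff)).comp Φ.symm.contMDiff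
  have h2 : ∀ (f : SmoothFn E M) m, lieFun Z f (Φ m) = lieFun X (f ∘ Φ) m := fun f m => by
    rw [hZ, lieFun_mpullback_symm, Φ.symm_apply_apply]
  refine ⟨Z, fun m => tangent_ext fun f => (h2 f m).trans ?_, h2⟩
  exact mvfderiv_comp_apply m (f.mdiff _) (Φ.contMDiff.mdifferentiableAt (by simp)) _

/-- The exterior derivative of a `1`-form commutes with pullbacks. -/
theorem dOneForm_pullback (Φ : M ≃ₘ^∞⟮𝓘(ℝ, E), 𝓘(ℝ, E)⟯ M) {θ κ : OneForm E M}
    (hθ : ∀ Z : SmoothVF E M, ContMDiff 𝓘(ℝ, E) 𝓘(ℝ, ℝ) ∞ (fun m => θ m (Z m)))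
    (hκ : ∀ m v, κ m v = θ (Φ m) (mfderiv 𝓘(ℝ, E) 𝓘(ℝ, E) Φ m v)) {X Y X' Y' : SmoothVF E M}
    (hX : ∀ m, X' (Φ m) = mfderiv 𝓘(ℝ, E) 𝓘(ℝ, E) Φ m (X m))
    (hX' : ∀ (f : SmoothFn E M) m, lieFun X' f (Φ m) = lieFun X (f ∘ Φ) m)
    (hY : ∀ m, Y' (Φ m) = mfderiv 𝓘(ℝ, E) 𝓘(ℝ, E) Φ m (Y m))
    (hY' : ∀ (f : SmoothFn E M) m, lieFun Y' f (Φ m) = lieFun Y (f ∘ Φ) m) (m : M) :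
    dOneForm κ X Y m = dOneForm θ X' Y' (Φ m) := by
  have h1 : (fun m => κ m (Y m)) = (fun m => θ m (Y' m)) ∘ Φ := funext fun m => by
    rw [hκ, ← hY]; rfl
  have h2 : (fun m => κ m (X m)) = (fun m => θ m (X' m)) ∘ Φ := funext fun m => by
    rw [hκ, ← hX]; rfl
  have h3 : mfderiv 𝓘(ℝ, E) 𝓘(ℝ, E) Φ m (⁅X, Y⁆ m) = ⁅X', Y'⁆ (Φ m) := by
    refine tangent_ext fun f => ?_
    let fΦ : SmoothFn E M := ⟨f ∘ Φ, f.contMDiff.comp Φ.contMDiff⟩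
    have e1 : mvfderiv 𝓘(ℝ, E) f (Φ m) (mfderiv 𝓘(ℝ, E) 𝓘(ℝ, E) Φ m (⁅X, Y⁆ m))
        = lieD ⁅X, Y⁆ fΦ m :=
      (mvfderiv_comp_apply m (f.mdiff _) (Φ.contMDiff.mdifferentiableAt (by simp)) _).symm
    have e2 : mvfderiv 𝓘(ℝ, E) f (Φ m) (⁅X', Y'⁆ (Φ m)) = lieD ⁅X', Y'⁆ f (Φ m) := rfl
    have e3 : (lieD Y fΦ : M → ℝ) = lieD Y' f ∘ Φ := funext fun q => (hY' f q).symm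
    have e4 : (lieD X fΦ : M → ℝ) = lieD X' f ∘ Φ := funext fun q => (hX' f q).symm
    have e5 : ∀ (f g : SmoothFn E M) q, (f - g) q = f q - g q := fun _ _ _ => rfl
    rw [e1, e2, lieD_bracket, lieD_bracket, e5, e5, lieD_apply, lieD_apply, lieD_apply X' , lieD_apply Y',
      hX', hY', e3, e4]
  rw [dOneForm, dOneForm, h1, h2]
  refine congrArg₂ _ (congrArg₂ _ (hX' ⟨_, hθ Y'⟩ m).symm (hY' ⟨_, hθ X'⟩ m).symm) ?_
  refine (hκ m (⁅X, Y⁆ m)).trans ?_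
  rw [h3]
  rfl

end PushForward

section LocallyConstant

/-- On a connected manifold, functions with vanishing differential are constant. -/
theorem eq_of_lie_eq_zero [PreconnectedSpace M] {f : SmoothFn E M}
    (hf : ∀ X : SmoothVF E M, ⁅X, f⁆ = 0) (m m' : M) : f m = f m' := by
  have hd : ∀ m, mvfderiv 𝓘(ℝ, E) f m = 0 := fun m => by
    ext v
    obtain ⟨X, rfl⟩ := exists_smoothVF_apply_eq (E := E) m v
    exact congrArg (fun g : SmoothFn E M => g m) (hf X)
  have hloc : IsLocallyConstant f := by
    refine (IsLocallyConstant.iff_eventually_eq _).2 fun p => ?_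
    let φ := extChartAt 𝓘(ℝ, E) p
    obtain ⟨ρ, hρ, hball⟩ := Metric.nhds_basis_ball.mem_iff.1
      (extChartAt_target_mem_nhds (I := 𝓘(ℝ, E)) p)
    have h1 : ∀ y ∈ Metric.ball (φ p) ρ, HasFDerivAt (f ∘ φ.symm) (0 : E →L[ℝ] ℝ) y := fun y hy => by
      have h2 : MDifferentiableAt 𝓘(ℝ, E) 𝓘(ℝ, E) φ.symm y :=
        ((contMDiffOn_extChartAt_symm (I := 𝓘(ℝ, E)) (n := ∞) p).contMDiffAt
          ((isOpen_extChartAt_target p).mem_nhds (hball hy))).mdifferentiableAt (by simp)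
      have h3 := (f.mdiff (φ.symm y)).hasMFDerivAt.comp y h2.hasMFDerivAt
      have h4 : HasFDerivAt (f ∘ φ.symm) _ y := hasMFDerivAt_iff_hasFDerivAt.1 h3
      refine h4.congr_fderiv ?_
      ext v
      exact congrArg (fun L : E →L[ℝ] ℝ => L (mfderiv 𝓘(ℝ, E) 𝓘(ℝ, E) φ.symm y v))
        (hd (φ.symm y))
    have h5 : ∀ᶠ q in 𝓝 p, q ∈ φ.source ∩ φ ⁻¹' Metric.ball (φ p) ρ :=
      (isOpen_extChartAt_preimage' p Metric.isOpen_ball).mem_nhds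
        ⟨mem_extChartAt_source p, Metric.mem_ball_self hρ⟩
    filter_upwards [h5] with q hq
    have h6 := Metric.isOpen_ball.is_const_of_fderiv_eq_zero (𝕜 := ℝ)
      (convex_ball (φ p) ρ).isPreconnected
      (fun y hy => (h1 y hy).differentiableAt.differentiableWithinAt)
      (fun y hy => (h1 y hy).fderiv) hq.2 (Metric.mem_ball_self hρ)
    simp only [Function.comp_apply] at h6
    rwa [φ.left_inv hq.1, φ.left_inv (mem_extChartAt_source p)] at h6
  exact hloc.apply_eq_of_preconnectedSpace m m'

end LocallyConstant

variable [MulAction Circle M] [ContMDiffSMul (𝓡 1) 𝓘(ℝ, E) ∞ Circle M]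

/-- Averaging over the circle commutes with Taylor expansion. -/
theorem HasTaylor.avg {f : ℝ → SmoothFn E M} {c : ℕ → SmoothFn E M}
    (hf : HasTaylor (fun t m => f t m) c) :
    HasTaylor (fun t m => NearlyPeriodic.avg E M (f t) m) (fun n => NearlyPeriodic.avg E M (c n)) :=
  fun N => by
  obtain ⟨r, hr, h⟩ := hf N
  let r' : ℝ → SmoothFn E M := fun t => ⟨r t, hr.slice t⟩
  refine ⟨fun t => NearlyPeriodic.avg E M (r' t), JointlySmooth.avg (f := r') hr, fun t m => ?_⟩
  have h1 : f t = ∑ i ∈ Finset.range N, t ^ i • c i + t ^ N • r' t := by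
    ext m
    refine (h t m).trans ?_
    change _ = (∑ i ∈ Finset.range N, t ^ i • c i : SmoothFn E M) m + _
    rw [SmoothFn.coe_sum]
    rfl
  beta_reduce
  rw [h1, map_add, map_sum, map_smul]
  change (∑ i ∈ Finset.range N, _ : SmoothFn E M) m + _ = _
  rw [SmoothFn.coe_sum]
  simp only [map_smul]
  rfl

namespace IsNormalizedLine
open Asymptotics Filter
variable {F : ℝ → M → M} {θ₀ : ℝ} {θ : ℝ → OneForm E M} {Ω : ℝ → BilinForm E M}
  {R : ℕ → SmoothVF E M} (h : IsNormalizedLine F θ₀ θ Ω R)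
  {k : ℕ → SmoothVF E M →ₗ[ℝ] SmoothFn E M}
  (hk : ∀ Y : SmoothVF E M, HasTaylor (fun t m =>
    (pullForm F θ t m - θ t m : TangentSpace 𝓘(ℝ, E) m →L[ℝ] ℝ) (Y m)) (fun n => k n Y))
  (hν : ∀ n (Y : SmoothVF E M), ⁅Y, cauchy LinearMap.id k R n⁆ = 0)
include h hk

/-- As `F` preserves `Ω = -dθ`, the forms `F^*θ - θ` are closed. -/
theorem mem_closedForms (n : ℕ) : k n ∈ closedForms (SmoothVF E M) (SmoothFn E M) := by
  intro X
  ext1 Y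
  rw [LieHom.lie_apply, differential_apply, sub_eq_iff_eq_add, ← sub_eq_iff_eq_add']
  let κ : ℝ → OneForm E M := fun t m => pullForm F θ t m - θ t m
  have hclosed : ∀ t m, lieFun X (fun m => κ t m (Y m)) m - lieFun Y (fun m => κ t m (X m)) m
      = κ t m (⁅X, Y⁆ m) := fun t m => by
    obtain ⟨Φ, hΦ⟩ := h.map.coe_diffeo t
    obtain ⟨X', hX, hX'⟩ := exists_pushForward Φ X
    obtain ⟨Y', hY, hY'⟩ := exists_pushForward Φ Y
    have h1 := dOneForm_pullback Φ (κ := pullForm F θ t) (fun Z => (h.jointlySmooth_apply Z).slice t)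
      (fun m v => by rw [hΦ]; rfl) hX hX' hY hY' m
    have h2 := h.primitive t X' Y' (Φ m)
    have h3 := h.preserves t m (X m) (Y m)
    rw [hX, hY] at h2
    rw [hΦ] at h2 h1
    rw [h2, h.primitive t X Y m, ← h1, neg_inj] at h3
    have hp := fun Z => h.smooth.pullForm_apply h.map.smooth (smoothVFFamily_const Z)
    have h4 : ∀ Z W : SmoothVF E M, lieFun Z (fun m => κ t m (W m)) m
        = lieFun Z (fun m => pullForm F θ t m (W m)) m - lieFun Z (fun m => θ t m (W m)) m :=
      fun Z W => lieFun_sub (f := fun m => pullForm F θ t m (W m)) (g := fun m => θ t m (W m)) _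
        ((hp W).mdiff t m) ((h.jointlySmooth_apply W).mdiff t m)
    have h5 : κ t m (⁅X, Y⁆ m) = pullForm F θ t m (⁅X, Y⁆ m) - θ t m (⁅X, Y⁆ m) := rfl
    have h6 : ∀ β : OneForm E M, dOneForm β X Y m = lieFun X (fun x => β x (Y x)) m
      - lieFun Y (fun x => β x (X x)) m - β m (⁅X, Y⁆ m) := fun _ => rfl
    rw [h6, h6] at h3
    rw [h4, h4, h5]
    linarith
  exact congrFun (((((hk Y).lie X).sub ((hk X).lie Y)).congr
    fun t m => (hclosed t m).symm).unique (hk ⁅X, Y⁆)) n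

include hν

/-- On a connected manifold the constants `νₙ` can be computed at a zero of `R₀`. There they vanish, as
`ν` is the contraction of `R₀` with a formal series of `1`-forms. -/
theorem nu_eq_zero_of_connected (hkt : ∀ n, Tensorial (k n)) [PreconnectedSpace M] {m₀ : M}
    (hm₀ : NearlyPeriodic.generator E m₀ = 0) (n : ℕ) : cauchy LinearMap.id k R n = 0 := by
  obtain ⟨W, hW, hRW⟩ := h.conj
  -- `νₙ = (T⁻¹κ)ₙ(R₀)`, where `T` is the transformation which takes `R₀` to `R`
  ext m
  rw [eq_of_lie_eq_zero (hν n) m m₀, cauchy_apply_eq hW hRW k hν n]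
  have h1 : Tensorial (transInv W k n) := transInv_mem W (tensorialForms E M) hkt n
  exact h1.apply_eq_zero (by rw [h.generator, hm₀])

/-- Since `κ = F^*θ - θ` is closed, the functions `νₙ` differ from `κₙ(R₀)` by derivatives along `R₀`.
As they are constant along the orbits, they are the averages of `κₙ(R₀)`, and these vanish if the
orbit integrals of `κ` do. -/
theorem nu_eq_zero_of_integral (hint : ∀ t m, ∫ s in (0 : ℝ)..(2 * Real.pi),
      (pullForm F θ t (rot s m) - θ t (rot s m) : TangentSpace 𝓘(ℝ, E) (rot s m) →L[ℝ] ℝ)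
        (R 0 (rot s m)) = 0) (n : ℕ) : cauchy LinearMap.id k R n = 0 := by
  obtain ⟨W, hW, hRW⟩ := h.conj
  let f : ℝ → SmoothFn E M := fun t => ⟨_, (h.jointlySmooth_kappa (R 0)).slice t⟩
  have h1 := HasTaylor.avg (f := f) (hk (R 0))
  have h2 : ∀ t, avg E M (f t) = 0 := fun t => by
    ext m
    rw [avg_apply]
    simp only [weight₀, intervalIntegral.integral_const_mul]
    exact mul_eq_zero_of_right _ (hint t m)
  have h3 : HasTaylor (fun t m => avg E M (f t) m) (fun _ => 0) := fun N =>
    ⟨fun _ => (0 : SmoothFn E M), JointlySmooth.const 0, fun t m => by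
      beta_reduce; rw [h2]; change (0 : ℝ) = ∑ i ∈ Finset.range N, t ^ i * (0 : ℝ) + t ^ N * (0 : ℝ); simp⟩
  have h4 : avg E M (k n (R 0)) = 0 := congrFun (h1.unique h3) n
  obtain ⟨g, hg⟩ := transInv_sub_exact W (h.mem_closedForms hk) n
  have h5 : cauchy LinearMap.id k R n = k n (R 0) + ⁅R 0, g⁆ := by
    rw [cauchy_apply_eq hW hRW k hν n, hg]
    rfl
  -- The function `νₙ` is locally constant, hence constant along the orbits.
  have h6 : avg E M (cauchy LinearMap.id k R n) = cauchy LinearMap.id k R n := by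
    ext m
    exact avg_of_rot_eq fun s => rot_eq_of_lie_eq_zero h.generator (hν n (R 0)) s m
  rw [← h6, h5, map_add, h4, avg_lie h.generator, add_zero]

end IsNormalizedLine
end NearlyPeriodic

/-! ### Reduction to lines -/

namespace NearlyPeriodic
open MeasureTheory Set

variable {E : Type*} [NormedAddCommGroup E] [NormedSpace ℝ E] [FiniteDimensional ℝ E]
  {M : Type*} [TopologicalSpace M] [ChartedSpace E M] [IsManifold 𝓘(ℝ, E) ∞ M] [T2Space M]
  {Γ : Type*} [NormedAddCommGroup Γ] [NormedSpace ℝ Γ]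

section Families

theorem SmoothOneFormFamily.sub {θ κ : Γ → OneForm E M} (hθ : SmoothOneFormFamily θ)
    (hκ : SmoothOneFormFamily κ) : SmoothOneFormFamily (fun γ m => θ γ m - κ γ m) := by
  intro p
  have h1 := ((contMDiffAt_hom_bundle _).1 (hθ p)).2
  have h2 := ((contMDiffAt_hom_bundle _).1 (hκ p)).2
  refine (contMDiffAt_hom_bundle _).2 ⟨contMDiff_fst p, ?_⟩
  refine (h1.sub h2).congr_of_eventuallyEq (Filter.Eventually.of_forall fun q => ?_)
  ext v
  simp [ContinuousLinearMap.inCoordinates]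

theorem SmoothOneFormFamily.const {θ : Γ → OneForm E M} (hθ : SmoothOneFormFamily θ) (γ : Γ) :
    SmoothOneFormFamily (fun _ : ℝ => θ γ) :=
  ContMDiff.comp (g := fun p : M × Γ => Bundle.TotalSpace.mk' (E →L[ℝ] ℝ)
      (E := fun m : M => TangentSpace 𝓘(ℝ, E) m →L[ℝ] ℝ) p.1 (θ p.2 p.1))
    (f := fun p : M × ℝ => (p.1, γ)) hθ (contMDiff_fst.prodMk contMDiff_const)

theorem SmoothBilinFormFamily.comp_line {Ω : Γ → BilinForm E M} (hΩ : SmoothBilinFormFamily Ω)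
    (γ : Γ) : SmoothBilinFormFamily (fun t : ℝ => Ω (t • γ)) :=
  ContMDiff.comp (g := fun p : M × Γ => Bundle.TotalSpace.mk' (E →L[ℝ] E →L[ℝ] ℝ)
      (E := fun m : M => TangentSpace 𝓘(ℝ, E) m →L[ℝ] TangentSpace 𝓘(ℝ, E) m →L[ℝ] ℝ)
      p.1 (Ω p.2 p.1))
    (f := fun p : M × ℝ => (p.1, p.2 • γ)) hΩ
    (contMDiff_fst.prodMk (contMDiff_snd.smul contMDiff_const))

theorem FormalSeries.smoothVFFamily_partialSum [FiniteDimensional ℝ Γ]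
    (R : FormalSeries Γ (SmoothVF E M)) (N : ℕ) :
    SmoothVFFamily (fun γ => (R.partialSum N γ : VF E M)) := by
  refine smoothVFFamily_of_lie fun f => ?_
  have h1 : JointlySmooth E (fun γ m => ∑ n ∈ Finset.range (N + 1), lieFun (R.term n γ) f m) :=
    JointlySmooth.sum fun n _ => (JointlySmooth.const f).mvfderiv (R.smoothVFFamily_term n)
  refine ContMDiff.congr h1 fun p => ?_
  have h2 : R.partialSum N p.2 p.1 = ∑ n ∈ Finset.range (N + 1), R.term n p.2 p.1 :=
    SmoothVF.coe_sum _ _ _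
  change mvfderiv 𝓘(ℝ, E) f p.1 (R.partialSum N p.2 p.1) = _
  rw [h2, map_sum]
  rfl

/-- Subtracting an exact form does not change the exterior derivative. -/
theorem dOneForm_sub_differential {ϑ : OneForm E M}
    (hϑ : ∀ Z : SmoothVF E M, ContMDiff 𝓘(ℝ, E) 𝓘(ℝ, ℝ) ∞ (fun m => ϑ m (Z m)))
    (g : SmoothFn E M) (X Y : SmoothVF E M) (m : M) :
    dOneForm (fun m => ϑ m - mvfderiv 𝓘(ℝ, E) g m) X Y m = dOneForm ϑ X Y m := by
  have h1 : ∀ Z W : SmoothVF E M,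
      lieFun Z (fun m => (ϑ m - mvfderiv 𝓘(ℝ, E) g m : TangentSpace 𝓘(ℝ, E) m →L[ℝ] ℝ) (W m)) m
      = lieFun Z (fun m => ϑ m (W m)) m - lieFun Z (lieFun W g) m := fun Z W =>
    lieFun_sub (f := fun m => ϑ m (W m)) (g := lieFun W g) _
      ((hϑ W).mdifferentiableAt (by simp)) ((lieD W g).mdiff m)
  have h2 : lieFun (⁅X, Y⁆ : SmoothVF E M) g m = lieFun X (lieFun Y g) m - lieFun Y (lieFun X g) m :=
    congrArg (fun f : SmoothFn E M => f m) (lieD_bracket X Y g)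
  have h3 : ∀ β : OneForm E M, dOneForm β X Y m = lieFun X (fun x => β x (Y x)) m
      - lieFun Y (fun x => β x (X x)) m - β m (⁅X, Y⁆ m) := fun _ => rfl
  rw [h3, h3, h1, h1, sub_apply]
  have h4 : mvfderiv 𝓘(ℝ, E) g m (⁅X, Y⁆ m) = lieFun (⁅X, Y⁆ : SmoothVF E M) g m := rfl
  rw [h4, h2]
  ring

end Families

variable [MulAction Circle M] [ContMDiffSMul (𝓡 1) 𝓘(ℝ, E) ∞ Circle M]

/-- At a fixed parameter, `exp(2π L_R) = 1` becomes a statement about sequences of coefficients. -/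
theorem IsRotoRate.formallyPeriodic {F : Γ → M → M} {R : FormalSeries Γ (SmoothVF E M)}
    (hR : IsRotoRate F R) (γ : Γ) : FormallyPeriodic (fun n => R.term n γ) := fun f => by
  obtain ⟨u, hu, hper⟩ := hR.periodic f
  refine ⟨fun s n => (u s).term n γ, fun n => ⟨?_, fun m s => ?_⟩, ?_, ?_⟩
  · exact ContMDiff.comp (g := fun p : ℝ × M => (u p.1).term n γ p.2)
      (f := fun p : M × ℝ => (p.2, p.1)) (hu.smooth n γ) (contMDiff_snd.prodMk contMDiff_fst)
  · refine (hu.deriv n γ m s).congr_deriv ?_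
    rw [cauchy, SmoothFn.coe_sum]
    rfl
  · exact funext fun n => hu.init n γ
  · exact funext fun n => hper n γ

theorem IsNearlyPeriodicMap.comp_line {F : Γ → M → M} {θ₀ : ℝ}
    (hF : IsNearlyPeriodicMap (E := E) F θ₀) (γ : Γ) :
    IsNearlyPeriodicMap (E := E) (fun t : ℝ => F (t • γ)) θ₀ where
  smooth := ContMDiff.comp (g := fun p : M × Γ => F p.2 p.1) (f := fun p : M × ℝ => (p.1, p.2 • γ))
    hF.smooth (contMDiff_fst.prodMk (contMDiff_snd.smul contMDiff_const))
  diffeo t := hF.diffeo (t • γ)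
  zero m := by rw [zero_smul, hF.zero]

/-- The invariance `F^*R = R` to all orders, restricted to a line in the parameter space. -/
theorem IsRotoRate.invariant_line {F : Γ → M → M} {R : FormalSeries Γ (SmoothVF E M)}
    (hR : IsRotoRate F R) (γ : Γ) (N : ℕ) (m : M) : (fun t : ℝ =>
      tangentCoord (VectorField.mpullback 𝓘(ℝ, E) 𝓘(ℝ, E) (F (t • γ))
        (lineSum (fun n => R.term n γ) N t) m)
        - tangentCoord (lineSum (fun n => R.term n γ) N t m)) =O[𝓝 0] fun t => t ^ (N + 1) := by
  have h1 : Filter.Tendsto (fun t : ℝ => t • γ) (𝓝 0) (𝓝 0) := by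
    have : Continuous fun t : ℝ => t • γ := by fun_prop
    simpa using this.tendsto 0
  have h2 := (hR.invariant m N).comp_tendsto h1
  simp only [Function.comp_def, R.partialSum_line] at h2
  refine h2.trans (Asymptotics.IsBigO.of_bound (‖γ‖ ^ (N + 1))
    (Filter.Eventually.of_forall fun t => ?_))
  rw [norm_pow, norm_norm, norm_smul, mul_pow, norm_pow, mul_comm]

variable {Ω : Γ → BilinForm E M} {F : Γ → M → M} {θ₀ : ℝ} {R : FormalSeries Γ (SmoothVF E M)}
  {θ : Γ → OneForm E M}

/-- For a Hamiltonian family, the integrals of `F_γ^*θ_γ - θ_γ` over the circle orbits vanish. -/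
theorem IsHamiltonian.integral_eq_zero (hH : IsHamiltonian F Ω)
    (hF : IsNearlyPeriodicMap (E := E) F θ₀) (hθ : SmoothOneFormFamily θ)
    (hprim : ∀ (γ : Γ) (X Y : SmoothVF E M) (m : M), Ω γ m (X m) (Y m) = -dOneForm (θ γ) X Y m)
    {R₀ : SmoothVF E M} (hR₀ : ∀ m, R₀ m = generator E m) (γ : Γ) (m : M) :
    ∫ s in (0 : ℝ)..(2 * Real.pi),
      (pullForm F θ γ (rot s m) - θ γ (rot s m) : TangentSpace 𝓘(ℝ, E) (rot s m) →L[ℝ] ℝ)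
        (R₀ (rot s m)) = 0 := by
  obtain ⟨Y, H, hY, hHs, hYH, hflow⟩ := hH
  have hline : ContMDiff (𝓘(ℝ, E).prod 𝓘(ℝ, ℝ)) (𝓘(ℝ, E).prod 𝓘(ℝ, ℝ × Γ)) ∞
      (fun p : M × ℝ => (p.1, (p.2, γ))) :=
    contMDiff_fst.prodMk ((contDiff_id.prodMk contDiff_const).contMDiff.comp contMDiff_snd)
  have hYγ : SmoothVFFamily (fun t => Y (t, γ)) :=
    ContMDiff.comp (g := fun p : M × (ℝ × Γ) => Bundle.TotalSpace.mk' E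
      (E := (TangentSpace 𝓘(ℝ, E) : M → Type _)) p.1 (Y p.2 p.1))
      (f := fun p : M × ℝ => (p.1, (p.2, γ))) hY hline
  have hHγ : JointlySmooth E (fun t => H (t, γ)) :=
    ContMDiff.comp (g := fun p : M × (ℝ × Γ) => H p.2 p.1)
      (f := fun p : M × ℝ => (p.1, (p.2, γ))) hHs hline
  have hFγ : ContMDiff 𝓘(ℝ, E) 𝓘(ℝ, E) ∞ (F γ) :=
    ContMDiff.comp (g := fun p : M × Γ => F p.2 p.1) (f := fun m => (m, γ)) hF.smooth
      (contMDiff_id.prodMk contMDiff_const)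
  let k : SmoothFn E M := ⟨_, ((hθ.pullForm_apply hF.smooth (smoothVFFamily_const R₀)).sub
    (hθ.apply (smoothVFFamily_const R₀))).slice γ⟩
  refine integral_orbit_eq_zero (hθ.const γ) hYγ hHγ (fun t Z m => ?_) hFγ (hflow γ) hR₀
    (k := k) (fun _ => rfl) m
  obtain ⟨Yt, hYt⟩ := hYγ.exists_eq t
  have h1 := hprim γ Yt Z m
  rw [← hYt, ← hYH, ← hYt, h1, neg_neg]

end NearlyPeriodic

end

theorem mainTheorem2
    {E : Type*} [NormedAddCommGroup E] [NormedSpace ℝ E] [FiniteDimensional ℝ E]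
    {M : Type*} [TopologicalSpace M] [T2Space M] [SecondCountableTopology M]
    [ChartedSpace E M] [IsManifold 𝓘(ℝ, E) ∞ M]
    {Γ : Type*} [NormedAddCommGroup Γ] [NormedSpace ℝ Γ] [FiniteDimensional ℝ Γ]
    [MulAction Circle M] [ContMDiffSMul (𝓡 1) 𝓘(ℝ, E) ∞ Circle M]
    (Ω : Γ → NearlyPeriodic.BilinForm E M)
    (hΩ : NearlyPeriodic.IsPresymplectic Ω) (hexact : NearlyPeriodic.IsExact Ω)
    (F : Γ → M → M) (θ₀ : ℝ)
    (hF : NearlyPeriodic.IsNearlyPeriodicMap (E := E) F θ₀)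
    (hnr : NearlyPeriodic.NonResonant θ₀)
    (hpres : NearlyPeriodic.PreservesForm F Ω)
    (R : NearlyPeriodic.FormalSeries Γ (NearlyPeriodic.SmoothVF E M))
    (hR : NearlyPeriodic.IsRotoRate F R)
    (hcase : NearlyPeriodic.IsHamiltonian F Ω ∨
      (ConnectedSpace M ∧ ∃ m : M, NearlyPeriodic.generator E m = 0)) :
    ∃ θ : Γ → NearlyPeriodic.OneForm E M,
      NearlyPeriodic.SmoothOneFormFamily θ ∧
      NearlyPeriodic.FormallyInvariant R θ ∧
      NearlyPeriodic.FormalPrimitive θ Ω ∧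
      NearlyPeriodic.IsAdiabaticInvariant F R θ := by
  open NearlyPeriodic in
  obtain ⟨ϑ, hϑ, hϑΩ⟩ := hexact
  have hconj : ∀ γ, ∃ W : ℕ → SmoothVF E M, W 0 = 0 ∧
      ∀ n, R.term n γ = transCoeff W n (R.term 0 γ) := fun γ =>
    ⟨normalGen (fun n => R.term n γ), by rw [normalGen],
      eq_transCoeff_normalGen (hR.limiting γ) (hR.formallyPeriodic γ)⟩
  obtain ⟨g, hg, hμ⟩ := exists_normalizing_function hϑ hR.limiting hconj
  -- The choice of `g` makes `ι_R θ` invariant under `L_R`.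
  let θ : Γ → OneForm E M := fun γ m => ϑ γ m - mvfderiv 𝓘(ℝ, E) (g γ) m
  have hθ : SmoothOneFormFamily θ := hϑ.sub hg.smoothOneFormFamily
  have hprim : ∀ (γ : Γ) (X Y : SmoothVF E M) (m : M), Ω γ m (X m) (Y m) = -dOneForm (θ γ) X Y m :=
    fun γ X Y m => by
      rw [hϑΩ γ X Y m, ← dOneForm_sub_differential
        (fun Z => (hϑ.apply (smoothVFFamily_const Z)).slice γ) ⟨g γ, hg.slice γ⟩]
      rfl
  -- All formal identities are verified along the lines `t ↦ t γ`.
  have hline : ∀ γ, IsNormalizedLine (fun t : ℝ => F (t • γ)) θ₀ (fun t => θ (t • γ))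
      (fun t => Ω (t • γ)) (fun n => R.term n γ) := fun γ =>
    { map := hF.comp_line γ
      smooth := hθ.comp_line γ
      smooth₂ := hΩ.smooth.comp_line γ
      primitive := fun t => hprim (t • γ)
      preserves := fun t => hpres (t • γ)
      generator := hR.limiting γ
      conj := hconj γ
      invariant := hR.invariant_line γ
      moment := hμ γ }
  have hmoment : ∀ N, JointlySmooth E (fun γ m => θ γ m (R.partialSum N γ m)) := fun N =>
    hθ.apply (R.smoothVFFamily_partialSum N)
  choose b hb hbt using fun γ => exists_taylorForm (hline γ).jointlySmooth_apply
  choose k hk hkt using fun γ => exists_taylorForm (hline γ).jointlySmooth_kappa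
  -- `b` and `k` are the Taylor coefficients of `θ` and of `F^*θ - θ`.
  have hδ := fun γ n => (hline γ).defect_eq_zero (hk γ) (hb γ) (hbt γ) hnr n
  have hν : ∀ γ n, cauchy LinearMap.id (k γ) (fun n => R.term n γ) n = 0 := fun γ => by
    rcases hcase with hH | ⟨_, m₀, hm₀⟩
    · exact (hline γ).nu_eq_zero_of_integral (hk γ) (fun n => (hδ γ n).2) fun t m =>
        hH.integral_eq_zero hF hθ hprim (hR.limiting γ) (t • γ) m
    · exact (hline γ).nu_eq_zero_of_connected (hk γ) (fun n => (hδ γ n).2) (hkt γ) hm₀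
  refine ⟨θ, hθ, fun Y m N => ?_, fun X Y m N => ?_, fun m N => ?_⟩
  -- `L_R θ = 0`
  · refine isBigO_of_lines (N := N + 1) ?_ fun γ => ?_
    · have h1 := (((hmoment N).lie Y).sub (hΩ.smooth.apply (R.smoothVFFamily_partialSum N)
        (smoothVFFamily_const Y))).param m
      convert! h1 using 2 with γ
      beta_reduce
      rw [hprim γ (R.partialSum N γ) Y m, dOneForm, lieOneForm]
      ring
    · have h1 := hasTaylorUpTo_lieOneForm (hb γ) (fun n => R.term n γ) N Y
      refine ((h1.isBigO_iff m).2 fun n _ => ?_).congr_left fun t => ?_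
      · rw [(hδ γ n).1]
        rfl
      · beta_reduce
        rw [R.partialSum_line]
  -- `-dθ = Ω` holds exactly
  · refine (Asymptotics.isBigO_zero _ _).congr_left fun γ => ?_
    beta_reduce
    rw [hprim γ X Y m]
    ring
  -- `F^*μ = μ`
  · refine isBigO_of_lines (N := N + 1) ?_ fun γ => ?_
    · exact (((hmoment N).comp_map hF.smooth).sub (hmoment N)).param m
    · refine ((((hline γ).hasTaylorUpTo_nu (hk γ) N).isBigO_iff m).2 fun n _ => ?_).congr_left
        fun t => ?_
      · rw [hν γ n]
        rfl
      · simp only [lineMoment, momentTrunc, R.partialSum_line]
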